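/- Let $k$ be an algebraically closed field and let $X$ be the union of two smooth, connected, projective curves $Y$ and $Z$ over $k$, meeting transversally at a single point $P$. Let $d\ge 0$ and $r\ge 0$ be integers, and let $\mathcal L$ be a line bundle on $X$ of degree $d$ on $Y$ and degree $0$ on $Z$. Call two line bundles $\mathcal L_1,\mathcal L_2$ on $X$ equivalent if, for some integer $j$, $\mathcal L_1|_Y\cong\mathcal L_2|_Y(-jP)$ and $\mathcal L_1|_Z\cong\mathcal L_2|_Z(jP)$. Let $S^d(X)$ be the $d$-th symmetric product of $X$, whose points are the effective $0$-cycles of degree $d$ on $X$. The degree-$d$ Abel map $A_d$ sends $D=D_Y+D_Z$, with $D_Y$ supported on $Y$ and $D_Z$ supported on $Z$, to the equivalence class of the line bundle with restrictions $\mathcal O_Y(D_Y)$ and $\mathcal O_Z(D_Z)$ to $Y$ and $Z$; this class does not depend on the decomposition of $D$. Let $A_d^{-1}(\mathcal L)\subseteq S^d(X)$ be the fiber over the class of $\mathcal L$, with the Zariski topology. For $i=0,\dots,d$ let $\mathcal L^i$ be the line bundle on $X$ with restrictions $\mathcal L|_Y(-iP)$ and $\mathcal L|_Z(iP)$, let $\varphi^i:\mathcal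 L^i\to\mathcal L^{i+1}$ be restriction to $Z$ followed by the inclusion $\mathcal L^i|_Z=\mathcal L^{i+1}|_Z(-P)\to\mathcal L^{i+1}$ (extension by zero), and let $\varphi_i:\mathcal L^{i+1}\to\mathcal L^i$ be restriction to $Y$ followed by the inclusion $\mathcal L^{i+1}|_Y=\mathcal L^i|_Y(-P)\to\mathcal L^i$. A limit linear series on $X$ of degree $d$ and dimension $r$ with underlying line bundle $\mathcal L$ is a collection of subspaces $V_i\subseteq\Gamma(X,\mathcal L^i)$, $i=0,\dots,d$, each of dimension $r+1$, such that $\varphi^i(V_i)\subseteq V_{i+1}$ and $\varphi_i(V_{i+1})\subseteq V_i$ for $0\le i<d$. An Eisenbud–Harris limit linear series on $X$ of degree $d$ and dimension $r$ with underlying line bundle $\mathcal L$ is a pair of subspaces $V^Y\subseteq\Gamma(Y,\mathcal L|_Y)$ and $V^Z\subseteq\Gamma(Z,\mathcal L|_Z(dP))$, each of dimension $r+1$, such that, if $a^Y_0<\dots<a^Y_r$ and $a^Z_0<\dots<a^Z_r$ are the orders of vanishing at $P$ of the nonzero sections in $V^Y$ and in $V^Z$ respectively, then $a^Y_i+a^Z_{r-i}\ge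 d$ for $i=0,\dots,r$. Suppose that $A_d^{-1}(\mathcal L)$ has an irreducible component of dimension strictly less than $r$. Then there is no limit linear series on $X$ of degree $d$ and dimension $r$ with underlying line bundle $\mathcal L$, and there is no Eisenbud–Harris limit linear series on $X$ of degree $d$ and dimension $r$ with underlying line bundle $\mathcal L$. -/

import Mathlib

open CategoryTheory AlgebraicGeometry

noncomputable section

namespace AbelLLS

universe u

/-- The `k`-rational points of a `k`-scheme, as sections of the structure morphism.  (Over an
algebraically closed field, and for schemes of finite type, these are the closed points.) -/
abbrev KPoint {k : Type u} [Field k] {S : Scheme.{u}} (f : S ⟶ Spec (.of k)) : Type u :=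
  {p : Spec (.of k) ⟶ S // p ≫ f = 𝟙 _}

/-- The point of the underlying topological space given by a rational point. -/
def KPoint.pt {k : Type u} [Field k] {S : Scheme.{u}} {f : S ⟶ Spec (.of k)} (p : KPoint f) : S :=
  p.1 (IsLocalRing.closedPoint k)

/-! ### Smooth projective curves, divisors and sections of line bundles -/

/-- A smooth, complete, connected curve over `k`. -/
structure SmoothCurve (k : Type u) [Field k] where
  /-- the underlying scheme -/
  scheme : Scheme.{u}
  /-- the structure morphism -/
  str : scheme ⟶ Spec (.of k)
  [integral : IsIntegral scheme]
  [smooth : SmoothOfRelativeDimension 1 str]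
  [proper : IsProper str]

namespace SmoothCurve

variable {k : Type u} [Field k] (C : SmoothCurve k)

instance : IsIntegral C.scheme := C.integral

instance : SmoothOfRelativeDimension 1 C.str := C.smooth

instance : IsProper C.str := C.proper

instance : IsLocallyNoetherian C.scheme := LocallyOfFiniteType.isLocallyNoetherian C.str

/-- The function field of the curve. -/
abbrev FunctionField : Type u := C.scheme.functionField

instance : Algebra k C.FunctionField :=
  ((Scheme.ΓSpecIso (.of k)).inv ≫ C.str.appTop ≫
    C.scheme.presheaf.germ ⊤ (genericPoint C.scheme) trivial).hom.toAlgebra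

/-- The closed points of the curve. -/
abbrev Point : Type u := KPoint C.str

/-- The order of vanishing of a rational function at a point (junk value `0` for `f = 0`). -/
def ord (f : C.FunctionField) (p : C.Point) : ℤ := Scheme.ord f p.pt

/-- `f` vanishes to order at least `n` at `p`; the zero function does so for every `n`. -/
def OrdGE (f : C.FunctionField) (p : C.Point) (n : ℤ) : Prop := f = 0 ∨ n ≤ C.ord f p

/-- Divisors on the curve.  On a smooth curve every line bundle is isomorphic to `𝒪(D)` for a
divisor `D`; here `𝒪(D)` is the usual subsheaf of the sheaf of rational functions, of functions
whose order at each point `p` is at least `-D p`. -/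
abbrev Divisor : Type u := C.Point →₀ ℤ

/-- The degree of a divisor `D`, that is, of the line bundle `𝒪(D)`. -/
def deg (D : C.Divisor) : ℤ := D.sum fun _ n => n

/-- Linear equivalence of divisors: `D - E` is the divisor of a nonzero rational function; this is
equivalent to `𝒪(D) ≅ 𝒪(E)`. -/
def LinEquiv (D E : C.Divisor) : Prop :=
  ∃ f : C.FunctionField, f ≠ 0 ∧ ∀ p, D p - E p = C.ord f p

/-- The global sections of `𝒪(D)`. -/
def sections (D : C.Divisor) : Set C.FunctionField := {f | ∀ p, C.OrdGE f p (-D p)}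

/-- `V` is a linear series in the line bundle `𝒪(D)`, of dimension `r`. -/
def IsLinearSeries (D : C.Divisor) (r : ℕ) (V : Submodule k C.FunctionField) : Prop :=
  (V : Set C.FunctionField) ⊆ C.sections D ∧ Module.finrank k V = r + 1

/-- `a 0 < a 1 < ⋯ < a r` is the vanishing sequence at `p` of the space `V` of sections of
`𝒪(D)`: the increasing enumeration of the orders of vanishing at `p` of the nonzero elements of
`V`.  The order at `p` of `f`, as a section of `𝒪(D)`, is `ord f p + D p`. -/
def IsVanishingSequence (D : C.Divisor) (V : Submodule k C.FunctionField) (p : C.Point) {r : ℕ}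
    (a : Fin (r + 1) → ℤ) : Prop :=
  StrictMono a ∧ Set.range a = {n | ∃ f ∈ V, f ≠ 0 ∧ n = C.ord f p + D p}

theorem ord_one (p : C.Point) : C.ord 1 p = 0 := by
  have h := Scheme.ord_mul (x := p.pt) (one_ne_zero (α := C.FunctionField)) one_ne_zero
  rw [mul_one] at h
  unfold ord
  omega

theorem ord_mul {f g : C.FunctionField} (hf : f ≠ 0) (hg : g ≠ 0) (p : C.Point) :
    C.ord (f * g) p = C.ord f p + C.ord g p := Scheme.ord_mul hf hg

theorem ord_inv {f : C.FunctionField} (hf : f ≠ 0) (p : C.Point) :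
    C.ord f⁻¹ p = - C.ord f p := by
  have h := C.ord_mul hf (inv_ne_zero hf) p
  rw [mul_inv_cancel₀ hf, ord_one] at h
  omega

theorem LinEquiv.refl (D : C.Divisor) : C.LinEquiv D D :=
  ⟨1, one_ne_zero, fun p => by rw [ord_one, sub_self]⟩

theorem LinEquiv.symm {D E : C.Divisor} (h : C.LinEquiv D E) : C.LinEquiv E D := by
  obtain ⟨f, hf, h⟩ := h
  exact ⟨f⁻¹, inv_ne_zero hf, fun p => by rw [ord_inv C hf, ← h p, neg_sub]⟩

theorem LinEquiv.trans {D E F : C.Divisor} (h : C.LinEquiv D E) (h' : C.LinEquiv E F) :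
    C.LinEquiv D F := by
  obtain ⟨f, hf, h⟩ := h
  obtain ⟨g, hg, h'⟩ := h'
  exact ⟨f * g, mul_ne_zero hf hg, fun p => by rw [ord_mul C hf hg, ← h p, ← h' p]; ring⟩

theorem LinEquiv.add {D E D' E' : C.Divisor} (h : C.LinEquiv D E) (h' : C.LinEquiv D' E') :
    C.LinEquiv (D + D') (E + E') := by
  obtain ⟨f, hf, h⟩ := h
  obtain ⟨g, hg, h'⟩ := h'
  refine ⟨f * g, mul_ne_zero hf hg, fun p => ?_⟩
  rw [ord_mul C hf hg, ← h p, ← h' p, Finsupp.add_apply, Finsupp.add_apply]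
  ring

end SmoothCurve

/-! ### Two smooth curves meeting transversally at one point -/

/-- The union of two smooth complete curves `Y` and `Z` meeting transversally at one point.
It is a reduced complete `k`-scheme, covered by closed subschemes `Y` and `Z` whose
scheme-theoretic intersection is one reduced rational point, the node `P`. -/
structure NodalCurve (k : Type u) [Field k] where
  /-- the first component -/
  Y : SmoothCurve k
  /-- the second component -/
  Z : SmoothCurve k
  /-- the underlying scheme -/
  scheme : Scheme.{u}
  /-- the structure morphism -/
  str : scheme ⟶ Spec (.of k)
  [reduced : IsReduced scheme]
  [proper : IsProper str]
  /-- the inclusion of the first component -/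
  inclY : Y.scheme ⟶ scheme
  /-- the inclusion of the second component -/
  inclZ : Z.scheme ⟶ scheme
  inclY_str : inclY ≫ str = Y.str
  inclZ_str : inclZ ≫ str = Z.str
  [closedY : IsClosedImmersion inclY]
  [closedZ : IsClosedImmersion inclZ]
  cover : Set.range inclY ∪ Set.range inclZ = Set.univ
  /-- the node `P`, as a point of the first component -/
  nodeY : Y.Point
  /-- the node `P`, as a point of the second component -/
  nodeZ : Z.Point
  isPullback : IsPullback nodeY.1 nodeZ.1 inclY inclZ

namespace NodalCurve

variable {k : Type u} [Field k] (X : NodalCurve k)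

instance : IsReduced X.scheme := X.reduced

instance : IsProper X.str := X.proper

instance : IsClosedImmersion X.inclY := X.closedY

instance : IsClosedImmersion X.inclZ := X.closedZ

/-- The closed points of `X`. -/
abbrev Point : Type u := KPoint X.str

/-- The inclusion of `Y` in `X`, on closed points. -/
def pointY (p : X.Y.Point) : X.Point :=
  ⟨p.1 ≫ X.inclY, by rw [Category.assoc, X.inclY_str, p.2]⟩

/-- The inclusion of `Z` in `X`, on closed points. -/
def pointZ (p : X.Z.Point) : X.Point :=
  ⟨p.1 ≫ X.inclZ, by rw [Category.assoc, X.inclZ_str, p.2]⟩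

theorem pointY_injective : Function.Injective X.pointY := fun _ _ h =>
  Subtype.ext ((cancel_mono X.inclY).mp (congrArg Subtype.val h))

theorem pointZ_injective : Function.Injective X.pointZ := fun _ _ h =>
  Subtype.ext ((cancel_mono X.inclZ).mp (congrArg Subtype.val h))

/-! ### The symmetric product -/

/-- The `d`-fold fibre product of `X` over `k`. -/
def power (d : ℕ) : Scheme.{u} :=
  Limits.widePullback (Spec (.of k)) (fun _ : Fin d => X.scheme) (fun _ => X.str)

/-- The `d`-tuple of closed points of `X`, as a point of the underlying space of `X ×ₖ ⋯ ×ₖ X`. -/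
def tuplePt (d : ℕ) (x : Fin d → X.Point) : X.power d :=
  (Limits.WidePullback.lift (𝟙 (Spec (.of k))) (fun i => (x i).1) (fun i => (x i).2) :
    Spec (.of k) ⟶ X.power d) (IsLocalRing.closedPoint k)

/-- The Zariski topology on the set of closed points of `X ×ₖ ⋯ ×ₖ X`. -/
abbrev powerTopology (d : ℕ) : TopologicalSpace (Fin d → X.Point) :=
  TopologicalSpace.induced (X.tuplePt d) inferInstance

/-- (The closed points of) the symmetric product `S^d(X)`: the effective `0`-cycles of degree `d`
on `X`. -/
def SymProd (d : ℕ) : Type u := Sym X.Point d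

/-- The quotient map `X ×ₖ ⋯ ×ₖ X → S^d(X)`, `(x₁, …, x_d) ↦ x₁ + ⋯ + x_d`. -/
def cycle (d : ℕ) (x : Fin d → X.Point) : X.SymProd d :=
  Sym.mk (Finset.univ.val.map x) (by simp)

/-- The Zariski topology on `S^d(X)`: the quotient topology for the quotient of the `d`-fold
product by the symmetric group. -/
instance (d : ℕ) : TopologicalSpace (X.SymProd d) :=
  TopologicalSpace.coinduced (X.cycle d) (X.powerTopology d)

/-! ### Line bundles on `X` and the Abel map -/

/-- A line bundle on `X`, given by its restrictions `𝒪(divY)` and `𝒪(divZ)` to `Y` and `Z`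
together with the isomorphism of their fibres at the node along which they are glued: the one that
matches the values at the node of the local generators `genY` and `genZ`. Every line bundle on `X`
is isomorphic to one of this form. -/
structure LineBundle where
  /-- the restriction to `Y` -/
  divY : X.Y.Divisor
  /-- the restriction to `Z` -/
  divZ : X.Z.Divisor
  /-- a generator of the stalk at the node of the restriction to `Y` -/
  genY : X.Y.FunctionField
  /-- a generator of the stalk at the node of the restriction to `Z` -/
  genZ : X.Z.FunctionField
  genY_ne_zero : genY ≠ 0
  genZ_ne_zero : genZ ≠ 0
  ord_genY : X.Y.ord genY X.nodeY = - divY X.nodeY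
  ord_genZ : X.Z.ord genZ X.nodeZ = - divZ X.nodeZ

/-- The global sections of a line bundle on `X`: pairs of global sections of the restrictions to
`Y` and to `Z` that have the same value at the node, that is, differ from the same multiple `c` of
the chosen generators by sections vanishing at the node. -/
def LineBundle.sections {X : NodalCurve k} (L : X.LineBundle) :
    Set (X.Y.FunctionField × X.Z.FunctionField) :=
  {s | s.1 ∈ X.Y.sections L.divY ∧ s.2 ∈ X.Z.sections L.divZ ∧
    ∃ c : k, X.Y.OrdGE (s.1 - c • L.genY) X.nodeY (1 - L.divY X.nodeY) ∧
      X.Z.OrdGE (s.2 - c • L.genZ) X.nodeZ (1 - L.divZ X.nodeZ)}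

/-- Equivalence of line bundles on `X`, in terms of their restrictions `(𝒪(D₁), 𝒪(D₂))` and
`(𝒪(E₁), 𝒪(E₂))` to `Y` and `Z`, which determine them up to isomorphism:
`𝒪(D₁) ≅ 𝒪(E₁)(-jP)` and `𝒪(D₂) ≅ 𝒪(E₂)(jP)` for some integer `j`. -/
def Equivalent (D E : X.Y.Divisor × X.Z.Divisor) : Prop :=
  ∃ j : ℤ, X.Y.LinEquiv D.1 (E.1 - Finsupp.single X.nodeY j) ∧
    X.Z.LinEquiv D.2 (E.2 + Finsupp.single X.nodeZ j)

theorem Equivalent.equivalence : Equivalence X.Equivalent where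
  refl D := ⟨0, by simpa using SmoothCurve.LinEquiv.refl _ _,
    by simpa using SmoothCurve.LinEquiv.refl _ _⟩
  symm := by
    rintro D E ⟨j, h₁, h₂⟩
    refine ⟨-j, ?_, ?_⟩
    · have h := (h₁.symm).add _ (.refl _ (Finsupp.single X.nodeY j))
      simpa using h
    · have h := (h₂.symm).add _ (.refl _ (-Finsupp.single X.nodeZ j))
      simpa using h
  trans := by
    rintro D E F ⟨j, h₁, h₂⟩ ⟨i, h₁', h₂'⟩
    refine ⟨i + j, ?_, ?_⟩
    · have h := h₁'.add _ (.refl _ (-Finsupp.single X.nodeY j))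
      rw [← sub_eq_add_neg] at h
      refine (h₁.trans _ h).trans _ ?_
      rw [Finsupp.single_add, ← sub_eq_add_neg, sub_sub]
      exact .refl _ _
    · have h := h₂'.add _ (.refl _ (Finsupp.single X.nodeZ j))
      refine (h₂.trans _ h).trans _ ?_
      rw [Finsupp.single_add, add_assoc]
      exact .refl _ _

/-- The set of equivalence classes of line bundles on `X`. (The classes of total degree `d` are
the points of the target of the degree-`d` Abel map.) -/
def PicClass : Type u := Quotient (⟨X.Equivalent, Equivalent.equivalence X⟩ : Setoid _)

/-- The class of the line bundles with restrictions `𝒪(D.1)` to `Y` and `𝒪(D.2)` to `Z`. -/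
def picClass (D : X.Y.Divisor × X.Z.Divisor) : X.PicClass :=
  Quotient.mk (⟨X.Equivalent, Equivalent.equivalence X⟩ : Setoid _) D

open scoped Classical in
/-- The part on `Y` of a `0`-cycle on `X`, viewed as a divisor on `Y`; it includes the node. -/
def partY {d : ℕ} (D : X.SymProd d) : X.Y.Divisor :=
  ((Multiset.toFinsupp (D : Sym X.Point d).1).comapDomain X.pointY
    X.pointY_injective.injOn).mapRange (fun n : ℕ => (n : ℤ)) Nat.cast_zero

open scoped Classical in
/-- The rest of the `0`-cycle: its part on `Z` away from the node, viewed as a divisor on `Z`. -/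
def partZ {d : ℕ} (D : X.SymProd d) : X.Z.Divisor :=
  (((Multiset.toFinsupp (D : Sym X.Point d).1).comapDomain X.pointZ
    X.pointZ_injective.injOn).erase X.nodeZ).mapRange (fun n : ℕ => (n : ℤ)) Nat.cast_zero

/-- The degree-`d` Abel map: a `0`-cycle `D = D_Y + D_Z`, with `D_Y` supported on `Y` and `D_Z`
supported on `Z`, is sent to the class of the line bundle with restrictions `𝒪(D_Y)` to `Y` and
`𝒪(D_Z)` to `Z`. (Moving the node from `D_Y` to `D_Z` does not change the class.) -/
def abelMap (d : ℕ) (D : X.SymProd d) : X.PicClass := X.picClass (X.partY D, X.partZ D)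

/-- The fibre `A_d⁻¹(L)` of the degree-`d` Abel map, as a subspace of `S^d(X)`. -/
def abelFiber (d : ℕ) (L : X.LineBundle) : Set (X.SymProd d) :=
  X.abelMap d ⁻¹' {X.picClass (L.divY, L.divZ)}

/-! ### Limit linear series -/

/-- The map `φ^i : L^i → L^{i+1}` on sections: restriction to `Z` followed by extension by zero. -/
def phiUp : (X.Y.FunctionField × X.Z.FunctionField) →ₗ[k]
    (X.Y.FunctionField × X.Z.FunctionField) :=
  LinearMap.inr k _ _ ∘ₗ LinearMap.snd k _ _

/-- The map `φ_i : L^{i+1} → L^i` on sections: restriction to `Y` followed by extension by zero. -/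
def phiDown : (X.Y.FunctionField × X.Z.FunctionField) →ₗ[k]
    (X.Y.FunctionField × X.Z.FunctionField) :=
  LinearMap.inl k _ _ ∘ₗ LinearMap.fst k _ _

/-- A limit linear series on `X` of degree `d` and dimension `r`, with underlying line bundle `L`
(of degree `d` on `Y` and degree `0` on `Z`). -/
structure LimitLinearSeries (d r : ℕ) (L : X.LineBundle) where
  /-- the line bundles `L^i`, with restrictions `L|_Y(-iP)` and `L|_Z(iP)` -/
  bundle : Fin (d + 1) → X.LineBundle
  bundle_zero : bundle 0 = L
  divY_bundle : ∀ i, (bundle i).divY = L.divY - Finsupp.single X.nodeY (i : ℤ)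
  divZ_bundle : ∀ i, (bundle i).divZ = L.divZ + Finsupp.single X.nodeZ (i : ℤ)
  /-- the spaces of sections `V_i` -/
  V : Fin (d + 1) → Submodule k (X.Y.FunctionField × X.Z.FunctionField)
  V_sections : ∀ i, (V i : Set (X.Y.FunctionField × X.Z.FunctionField)) ⊆ (bundle i).sections
  finrank_V : ∀ i, Module.finrank k (V i) = r + 1
  map_up : ∀ i : Fin d, (V i.castSucc).map X.phiUp ≤ V i.succ
  map_down : ∀ i : Fin d, (V i.succ).map X.phiDown ≤ V i.castSucc

/-- An Eisenbud–Harris limit linear series on `X` of degree `d` and dimension `r`, with underlying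
line bundle `L` (of degree `d` on `Y` and degree `0` on `Z`): a linear series in `L|_Y` and one in
`L|_Z(dP)`, with vanishing sequences at the node satisfying the compatibility inequalities. -/
structure EHLimitLinearSeries (d r : ℕ) (L : X.LineBundle) where
  /-- the linear series on `Y` -/
  VY : Submodule k X.Y.FunctionField
  /-- the linear series on `Z` -/
  VZ : Submodule k X.Z.FunctionField
  isLinearSeriesY : X.Y.IsLinearSeries L.divY r VY
  isLinearSeriesZ : X.Z.IsLinearSeries (L.divZ + Finsupp.single X.nodeZ (d : ℤ)) r VZ
  /-- the vanishing sequence on `Y` -/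
  aY : Fin (r + 1) → ℤ
  /-- the vanishing sequence on `Z` -/
  aZ : Fin (r + 1) → ℤ
  isVanishingSequenceY : X.Y.IsVanishingSequence L.divY VY X.nodeY aY
  isVanishingSequenceZ :
    X.Z.IsVanishingSequence (L.divZ + Finsupp.single X.nodeZ (d : ℤ)) VZ X.nodeZ aZ
  le_add : ∀ i, (d : ℤ) ≤ aY i + aZ i.rev

end NodalCurve

end AbelLLS

end

noncomputable section

/-- A system of discrete valuations `ord · p`, `p ∈ P`, of a field `K` over `k`, behaving like the
orders of vanishing at the points of a smooth complete curve over `k` with function field `K`. -/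
structure OrdSystem (k : Type*) {K P : Type*} [Field k] [Field K] [Algebra k K]
    (ord : K → P → ℤ) : Prop where
  mul : ∀ {f g : K} (p : P), f ≠ 0 → g ≠ 0 → ord (f * g) p = ord f p + ord g p
  add : ∀ {f g : K} (p : P), f ≠ 0 → g ≠ 0 → f + g ≠ 0 → min (ord f p) (ord g p) ≤ ord (f + g) p
  const : ∀ (c : k) (p : P), c ≠ 0 → ord (algebraMap k K c) p = 0
  residue : ∀ {f : K} (p : P), f ≠ 0 → 0 ≤ ord f p →
    ∃ c : k, f = algebraMap k K c ∨ 1 ≤ ord (f - algebraMap k K c) p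
  uniformizer : ∀ p : P, ∃ u : K, u ≠ 0 ∧ ord u p = 1
  finite_support : ∀ f : K, f ≠ 0 → {p | ord f p ≠ 0}.Finite
  center : ∀ A : ValuationSubring K, (∀ c : k, algebraMap k K c ∈ A) →
    ∃ p, ∀ f, f ≠ 0 → 0 ≤ ord f p → f ∈ A
  separated : ∀ p q : P, p ≠ q → ∃ f : K, f ≠ 0 ∧ 0 ≤ ord f p ∧ ord f q < 0

theorem IsAlgClosed.exists_algebraMap_eq_of_isIntegral {k K : Type*} [Field k] [IsAlgClosed k]
    [Field K] [Algebra k K] {f : K} (hf : IsIntegral k f) : ∃ c : k, f = algebraMap k K c := by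
  obtain ⟨c, hc⟩ := minpoly.mem_range_of_degree_eq_one k f
    (IsAlgClosed.degree_eq_one_of_irreducible k (minpoly.irreducible hf))
  exact ⟨c, hc.symm⟩

namespace OrdSystem

variable {k K P : Type*} [Field k] [Field K] [Algebra k K] {ord : K → P → ℤ}

/-- `f` has order at least `n` at `p`. -/
def GE (_ : OrdSystem k ord) (f : K) (p : P) (n : ℤ) : Prop := f = 0 ∨ n ≤ ord f p

variable (H : OrdSystem k ord)
include H

theorem one (p : P) : ord 1 p = 0 := by
  simpa using H.const 1 p one_ne_zero

theorem neg (f : K) (p : P) : ord (-f) p = ord f p := by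
  by_cases hf : f = 0
  · simp [hf]
  have h1 : ord (-1) p = 0 := by
    simpa using H.const (-1) p (by simp)
  rw [← neg_one_mul, H.mul p (by simp) hf, h1, zero_add]

theorem inv {f : K} (hf : f ≠ 0) (p : P) : ord f⁻¹ p = - ord f p := by
  have := H.mul p hf (inv_ne_zero hf)
  rw [mul_inv_cancel₀ hf, H.one] at this
  omega

theorem div {f g : K} (hf : f ≠ 0) (hg : g ≠ 0) (p : P) : ord (f / g) p = ord f p - ord g p := by
  rw [div_eq_mul_inv, H.mul p hf (inv_ne_zero hg), H.inv hg]; ring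

theorem pow {f : K} (hf : f ≠ 0) (p : P) (n : ℕ) : ord (f ^ n) p = n * ord f p := by
  induction n with
  | zero => simp [H.one]
  | succ n ih => rw [pow_succ, H.mul p (pow_ne_zero _ hf) hf, ih]; push_cast; ring

theorem ge_zero (p : P) (n : ℤ) : H.GE 0 p n := Or.inl rfl

theorem ge_iff {f : K} (hf : f ≠ 0) {p : P} {n : ℤ} : H.GE f p n ↔ n ≤ ord f p := by
  simp [GE, hf]

theorem ge_mono {f : K} {p : P} {m n : ℤ} (h : H.GE f p n) (hm : m ≤ n) : H.GE f p m :=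
  h.imp_right hm.trans

theorem ge_add {f g : K} {p : P} {n : ℤ} (hf : H.GE f p n) (hg : H.GE g p n) :
    H.GE (f + g) p n := by
  by_cases hf0 : f = 0
  · simpa [hf0] using hg
  by_cases hg0 : g = 0
  · simpa [hg0] using hf
  by_cases hfg : f + g = 0
  · exact Or.inl hfg
  rw [H.ge_iff hf0] at hf
  rw [H.ge_iff hg0] at hg
  exact Or.inr ((le_min hf hg).trans (H.add p hf0 hg0 hfg))

theorem ge_mul {f g : K} {p : P} {m n : ℤ} (hf : H.GE f p m) (hg : H.GE g p n) :
    H.GE (f * g) p (m + n) := by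
  by_cases hf0 : f = 0
  · exact Or.inl (by simp [hf0])
  by_cases hg0 : g = 0
  · exact Or.inl (by simp [hg0])
  rw [H.ge_iff hf0] at hf
  rw [H.ge_iff hg0] at hg
  exact Or.inr (by rw [H.mul p hf0 hg0]; omega)

theorem ge_neg {f : K} {p : P} {n : ℤ} (hf : H.GE f p n) : H.GE (-f) p n := by
  rcases hf with rfl | h
  · exact Or.inl (by simp)
  · exact Or.inr (by rwa [H.neg])

theorem ge_sub {f g : K} {p : P} {n : ℤ} (hf : H.GE f p n) (hg : H.GE g p n) :
    H.GE (f - g) p n := by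
  rw [sub_eq_add_neg]; exact H.ge_add hf (H.ge_neg hg)

theorem ge_const (c : k) (p : P) : H.GE (algebraMap k K c) p 0 := by
  by_cases hc : c = 0
  · exact Or.inl (by simp [hc])
  · exact Or.inr (H.const c p hc).ge

theorem ge_smul {f : K} {p : P} {n : ℤ} (c : k) (hf : H.GE f p n) : H.GE (c • f) p n := by
  rw [Algebra.smul_def]
  simpa using H.ge_mul (H.ge_const c p) hf

/-- The order of a sum of two functions of different orders. -/
theorem add_eq_of_lt {f g : K} (hf : f ≠ 0) {p : P} (hg : H.GE g p (ord f p + 1)) :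
    f + g ≠ 0 ∧ ord (f + g) p = ord f p := by
  have hne : f + g ≠ 0 := by
    intro h
    have : f = -g := eq_neg_of_add_eq_zero_left h
    have h2 := H.ge_neg hg
    rw [← this, H.ge_iff hf] at h2
    omega
  refine ⟨hne, le_antisymm ?_ ?_⟩
  · by_contra hlt
    push Not at hlt
    have h1 : H.GE (f + g) p (ord f p + 1) := Or.inr (by omega)
    have h2 := H.ge_sub h1 hg
    rw [add_sub_cancel_right, H.ge_iff hf] at h2
    omega
  · exact (H.ge_iff hne).1 (H.ge_add (Or.inr le_rfl) (H.ge_mono hg (by omega)))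

/-- Leading coefficients: two functions of order at least `n`, the first exactly `n`. -/
theorem exists_ge_succ {f g : K} {p : P} {n : ℤ} (hf : f ≠ 0) (hfn : ord f p = n)
    (hg : H.GE g p n) : ∃ c : k, H.GE (g - c • f) p (n + 1) := by
  by_cases hg0 : g = 0
  · exact ⟨0, Or.inl (by simp [hg0])⟩
  rw [H.ge_iff hg0] at hg
  have h0 : g / f ≠ 0 := div_ne_zero hg0 hf
  obtain ⟨c, hc⟩ := H.residue p h0 (by rw [H.div hg0 hf]; omega)
  refine ⟨c, ?_⟩
  have hc' : H.GE (g / f - algebraMap k K c) p 1 := hc.imp_left sub_eq_zero.2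
  have := H.ge_mul hc' (Or.inr hfn.ge : H.GE f p n)
  rwa [sub_mul, div_mul_cancel₀ _ hf, ← Algebra.smul_def, add_comm] at this

/-- The functions of order at least `D p` at every `p`. -/
def sectionSpace (D : P → ℤ) : Submodule k K where
  carrier := {f | ∀ p, H.GE f p (- D p)}
  add_mem' hf hg p := H.ge_add (hf p) (hg p)
  zero_mem' p := H.ge_zero p _
  smul_mem' c _ hf p := H.ge_smul c (hf p)

end OrdSystem

/-- A space `N'` that is spanned over `N` by any of its elements outside `N`. -/
theorem Submodule.finrank_le_succ_of_forall_exists {k V : Type*} [Field k] [AddCommGroup V]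
    [Module k V] {N N' : Submodule k V} [FiniteDimensional k N] (hle : N ≤ N')
    (h : ∀ x ∈ N', x ∉ N → ∀ y ∈ N', ∃ c : k, y - c • x ∈ N) :
    FiniteDimensional k N' ∧ Module.finrank k N' ≤ Module.finrank k N + 1 := by
  by_cases hN : N' ≤ N
  · have : N' = N := le_antisymm hN hle
    subst this
    exact ⟨inferInstance, by omega⟩
  obtain ⟨x, hx, hxN⟩ := Set.not_subset.1 hN
  have hle' : N' ≤ N ⊔ span k {x} := by
    intro y hy
    obtain ⟨c, hc⟩ := h x hx hxN y hy
    have := add_mem (mem_sup_left hc : y - c • x ∈ N ⊔ span k {x})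
      (mem_sup_right (mem_span_singleton.2 ⟨c, rfl⟩))
    simpa using this
  have hfin : FiniteDimensional k N' := finiteDimensional_of_le hle'
  refine ⟨hfin, ?_⟩
  calc Module.finrank k N' ≤ Module.finrank k ↥(N ⊔ span k {x}) := finrank_mono hle'
    _ ≤ Module.finrank k N + Module.finrank k (span k {x}) := finrank_add_le_finrank_add_finrank _ _
    _ ≤ _ := by
      have := finrank_span_le_card (R := k) ({x} : Set V)
      simp at this
      omega

namespace OrdSystem

variable {k K P : Type*} [Field k] [Field K] [Algebra k K] {ord : K → P → ℤ}
variable (H : OrdSystem k ord)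
include H

/-- A function without poles is constant. -/
theorem exists_const_of_forall_ge [IsAlgClosed k] {f : K} (hf : ∀ p, H.GE f p 0) :
    ∃ c : k, f = algebraMap k K c := by
  by_contra hne
  push Not at hne
  have htr : ¬ IsIntegral k f := fun hint => by
    obtain ⟨c, hc⟩ := IsAlgClosed.exists_algebraMap_eq_of_isIntegral hint
    exact hne c hc
  have hf0 : f ≠ 0 := by rintro rfl; exact hne 0 (by simp)
  obtain ⟨A, hA, hfA⟩ : ∃ A : ValuationSubring K, (∀ c : k, algebraMap k K c ∈ A) ∧ f ∉ A := by
    by_contra hall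
    push Not at hall
    apply htr
    have hmem : f ∈ (integralClosure (Subring.closure (Set.range (algebraMap k K))) K).toSubring := by
      rw [← iInf_valuationSubring_superset, Subring.mem_iInf]
      rintro ⟨A, hA⟩
      exact hall A fun c => hA ⟨c, rfl⟩
    obtain ⟨q, hq, hqf⟩ := (hmem : IsIntegral _ f)
    have hsurj : ∀ x : Subring.closure (Set.range (algebraMap k K)),
        ∃ c, algebraMap k K c = x := fun x =>
      ((Subring.closure_le (t := (algebraMap k K).range)).2 (by rintro _ ⟨c, rfl⟩; exact ⟨c, rfl⟩)) x.2
    have hlift : q.map (algebraMap _ K) ∈ Polynomial.lifts (algebraMap k K) := by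
      rw [Polynomial.lifts_iff_coeff_lifts]
      intro n
      rw [Polynomial.coeff_map]
      exact hsurj _
    obtain ⟨q', hq', -, hmon⟩ := Polynomial.lifts_and_natDegree_eq_and_monic hlift (hq.map _)
    refine ⟨q', hmon, ?_⟩
    rw [Polynomial.eval₂_eq_eval_map, hq', ← Polynomial.eval₂_eq_eval_map]
    exact hqf
  obtain ⟨p, hp⟩ := H.center A hA
  exact hfA (hp f hf0 ((H.ge_iff hf0).1 (hf p)))

theorem sectionSpace_zero [IsAlgClosed k] :
    FiniteDimensional k (H.sectionSpace 0) ∧ Module.finrank k (H.sectionSpace 0) ≤ 1 := by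
  have hle : H.sectionSpace 0 ≤ Submodule.span k {1} := by
    intro f hf
    obtain ⟨c, hc⟩ := H.exists_const_of_forall_ge (f := f) (fun p => by simpa using hf p)
    exact Submodule.mem_span_singleton.2 ⟨c, by rw [hc, Algebra.smul_def, mul_one]⟩
  have hfin := Submodule.finiteDimensional_of_le hle
  refine ⟨hfin, (Submodule.finrank_mono hle).trans ?_⟩
  simpa using finrank_span_le_card (R := k) ({1} : Set K)

/-- The space of sections of an effective divisor `D` has dimension at most `deg D + 1`. -/
theorem finrank_sectionSpace_le [IsAlgClosed k] (D : P →₀ ℕ) :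
    FiniteDimensional k (H.sectionSpace (fun p => D p)) ∧
      Module.finrank k (H.sectionSpace (fun p => D p)) ≤ (D.sum fun _ n => n) + 1 := by
  classical
  suffices h : ∀ s : Multiset P, FiniteDimensional k (H.sectionSpace (fun p => s.count p)) ∧
      Module.finrank k (H.sectionSpace (fun p => s.count p)) ≤ s.card + 1 by
    have := h (Finsupp.toMultiset D)
    have heq : (fun p => ((Finsupp.toMultiset D).count p : ℤ)) = fun p => (D p : ℤ) := by
      ext p; rw [Finsupp.count_toMultiset]
    rw [heq, Finsupp.card_toMultiset] at this
    exact this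
  intro s
  induction s using Multiset.induction_on with
  | empty => exact H.sectionSpace_zero
  | cons q s ih =>
    obtain ⟨ih1, ih2⟩ := ih
    have hcount : ∀ p, s.count p ≤ (q ::ₘ s).count p := fun p => Multiset.count_le_count_cons _ _ _
    have := Submodule.finrank_le_succ_of_forall_exists
      (N := H.sectionSpace (fun p => s.count p))
      (N' := H.sectionSpace (fun p => (q ::ₘ s).count p)) ?_ ?_
    · exact ⟨this.1, this.2.trans (by rw [Multiset.card_cons]; omega)⟩
    · intro f hf p
      exact H.ge_mono (hf p) (by have := hcount p; dsimp only; omega)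
    · intro x hx hxN y hy
      have hx0 : x ≠ 0 := by rintro rfl; exact hxN (zero_mem _)
      have hord : ord x q = - ((q ::ₘ s).count q : ℤ) := by
        by_contra hne
        apply hxN
        intro p
        have hxp := (H.ge_iff hx0).1 (hx p)
        refine Or.inr ?_
        by_cases hpq : p = q
        · subst hpq
          simp at hne hxp ⊢
          omega
        · simpa [Multiset.count_cons_of_ne hpq] using hxp
      obtain ⟨c, hc⟩ := H.exists_ge_succ hx0 hord (hy q)
      refine ⟨c, fun p => ?_⟩
      by_cases hpq : p = q
      · subst hpq
        exact H.ge_mono hc (by simp)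
      · have := H.ge_sub (hy p) (H.ge_smul c (hx p))
        simpa [Multiset.count_cons_of_ne hpq] using this

/-- The divisor of poles of a nonzero function. -/
def poles (f : K) (hf : f ≠ 0) : P →₀ ℕ :=
  Finsupp.onFinset (H.finite_support f hf).toFinset (fun p => (- ord f p).toNat) (by
    intro p hp
    simp only [Set.Finite.mem_toFinset, Set.mem_ofPred_eq]
    intro h
    simp [h] at hp)

theorem poles_apply (f : K) (hf : f ≠ 0) (p : P) : H.poles f hf p = (- ord f p).toNat := rfl

/-- A family that is linearly independent over a subfield containing the transcendental function
`y` has at most as many members as `y` has poles. -/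
theorem card_le_degree_poles [IsAlgClosed k] {F : Type*} [Field F] [Algebra k F] [Algebra F K]
    [IsScalarTower k F K] {y : F} (hy : Transcendental k y) {n : ℕ} (u : Fin n → K)
    (hu : LinearIndependent F u) (hy0 : algebraMap F K y ≠ 0) :
    n ≤ (H.poles (algebraMap F K y) hy0).sum fun _ m => m := by
  classical
  set z := algebraMap F K y with hz
  set D := H.poles z hy0
  set d := D.sum fun _ m => m with hd
  have hu0 : ∀ j, u j ≠ 0 := hu.ne_zero
  set E : P →₀ ℕ := ∑ j, H.poles (u j) (hu0 j) with hE
  set e := E.sum fun _ m => m with he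
  by_contra hlt
  push Not at hlt
  set l := e + 1
  have hindF : LinearIndependent k (fun ij : Fin (l + 1) × Fin n => z ^ (ij.1 : ℕ) * u ij.2) := by
    have hpow : LinearIndependent k (fun i : Fin (l + 1) => y ^ (i : ℕ)) := by
      have h2 := (Polynomial.basisMonomials k).linearIndependent.map'
        (Polynomial.aeval y : Polynomial k →ₐ[k] F).toLinearMap
        (LinearMap.ker_eq_bot.2 (transcendental_iff_injective.1 hy))
      have h3 := h2.comp (fun i : Fin (l + 1) => (i : ℕ)) Fin.val_injective
      simpa [Function.comp_def, Polynomial.aeval_monomial] using h3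
    have := linearIndependent_smul hpow hu
    simpa only [Algebra.smul_def, map_pow] using this
  have hmem : ∀ ij : Fin (l + 1) × Fin n, z ^ (ij.1 : ℕ) * u ij.2 ∈
      H.sectionSpace (fun p => (l • D + E) p) := by
    rintro ⟨i, j⟩ p
    refine Or.inr ?_
    dsimp only
    rw [H.mul p (pow_ne_zero _ hy0) (hu0 j), H.pow hy0]
    have h1 : (- ord (u j) p) ≤ E p := by
      have : H.poles (u j) (hu0 j) p ≤ E p := by
        rw [hE, Finsupp.finsetSum_apply]
        exact Finset.single_le_sum (f := fun j => H.poles (u j) (hu0 j) p)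
          (fun _ _ => Nat.zero_le _) (Finset.mem_univ j)
      rw [H.poles_apply] at this
      omega
    have h2 : - (i * ord z p) ≤ l * D p := by
      have hD : - ord z p ≤ D p := by
        have : D p = (- ord z p).toNat := H.poles_apply z hy0 p
        omega
      have hi : (i : ℤ) ≤ l := by have := i.2; omega
      have hD0 : (0 : ℤ) ≤ D p := by positivity
      have hi0 : (0 : ℤ) ≤ (i : ℕ) := by positivity
      nlinarith
    simp only [Finsupp.coe_add, Finsupp.coe_smul, Pi.add_apply, Pi.smul_apply, smul_eq_mul]
    push_cast
    linarith
  obtain ⟨hfin, hle⟩ := H.finrank_sectionSpace_le (l • D + E)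
  have hind' : LinearIndependent k (fun ij : Fin (l + 1) × Fin n =>
      (⟨_, hmem ij⟩ : H.sectionSpace (fun p => (l • D + E) p))) := by
    apply LinearIndependent.of_comp (Submodule.subtype _)
    exact hindF
  have hcard := hind'.fintype_card_le_finrank
  rw [Fintype.card_prod, Fintype.card_fin, Fintype.card_fin] at hcard
  have hsum : ((l • D + E).sum fun _ m => m) = l * d + e := by
    rw [Finsupp.sum_add_index' (fun _ => rfl) (fun _ _ _ => rfl),
      Finsupp.sum_smul_index (fun _ => rfl), hd, Finsupp.mul_sum]
  have h1 : (l + 1) * (d + 1) ≤ (l + 1) * n := Nat.mul_le_mul_left _ hlt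
  have : (l + 1) * (d + 1) = l * d + l + d + 1 := by ring
  omega

theorem finite_of_transcendental [IsAlgClosed k] {F : Type*} [Field F] [Algebra k F] [Algebra F K]
    [IsScalarTower k F K] {y : F} (hy : Transcendental k y) (hy0 : algebraMap F K y ≠ 0) :
    FiniteDimensional F K ∧
      Module.finrank F K ≤ (H.poles (algebraMap F K y) hy0).sum fun _ m => m := by
  have hr : Module.rank F K ≤ ((H.poles (algebraMap F K y) hy0).sum fun _ m => m : ℕ) := by
    refine rank_le fun s hs => ?_
    have := H.card_le_degree_poles hy (fun i => ((s.equivFin.symm i : s) : K))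
      (hs.comp _ s.equivFin.symm.injective) hy0
    simpa using this
  have hfin : FiniteDimensional F K :=
    Module.rank_lt_aleph0_iff.1 (hr.trans_lt (Cardinal.natCast_lt_aleph0))
  exact ⟨hfin, by exact_mod_cast (Module.finrank_eq_rank F K ▸ hr)⟩

end OrdSystem

end

noncomputable section

open scoped TensorProduct

/-- A commutative algebra over an algebraically closed field acts on a simple module of finite
dimension through a character. -/
theorem exists_character_of_isSimpleModule {F E N : Type*} [Field F] [IsAlgClosed F] [CommRing E]
    [Algebra F E] [AddCommGroup N] [Module F N] [Module E N] [IsScalarTower F E N]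
    [FiniteDimensional F N] [IsSimpleModule E N] :
    ∃ χ : E →ₐ[F] F, ∀ (a : E) (x : N), a • x = χ a • x := by
  have : Nontrivial N := IsSimpleModule.nontrivial E N
  obtain ⟨x, hx⟩ := exists_ne (0 : N)
  have key : ∀ a : E, ∃ c : F, ∀ y : N, a • y = c • y := by
    intro a
    obtain ⟨c, hc⟩ := Module.End.exists_eigenvalue (Algebra.lsmul F F N a)
    obtain ⟨z, hz⟩ := hc.exists_hasEigenvector
    refine ⟨c, fun y => ?_⟩
    let W : Submodule E N :=
      { carrier := {y | a • y = c • y}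
        add_mem' := fun {u v} hu hv => by
          change a • (u + v) = c • (u + v)
          rw [smul_add, smul_add, hu, hv]
        zero_mem' := by change a • (0 : N) = c • (0 : N); simp
        smul_mem' := fun b u hu => by
          change a • b • u = c • b • u
          rw [smul_comm a b u, smul_comm c b u]
          exact congrArg _ hu }
    have hW : W = ⊤ := by
      refine (IsSimpleOrder.eq_bot_or_eq_top W).resolve_left fun h => hz.2 ?_
      have : z ∈ W := hz.apply_eq_smul
      rwa [h, Submodule.mem_bot] at this
    exact (hW ▸ Submodule.mem_top : y ∈ W)
  choose c hc using key
  have huniq : ∀ {c₁ c₂ : F}, c₁ • x = c₂ • x → c₁ = c₂ := fun h => smul_left_injective F hx h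
  refine ⟨AlgHom.ofLinearMap ⟨⟨c, fun a b => huniq ?_⟩, fun r a => huniq ?_⟩ (huniq ?_)
    fun a b => huniq ?_, hc⟩
  · rw [← hc, add_smul, add_smul, hc, hc]
  · dsimp
    rw [← hc, smul_assoc, hc, mul_smul]
  · change c 1 • x = (1 : F) • x
    rw [← hc, one_smul, one_smul]
  · change c (a * b) • x = (c a * c b) • x
    rw [← hc, mul_smul, mul_smul, hc b, smul_comm, hc a, smul_comm]

/-- The determinants of a commutative algebra over an algebraically closed field acting on a module
of finite dimension are products of characters. -/
theorem exists_multiset_characters {F E : Type*} [Field F] [IsAlgClosed F] [CommRing E]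
    [Algebra F E] (n : ℕ) : ∀ (N : Type*) [AddCommGroup N] [Module F N] [Module E N]
    [IsScalarTower F E N] [FiniteDimensional F N], Module.finrank F N = n →
    ∃ S : Multiset (E →ₐ[F] F), S.card = n ∧
      ∀ a, LinearMap.det (Algebra.lsmul F F N a) = (S.map fun χ => χ a).prod := by
  induction n with
  | zero =>
    intro N _ _ _ _ _ hN
    refine ⟨0, rfl, fun a => ?_⟩
    rw [LinearMap.det_eq_one_of_finrank_eq_zero hN]
    rfl
  | succ n ih =>
    intro N _ _ _ _ _ hN
    have : Nontrivial N := Module.nontrivial_of_finrank_pos (R := F) (by omega)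
    have : IsArtinian E N := isArtinian_of_tower F inferInstance
    obtain ⟨W, hW⟩ := IsAtomic.exists_atom (Submodule E N)
    have : IsSimpleModule E W := isSimpleModule_iff_isAtom.2 hW
    have : FiniteDimensional F W :=
      inferInstanceAs (FiniteDimensional F (W.restrictScalars F))
    obtain ⟨χ, hχ⟩ := exists_character_of_isSimpleModule (F := F) (E := E) (N := W)
    have hW1 : Module.finrank F W = 1 := by
      have : Nontrivial W := IsSimpleModule.nontrivial E W
      obtain ⟨x, hx⟩ := exists_ne (0 : W)
      refine finrank_eq_one x hx fun y => ?_
      obtain ⟨a, ha⟩ := (IsSimpleModule.toSpanSingleton_surjective E hx) y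
      exact ⟨χ a, by rw [← hχ]; exact ha⟩
    have hq : Module.finrank F (N ⧸ W) = n := by
      have h1 := (W.restrictScalars F).finrank_quotient_add_finrank
      have h2 : Module.finrank F (W.restrictScalars F) = 1 := hW1
      have h3 := (Submodule.Quotient.restrictScalarsEquiv F W).finrank_eq
      omega
    have : FiniteDimensional F (N ⧸ W) :=
      Module.Finite.equiv (Submodule.Quotient.restrictScalarsEquiv F W)
    obtain ⟨S, hS, hdet⟩ := ih (N ⧸ W) hq
    refine ⟨χ ::ₘ S, by simp [hS], fun a => ?_⟩
    have hle : W.restrictScalars F ≤ (W.restrictScalars F).comap (Algebra.lsmul F F N a) :=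
      fun x hx => W.smul_mem a hx
    rw [LinearMap.det_eq_det_mul_det (W.restrictScalars F) _ hle, Multiset.map_cons,
      Multiset.prod_cons]
    congr 1
    · have : LinearMap.restrict (p := W.restrictScalars F) (q := W.restrictScalars F)
          (Algebra.lsmul F F N a) hle = χ a • LinearMap.id := by
        ext x
        exact congrArg Subtype.val (hχ a x)
      rw [this, LinearMap.det_smul, LinearMap.det_id, mul_one]
      have h2 : Module.finrank F (W.restrictScalars F) = 1 := hW1
      rw [h2, pow_one]
    · have hconj := LinearMap.det_conj ((W.restrictScalars F).mapQ (W.restrictScalars F) _ hle)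
        (Submodule.Quotient.restrictScalarsEquiv F W)
      rw [← hdet a, ← hconj]
      congr 1
      refine LinearMap.ext fun x => ?_
      obtain ⟨x, rfl⟩ := Submodule.Quotient.mk_surjective W x
      rfl

/-- The embeddings of a finite extension `K` of `F` in an algebraically closed field, with
multiplicities: they compute characteristic polynomials. -/
theorem exists_multiset_embeddings (F K M : Type*) [Field F] [Field K] [Field M] [IsAlgClosed M]
    [Algebra F K] [Algebra F M] [FiniteDimensional F K] :
    ∃ S : Multiset (K →ₐ[F] M), S.card = Module.finrank F K ∧
      ∀ h : K, (LinearMap.charpoly (Algebra.lmul F K h)).map (algebraMap F M) =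
        (S.map fun σ => Polynomial.X - Polynomial.C (σ h)).prod := by
  obtain ⟨S, hS, hdet⟩ := exists_multiset_characters (F := M) (E := TensorProduct F M K) _
    (TensorProduct F M K) rfl
  rw [Module.finrank_baseChange] at hS
  refine ⟨S.map fun χ => (χ.restrictScalars F).comp Algebra.TensorProduct.includeRight,
    by simpa using hS, fun h => ?_⟩
  rw [← LinearMap.charpoly_baseChange, Multiset.map_map]
  refine Polynomial.funext fun c => ?_
  rw [LinearMap.eval_charpoly, Polynomial.eval_multiset_prod, Multiset.map_map]
  have h1 := hdet (algebraMap M _ c - (1 : M) ⊗ₜ[F] h)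
  have h2 : Algebra.lsmul M M (TensorProduct F M K) (algebraMap M _ c - (1 : M) ⊗ₜ[F] h) =
      algebraMap M (Module.End M (TensorProduct F M K)) c -
        (Algebra.lmul F K h).baseChange M := by
    ext x
    simp [Algebra.TensorProduct.tmul_mul_tmul, TensorProduct.smul_tmul']
  rw [← h2, h1]
  congr 1
  refine Multiset.map_congr rfl fun χ _ => ?_
  rw [map_sub, AlgHom.commutes]
  simp

end

noncomputable section

namespace OrdSystem

variable {k K P : Type*} [Field k] [Field K] [Algebra k K] {ord : K → P → ℤ}
variable (H : OrdSystem k ord)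
include H

/-- The absolute value attached to a point. -/
def absoluteValue (p : P) : AbsoluteValue K ℝ where
  toFun f := by classical exact if f = 0 then 0 else (2 : ℝ) ^ (- ord f p)
  map_mul' f g := by
    by_cases hf : f = 0
    · simp [hf]
    by_cases hg : g = 0
    · simp [hg]
    simp only [mul_eq_zero, hf, hg, or_self, if_false]
    rw [H.mul p hf hg, neg_add, zpow_add₀ (by norm_num)]
  nonneg' f := by
    split_ifs
    · exact le_rfl
    · positivity
  eq_zero' f := by
    split_ifs with h
    · simp [h]
    · simp only [h, iff_false]
      positivity
  add_le' f g := by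
    by_cases hf : f = 0
    · subst hf; rw [zero_add, if_pos rfl, zero_add]
    by_cases hg : g = 0
    · subst hg; rw [add_zero, if_pos rfl, add_zero]
    by_cases hfg : f + g = 0
    · simp only [hf, hg, hfg, if_true, if_false]
      positivity
    simp only [hf, hg, hfg, if_false]
    rcases min_le_iff.1 (H.add p hf hg hfg) with h | h
    · refine (zpow_le_zpow_right₀ (by norm_num : (1 : ℝ) ≤ 2) (neg_le_neg h)).trans ?_
      have : (0 : ℝ) < 2 ^ (- ord g p) := by positivity
      linarith
    · refine (zpow_le_zpow_right₀ (by norm_num : (1 : ℝ) ≤ 2) (neg_le_neg h)).trans ?_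
      have : (0 : ℝ) < 2 ^ (- ord f p) := by positivity
      linarith

theorem absoluteValue_apply {f : K} (hf : f ≠ 0) (p : P) :
    H.absoluteValue p f = (2 : ℝ) ^ (- ord f p) := if_neg hf

theorem one_lt_absoluteValue {f : K} (hf : f ≠ 0) (p : P) :
    1 < H.absoluteValue p f ↔ ord f p < 0 := by
  rw [H.absoluteValue_apply hf, one_lt_zpow_iff_right₀ (by norm_num)]
  omega

theorem absoluteValue_lt_one {f : K} (hf : f ≠ 0) (p : P) :
    H.absoluteValue p f < 1 ↔ 0 < ord f p := by
  rw [H.absoluteValue_apply hf, zpow_lt_one_iff_right₀ (by norm_num)]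
  omega

/-- Weak approximation: a function with prescribed signs of orders. -/
theorem exists_neg_pos (p : P) (Q : Finset P) :
    ∃ a : K, a ≠ 0 ∧ ord a p < 0 ∧ ∀ q ∈ Q, q ≠ p → 0 < ord a q := by
  classical
  let ι := ↥(insert p Q)
  obtain ⟨a, ha, ha'⟩ := AbsoluteValue.exists_one_lt_lt_one_pi_of_not_isEquiv
    (v := fun q : ι => H.absoluteValue (q : P)) (fun q => by
      obtain ⟨u, hu, hu1⟩ := H.uniformizer (q : P)
      refine ⟨u, hu, ne_of_lt ?_⟩
      rw [H.absoluteValue_lt_one hu]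
      omega)
    (fun q q' hqq' heq => by
      obtain ⟨f, hf, hfq, hfq'⟩ := H.separated (q : P) (q' : P) (fun h => hqq' (Subtype.ext h))
      have h1 := (H.one_lt_absoluteValue hf q').2 hfq'
      rw [← AbsoluteValue.IsEquiv.one_lt_iff heq, H.one_lt_absoluteValue hf] at h1
      omega) ⟨p, Finset.mem_insert_self _ _⟩
  have ha0 : a ≠ 0 := by
    rintro rfl
    simp at ha
    linarith
  refine ⟨a, ha0, (H.one_lt_absoluteValue ha0 p).1 ha, fun q hq hqp => ?_⟩
  exact (H.absoluteValue_lt_one ha0 q).1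
    (ha' ⟨q, Finset.mem_insert_of_mem hq⟩ fun h => hqp (congrArg Subtype.val h))

/-- Weak approximation: a uniformizer at `p` that is a unit at finitely many other points. -/
theorem exists_uniformizer_unit (p : P) (Q : Finset P) :
    ∃ h : K, h ≠ 0 ∧ ord h p = 1 ∧ ∀ q ∈ Q, q ≠ p → ord h q = 0 := by
  classical
  obtain ⟨a, ha0, hap, haq⟩ := H.exists_neg_pos p Q
  obtain ⟨u, hu0, hu1⟩ := H.uniformizer p
  set N : ℕ := 2 + ∑ q ∈ Q, (ord u q).natAbs with hN
  have hN0 : ∀ q ∈ Q, (ord u q).natAbs ≤ N := fun q hq => by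
    have := Finset.single_le_sum (f := fun q => (ord u q).natAbs) (fun _ _ => Nat.zero_le _) hq
    omega
  have haN : a ^ N ≠ 0 := pow_ne_zero _ ha0
  have hordN : ∀ q, ord (a ^ N) q = N * ord a q := fun q => H.pow ha0 q N
  -- `b = 1 + a ^ N`
  have hb : 1 + a ^ N ≠ 0 ∧ ord (1 + a ^ N) p = ord (a ^ N) p := by
    rw [add_comm]
    refine H.add_eq_of_lt haN (Or.inr ?_)
    rw [H.one, hordN]
    have : (2 : ℤ) ≤ N := by omega
    nlinarith
  have hbq : ∀ q ∈ Q, q ≠ p → ord (1 + a ^ N) q = 0 := fun q hq hqp => by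
    have := H.add_eq_of_lt (f := 1) (g := a ^ N) (p := q) one_ne_zero (Or.inr ?_)
    · rw [this.2, H.one]
    · rw [H.one, hordN]
      have := haq q hq hqp
      have : (2 : ℤ) ≤ N := by omega
      nlinarith
  have hua : u * a ^ N ≠ 0 := mul_ne_zero hu0 haN
  have h1p := H.add_eq_of_lt (f := u * a ^ N) (g := 1) (p := p) hua (Or.inr (by
    rw [H.one, H.mul p hu0 haN, hordN, hu1]
    have : (2 : ℤ) ≤ N := by omega
    nlinarith))
  refine ⟨(u * a ^ N + 1) / (1 + a ^ N), div_ne_zero h1p.1 hb.1, ?_, fun q hq hqp => ?_⟩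
  · rw [H.div h1p.1 hb.1, h1p.2, hb.2, H.mul p hu0 haN, hu1]
    ring
  · have h1q := H.add_eq_of_lt (f := 1) (g := u * a ^ N) (p := q) one_ne_zero (Or.inr (by
      rw [H.one, H.mul q hu0 haN, hordN]
      have h1 := haq q hq hqp
      have h2 := hN0 q hq
      have h3 : (2 : ℤ) + (ord u q).natAbs ≤ N := by
        have := Finset.single_le_sum (f := fun q => (ord u q).natAbs) (fun _ _ => Nat.zero_le _) hq
        omega
      have h4 : (N : ℤ) * 1 ≤ N * ord a q := by
        apply mul_le_mul_of_nonneg_left <;> omega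
      omega))
    rw [add_comm (u * a ^ N) 1, H.div h1q.1 hb.1, h1q.2, H.one, hbq q hq hqp, sub_zero]

/-- The local ring of a point. -/
def localRing (p : P) : ValuationSubring K where
  carrier := {f | H.GE f p 0}
  mul_mem' hf hg := by simpa using H.ge_mul hf hg
  one_mem' := Or.inr (H.one p).ge
  add_mem' hf hg := H.ge_add hf hg
  zero_mem' := Or.inl rfl
  neg_mem' hf := H.ge_neg hf
  mem_or_inv_mem' f := by
    by_cases hf : f = 0
    · exact Or.inl (Or.inl hf)
    rcases le_total 0 (ord f p) with h | h
    · exact Or.inl (Or.inr h)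
    · exact Or.inr (Or.inr (by rw [H.inv hf]; omega))

theorem mem_localRing {p : P} {f : K} : f ∈ H.localRing p ↔ H.GE f p 0 := Iff.rfl

theorem valuation_localRing_eq_one {p : P} {f : K} (hf : f ≠ 0) :
    (H.localRing p).valuation f = 1 ↔ ord f p = 0 := by
  constructor
  · intro h
    have h1 : f ∈ H.localRing p := (ValuationSubring.valuation_le_one_iff _ _).1 h.le
    have h2 : f⁻¹ ∈ H.localRing p :=
      (ValuationSubring.valuation_le_one_iff _ _).1 (by rw [map_inv₀, h, inv_one])
    rw [H.mem_localRing, H.ge_iff hf] at h1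
    rw [H.mem_localRing, H.ge_iff (inv_ne_zero hf), H.inv hf] at h2
    omega
  · intro h
    refine le_antisymm ((ValuationSubring.valuation_le_one_iff _ _).2 (Or.inr h.ge)) ?_
    have := (ValuationSubring.valuation_le_one_iff (H.localRing p) f⁻¹).2
      (Or.inr (by rw [H.inv hf]; omega))
    rw [map_inv₀] at this
    exact (inv_le_one₀ (zero_lt_iff.2 ((Valuation.ne_zero_iff _).2 hf))).1 this

theorem valuation_localRing_lt_one {p : P} {f : K} (hf : f ≠ 0) :
    (H.localRing p).valuation f < 1 ↔ 0 < ord f p := by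
  rw [lt_iff_le_and_ne, ValuationSubring.valuation_le_one_iff, Ne, H.valuation_localRing_eq_one hf,
    H.mem_localRing, H.ge_iff hf]
  omega

end OrdSystem

section

open Polynomial

/-- The order of a rational function at a point of the affine line. -/
theorem RatFunc.exists_eq_zpow_mul {k : Type*} [Field k] (a : k) {x : RatFunc k} (hx : x ≠ 0) :
    ∃ (m : ℤ) (f g : k[X]), f.eval a ≠ 0 ∧ g.eval a ≠ 0 ∧
      x = (RatFunc.X - RatFunc.C a) ^ m *
        (algebraMap k[X] (RatFunc k) f / algebraMap k[X] (RatFunc k) g) := by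
  have key : ∀ f : k[X], f ≠ 0 → ∃ (m : ℕ) (g : k[X]), g.eval a ≠ 0 ∧
      algebraMap k[X] (RatFunc k) f = (RatFunc.X - RatFunc.C a) ^ m * algebraMap _ _ g := by
    intro f hf
    obtain ⟨g, hg, hdvd⟩ := Polynomial.exists_eq_pow_rootMultiplicity_mul_and_not_dvd f hf a
    refine ⟨f.rootMultiplicity a, g, fun h => hdvd (dvd_iff_isRoot.2 h), ?_⟩
    conv_lhs => rw [hg]
    simp
  obtain ⟨m, f, hf, hmf⟩ := key x.num (RatFunc.num_ne_zero hx)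
  obtain ⟨n, g, hg, hng⟩ := key x.denom x.denom_ne_zero
  have hX : (RatFunc.X - RatFunc.C a : RatFunc k) ≠ 0 := by
    rw [← RatFunc.algebraMap_X, ← RatFunc.algebraMap_C, ← map_sub]
    exact (map_ne_zero_iff _ (RatFunc.algebraMap_injective k)).2 (X_sub_C_ne_zero a)
  refine ⟨m - n, f, g, hf, hg, ?_⟩
  rw [← RatFunc.num_div_denom x, hmf, hng, zpow_sub₀ hX, zpow_natCast, zpow_natCast]
  rw [mul_div_mul_comm]

/-- A polynomial not vanishing at `a` is a unit in a valuation ring in which `X - a` is not. -/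
theorem ValuationSubring.valuation_aeval_eq_one {k L : Type*} [Field k] [Field L] [Algebra k L]
    (A : ValuationSubring L) (hA : ∀ c : k, algebraMap k L c ∈ A) {t : L} {a : k}
    (ht : A.valuation (t - algebraMap k L a) < 1) {f : k[X]} (hf : f.eval a ≠ 0) :
    A.valuation (aeval t f) = 1 := by
  obtain ⟨g, hg⟩ := X_sub_C_dvd_sub_C_eval (a := a) (p := f)
  have htA : t ∈ A := by
    have := A.add_mem _ _ ((ValuationSubring.valuation_le_one_iff _ _).1 ht.le) (hA a)
    simpa using this
  have hgA : aeval t g ∈ A := by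
    rw [aeval_eq_sum_range]
    refine _root_.sum_mem fun i _ => ?_
    rw [Algebra.smul_def]
    exact A.mul_mem _ _ (hA _) (pow_mem htA i)
  have hcA : ∀ c : k, c ≠ 0 → A.valuation (algebraMap k L c) = 1 := fun c hc => by
    refine le_antisymm ((ValuationSubring.valuation_le_one_iff _ _).2 (hA c)) ?_
    have := (ValuationSubring.valuation_le_one_iff A _).2 (hA c⁻¹)
    rw [map_inv₀, map_inv₀] at this
    exact (inv_le_one₀ (zero_lt_iff.2 ((Valuation.ne_zero_iff _).2 (by simpa using hc)))).1 this
  have h1 : aeval t f = (t - algebraMap k L a) * aeval t g + algebraMap k L (f.eval a) := by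
    have := congrArg (aeval t) hg
    simp only [map_sub, map_mul, aeval_X, aeval_C] at this
    rw [← this, sub_add_cancel]
  rw [h1, Valuation.map_add_eq_of_lt_right, hcA _ hf]
  rw [hcA _ hf, map_mul]
  exact mul_lt_one_of_lt_of_le ht ((ValuationSubring.valuation_le_one_iff _ _).2 hgA)

/-- The order of a rational function at a point `a` of the affine line determines its valuation in
valuation rings in which `X - a` is not a unit. -/
theorem ValuationSubring.exists_valuation_algebraMap {k : Type*} [Field k] (a : k) {x : RatFunc k}
    (hx : x ≠ 0) : ∃ m : ℤ, ∀ {L : Type*} [Field L] [Algebra k L] [Algebra (RatFunc k) L]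
      [IsScalarTower k (RatFunc k) L] (A : ValuationSubring L),
      (∀ c : k, algebraMap k L c ∈ A) →
      A.valuation (algebraMap (RatFunc k) L RatFunc.X - algebraMap k L a) < 1 →
      A.valuation (algebraMap (RatFunc k) L x) =
        A.valuation (algebraMap (RatFunc k) L RatFunc.X - algebraMap k L a) ^ m := by
  obtain ⟨m, f, g, hf, hg, h⟩ := RatFunc.exists_eq_zpow_mul a hx
  refine ⟨m, fun {L} _ _ _ _ A hA ht => ?_⟩
  have hpoly : ∀ f : k[X], algebraMap (RatFunc k) L (algebraMap k[X] (RatFunc k) f) =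
      aeval (algebraMap (RatFunc k) L RatFunc.X) f := by
    intro f
    rw [← RatFunc.algebraMap_X, aeval_algebraMap_apply, aeval_algebraMap_apply]
    simp
  have hC : algebraMap (RatFunc k) L (RatFunc.C a) = algebraMap k L a := by
    rw [IsScalarTower.algebraMap_apply k (RatFunc k) L]; rfl
  rw [h, map_mul, map_zpow₀, map_sub, hC, map_div₀, hpoly, hpoly, map_mul, map_zpow₀, map_div₀,
    A.valuation_aeval_eq_one hA ht hf, A.valuation_aeval_eq_one hA ht hg, div_one, mul_one]

end

end

noncomputable section

namespace OrdSystem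

open Polynomial

universe u

variable {k : Type*} {K M : Type u} {P : Type*} [Field k] [Field K] [Algebra k K]
  {ord : K → P → ℤ} (H : OrdSystem k ord)

theorem _root_.RatFunc.X_sub_algebraMap_ne_zero {k : Type*} [Field k] (a : k) :
    (RatFunc.X - algebraMap k (RatFunc k) a : RatFunc k) ≠ 0 := by
  have : algebraMap k (RatFunc k) a = RatFunc.C a := rfl
  rw [this, ← RatFunc.algebraMap_X, ← RatFunc.algebraMap_C, ← map_sub]
  exact (_root_.map_ne_zero_iff _ (RatFunc.algebraMap_injective k)).2 (X_sub_C_ne_zero a)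

theorem _root_.RatFunc.transcendental_inv_X_sub {k : Type*} [Field k] (a : k) :
    Transcendental k (RatFunc.X - algebraMap k (RatFunc k) a)⁻¹ := by
  intro h
  have h1 : IsAlgebraic k (RatFunc.X - algebraMap k (RatFunc k) a) := by
    simpa using h.inv
  have h2 : IsAlgebraic k (RatFunc.X : RatFunc k) := by
    simpa using h1.add (isAlgebraic_algebraMap a)
  rw [← RatFunc.algebraMap_X, isAlgebraic_algebraMap_iff (RatFunc.algebraMap_injective k)] at h2
  exact transcendental_X k h2

include H

/-- A valuation ring of an extension field is centered at some point. -/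
theorem exists_center [Field M] [Algebra k M] (V : ValuationSubring M)
    (hV : ∀ c : k, algebraMap k M c ∈ V) (σ : K →ₐ[k] M) :
    ∃ p, ∀ f, f ≠ 0 → 0 ≤ ord f p → σ f ∈ V :=
  H.center (V.comap (σ : K →+* M)) fun c => by
    rw [ValuationSubring.mem_comap]
    simpa using hV c

/-- The divisor of zeros of a nonzero function. -/
abbrev zeros (f : K) (hf : f ≠ 0) : P →₀ ℕ := H.poles f⁻¹ (inv_ne_zero hf)

theorem zeros_apply (f : K) (hf : f ≠ 0) (p : P) : H.zeros f hf p = (ord f p).toNat := by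
  rw [poles_apply, H.inv hf, neg_neg]

variable [IsAlgClosed k] [Algebra (RatFunc k) K] [IsScalarTower k (RatFunc k) K]

omit [IsAlgClosed k] H in
theorem sub_algebraMap_ne_zero (a : k) :
    algebraMap (RatFunc k) K RatFunc.X - algebraMap k K a ≠ 0 := by
  rw [IsScalarTower.algebraMap_apply k (RatFunc k) K, ← map_sub]
  exact (_root_.map_ne_zero _).2 (RatFunc.X_sub_algebraMap_ne_zero a)

theorem finrank_le_degree_zeros (a : k) : FiniteDimensional (RatFunc k) K ∧
    Module.finrank (RatFunc k) K ≤
      (H.zeros _ (sub_algebraMap_ne_zero (K := K) a)).sum fun _ m => m := by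
  have h0 : algebraMap (RatFunc k) K (RatFunc.X - algebraMap k (RatFunc k) a)⁻¹ ≠ 0 :=
    (_root_.map_ne_zero _).2 (inv_ne_zero (RatFunc.X_sub_algebraMap_ne_zero a))
  have := H.finite_of_transcendental (K := K) (RatFunc.transcendental_inv_X_sub a) h0
  refine ⟨this.1, this.2.trans (le_of_eq ?_)⟩
  congr 1
  ext p
  rw [poles_apply, poles_apply, map_inv₀, map_sub, ← IsScalarTower.algebraMap_apply]

variable [Field M] [Algebra k M] [Algebra (RatFunc k) M] [IsScalarTower k (RatFunc k) M]

section

variable {a : k} {V : ValuationSubring M}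
  (hV : ∀ c : k, algebraMap k M c ∈ V)
  (ha : V.valuation (algebraMap (RatFunc k) M RatFunc.X - algebraMap k M a) < 1)
  {σ : K →ₐ[RatFunc k] M} {p : P} (hp : ∀ f, f ≠ 0 → 0 ≤ ord f p → σ f ∈ V)

include hV ha hp

omit [IsAlgClosed k] hV in
theorem ord_center_pos : 0 < ord (algebraMap (RatFunc k) K RatFunc.X - algebraMap k K a) p := by
  by_contra hle
  push Not at hle
  have h0 := sub_algebraMap_ne_zero (K := K) a
  have h1 := hp _ (inv_ne_zero h0) (by rw [H.inv h0]; omega)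
  rw [map_inv₀, map_sub, AlgHom.commutes, IsScalarTower.algebraMap_apply k (RatFunc k) K,
    AlgHom.commutes, ← IsScalarTower.algebraMap_apply, ← ValuationSubring.valuation_le_one_iff,
    map_inv₀] at h1
  have h3 : V.valuation (algebraMap (RatFunc k) M RatFunc.X - algebraMap k M a) ≠ 0 :=
    (Valuation.ne_zero_iff _).2 (sub_algebraMap_ne_zero a)
  exact absurd ((inv_le_one₀ (zero_lt_iff.2 h3)).1 h1) (not_le.2 ha)

omit [IsAlgClosed k] [IsScalarTower k (RatFunc k) K] [Algebra k M]
  [IsScalarTower k (RatFunc k) M] hV ha in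
theorem valuation_center_eq_one {h : K} (hh : h ≠ 0) (h0 : ord h p = 0) :
    V.valuation (σ h) = 1 := by
  refine le_antisymm ((ValuationSubring.valuation_le_one_iff _ _).2 (hp h hh h0.ge)) ?_
  have := (ValuationSubring.valuation_le_one_iff V _).2
    (hp h⁻¹ (inv_ne_zero hh) (by rw [H.inv hh]; omega))
  rw [map_inv₀, map_inv₀] at this
  exact (inv_le_one₀ (zero_lt_iff.2 ((Valuation.ne_zero_iff _).2
    ((_root_.map_ne_zero _).2 hh)))).1 this

omit [IsAlgClosed k] hV in
theorem valuation_center_pow {h : K} (hh : h ≠ 0) (h1 : ord h p = 1) :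
    V.valuation (σ h) ^
        (ord (algebraMap (RatFunc k) K RatFunc.X - algebraMap k K a) p).toNat =
      V.valuation (algebraMap (RatFunc k) M RatFunc.X - algebraMap k M a) := by
  have hpos := H.ord_center_pos ha hp
  have h0 := sub_algebraMap_ne_zero (K := K) a
  set e := (ord (algebraMap (RatFunc k) K RatFunc.X - algebraMap k K a) p).toNat with he
  have h2 : h ^ e / (algebraMap (RatFunc k) K RatFunc.X - algebraMap k K a) ≠ 0 :=
    div_ne_zero (pow_ne_zero _ hh) h0
  have h3 := H.valuation_center_eq_one hp h2
    (by rw [H.div (pow_ne_zero _ hh) h0, H.pow hh, h1]; omega)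
  rw [map_div₀, map_pow, map_sub, AlgHom.commutes, IsScalarTower.algebraMap_apply k (RatFunc k) K,
    AlgHom.commutes, ← IsScalarTower.algebraMap_apply, map_div₀, map_pow] at h3
  exact eq_of_div_eq_one h3

end

omit [IsAlgClosed k] H [Algebra k K] [IsScalarTower k (RatFunc k) K] [Algebra k M]
  [IsScalarTower k (RatFunc k) M] in
theorem _root_.Multiset.prod_eq_pow_count {α β G : Type*} [CommMonoid G] [DecidableEq β]
    (S : Multiset α) (c : α → β) (b : β) (f : α → G) (τ : G)
    (h : ∀ x ∈ S, f x = if c x = b then τ else 1) :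
    (S.map f).prod = τ ^ (S.map c).count b := by
  induction S using Multiset.induction_on with
  | empty => simp
  | cons x S ih =>
    rw [Multiset.map_cons, Multiset.prod_cons, Multiset.map_cons, Multiset.count_cons,
      ih fun y hy => h y (Multiset.mem_cons_of_mem hy), h x (Multiset.mem_cons_self _ _)]
    by_cases hx : c x = b
    · rw [if_pos hx, if_pos hx.symm, pow_succ, mul_comm]
    · rw [if_neg hx, if_neg (Ne.symm hx), one_mul, add_zero]

/-- The centers of the embeddings of `K` over a point of the affine line form the fibre over that
point. -/
theorem map_center_eq_zeros [FiniteDimensional (RatFunc k) K] {a : k} {V : ValuationSubring M}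
    (hV : ∀ c : k, algebraMap k M c ∈ V)
    (ha : V.valuation (algebraMap (RatFunc k) M RatFunc.X - algebraMap k M a) < 1)
    {S : Multiset (K →ₐ[RatFunc k] M)} (hS : S.card = Module.finrank (RatFunc k) K)
    (hchar : ∀ h : K, (LinearMap.charpoly (Algebra.lmul (RatFunc k) K h)).map
      (algebraMap (RatFunc k) M) = (S.map fun σ => X - C (σ h)).prod)
    {c : (K →ₐ[RatFunc k] M) → P} (hc : ∀ σ f, f ≠ 0 → 0 ≤ ord f (c σ) → σ f ∈ V) :
    S.map c = Finsupp.toMultiset (H.zeros _ (sub_algebraMap_ne_zero (K := K) a)) := by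
  classical
  obtain ⟨-, hdeg⟩ := H.finrank_le_degree_zeros (K := K) a
  have h0 := sub_algebraMap_ne_zero (K := K) a
  set φ := algebraMap (RatFunc k) K RatFunc.X - algebraMap k K a with hφ
  set τ := V.valuation (algebraMap (RatFunc k) M RatFunc.X - algebraMap k M a) with hτ
  have hτ0 : τ ≠ 0 := (Valuation.ne_zero_iff _).2 (sub_algebraMap_ne_zero a)
  symm
  refine Multiset.eq_of_le_of_card_le (Multiset.le_iff_count.2 fun p => ?_) ?_
  swap
  · rw [Multiset.card_map, hS, Finsupp.card_toMultiset]
    exact hdeg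
  rw [Finsupp.count_toMultiset, H.zeros_apply]
  by_cases hp : ord φ p ≤ 0
  · rw [Int.toNat_of_nonpos hp]; exact Nat.zero_le _
  push Not at hp
  -- a uniformizer at `p`
  obtain ⟨h, hh0, hhp, hhq⟩ := H.exists_uniformizer_unit p (H.finite_support φ h0).toFinset
  have hcQ : ∀ σ, c σ ∈ (H.finite_support φ h0).toFinset := fun σ => by
    rw [Set.Finite.mem_toFinset]
    exact (H.ord_center_pos ha (hc σ)).ne'
  have hval : ∀ σ, c σ ≠ p → V.valuation (σ h) = 1 := fun σ hσ =>
    H.valuation_center_eq_one (hc σ) hh0 (hhq _ (hcQ σ) hσ)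
  have hvalV : ∀ σ : K →ₐ[RatFunc k] M, σ h ∈ V := fun σ => by
    refine hc σ h hh0 ?_
    by_cases hσ : c σ = p
    · rw [hσ, hhp]; omega
    · rw [hhq _ (hcQ σ) hσ]
  set χ := LinearMap.charpoly (Algebra.lmul (RatFunc k) K h) with hχ
  have hcoeff : ∀ i, algebraMap (RatFunc k) M (χ.coeff i) ∈ V := by
    intro i
    rw [← coeff_map, hchar]
    have : (S.map fun σ : K →ₐ[RatFunc k] M => X - C (σ h)).prod =
        ((S.map fun σ : K →ₐ[RatFunc k] M => X - C (⟨σ h, hvalV σ⟩ : V)).prod).map V.subtype := by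
      rw [Polynomial.map_multiset_prod, Multiset.map_map]
      congr 1
      refine Multiset.map_congr rfl fun σ _ => ?_
      simp
    rw [this, coeff_map]
    exact Subtype.prop _
  have hcoeff0 : V.valuation (algebraMap (RatFunc k) M (χ.coeff 0)) =
      (S.map fun σ => V.valuation (σ h)).prod := by
    rw [← coeff_map, hchar, coeff_zero_eq_eval_zero, eval_multiset_prod, map_multiset_prod,
      Multiset.map_map, Multiset.map_map]
    congr 1
    refine Multiset.map_congr rfl fun σ _ => ?_
    simp [Valuation.map_neg]
  have hprod0 : (S.map fun σ => V.valuation (σ h)).prod ≠ 0 := by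
    rw [Ne, Multiset.prod_eq_zero_iff]
    intro hmem
    obtain ⟨σ, -, hσ⟩ := Multiset.mem_map.1 hmem
    exact (Valuation.ne_zero_iff _).2 ((_root_.map_ne_zero σ).2 hh0) hσ
  have hχ0 : χ.coeff 0 ≠ 0 := by
    intro h
    rw [← hcoeff0, h] at hprod0
    simp at hprod0
  have hloc : ∀ c : k, algebraMap k K c ∈ H.localRing p := fun c => H.ge_const c p
  have hlocφ : (H.localRing p).valuation φ < 1 := (H.valuation_localRing_lt_one h0).2 hp
  have hcomp : ∀ x : RatFunc k, algebraMap (RatFunc k) M x ∈ V →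
      algebraMap (RatFunc k) K x ∈ H.localRing p := by
    intro x hx
    by_cases hx0 : x = 0
    · rw [hx0, map_zero]; exact zero_mem _
    obtain ⟨m, hm⟩ := ValuationSubring.exists_valuation_algebraMap.{_, u} a hx0
    rw [← ValuationSubring.valuation_le_one_iff, hm V hV ha] at hx
    rw [← ValuationSubring.valuation_le_one_iff, hm (H.localRing p) hloc hlocφ]
    have hm0 : 0 ≤ m := by
      by_contra hneg
      push Not at hneg
      exact absurd hx (not_le.2 (one_lt_zpow_of_neg₀ (zero_lt_iff.2 hτ0) ha hneg))
    exact zpow_le_one₀ (zero_lt_iff.2 ((Valuation.ne_zero_iff _).2 h0)) hlocφ.le hm0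
  -- some embedding is centered at `p`
  have hpos : 0 < (S.map c).count p := by
    rw [Multiset.count_pos]
    by_contra hnot
    have hne : ∀ σ ∈ S, c σ ≠ p := fun σ hσ h => hnot (Multiset.mem_map.2 ⟨σ, hσ, h⟩)
    have hone : V.valuation (algebraMap (RatFunc k) M (χ.coeff 0)) = 1 := by
      rw [hcoeff0]
      refine Multiset.prod_eq_one fun x hx => ?_
      obtain ⟨σ, hσ, rfl⟩ := Multiset.mem_map.1 hx
      exact hval σ (hne σ hσ)
    obtain ⟨m, hm⟩ := ValuationSubring.exists_valuation_algebraMap.{_, u} a hχ0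
    have hm1 := hm V hV ha
    rw [hone] at hm1
    have hm0 : m = 0 := by
      by_contra hmne
      exact hmne (zpow_right_injective₀ (zero_lt_iff.2 hτ0) ha.ne (hm1.symm.trans (zpow_zero τ).symm))
    have h1 := hm (H.localRing p) hloc hlocφ
    rw [hm0, zpow_zero] at h1
    have hCH : aeval h χ = 0 := by
      have := LinearMap.aeval_self_charpoly (Algebra.lmul (RatFunc k) K h)
      rw [aeval_algHom_apply] at this
      have h1 : aeval h χ * 1 = 0 := LinearMap.congr_fun this 1
      rwa [mul_one] at h1
    rw [← divX_mul_X_add χ, map_add, map_mul, aeval_X, aeval_C] at hCH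
    have hdiv : aeval h χ.divX ∈ H.localRing p := by
      rw [aeval_eq_sum_range]
      refine _root_.sum_mem fun i _ => ?_
      rw [Algebra.smul_def, coeff_divX]
      refine (H.localRing p).mul_mem _ _ (hcomp _ (hcoeff _)) (pow_mem ?_ i)
      exact Or.inr (by omega)
    rw [eq_neg_of_add_eq_zero_right hCH, Valuation.map_neg, map_mul] at h1
    have h2 : (H.localRing p).valuation h < 1 := (H.valuation_localRing_lt_one hh0).2 (by omega)
    rw [mul_comm] at h1
    exact absurd h1 (mul_lt_one_of_lt_of_le h2
      ((ValuationSubring.valuation_le_one_iff _ _).2 hdiv)).ne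
  -- compare valuations of the norm of `h`
  obtain ⟨m, hm⟩ := ValuationSubring.exists_valuation_algebraMap.{_, u} a hχ0
  have hm1 := hm V hV ha
  have hpow : ((S.map fun σ => V.valuation (σ h)).prod) ^ (ord φ p).toNat =
      τ ^ (S.map c).count p := by
    rw [← Multiset.prod_map_pow]
    refine Multiset.prod_eq_pow_count S c p _ τ fun σ _ => ?_
    split_ifs with hσ
    · subst hσ
      exact H.valuation_center_pow ha (hc σ) hh0 hhp
    · rw [hval σ hσ, one_pow]
  rw [← hcoeff0, hm1, ← hτ, ← zpow_natCast, ← zpow_natCast, ← zpow_mul] at hpow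
  have hinj := zpow_right_injective₀ (zero_lt_iff.2 hτ0) ha.ne hpow
  have h3 : ((ord φ p).toNat : ℤ) = ord φ p := Int.toNat_of_nonneg hp.le
  have h4 : 0 < m := by
    by_contra hle
    push Not at hle
    have : m * ((ord φ p).toNat : ℤ) ≤ 0 := mul_nonpos_of_nonpos_of_nonneg hle (by positivity)
    omega
  have h5 : 1 * ((ord φ p).toNat : ℤ) ≤ m * ((ord φ p).toNat : ℤ) :=
    mul_le_mul_of_nonneg_right (by omega) (by positivity)
  change (ord φ p).toNat ≤ _
  omega

end OrdSystem

end

noncomputable section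

open Polynomial

/-- `V` is the valuation ring of a place of `M` with residue field `k`. -/
structure ValuationSubring.IsPlace (k : Type*) {M : Type*} [Field k] [Field M] [Algebra k M]
    (V : ValuationSubring M) : Prop where
  algebraMap_mem : ∀ c : k, algebraMap k M c ∈ V
  residue : ∀ x ∈ V, ∃ c : k, V.valuation (x - algebraMap k M c) < 1

/-- Valuation rings over a point of the affine line have residue field `k`. -/
theorem ValuationSubring.isPlace_of_valuation_lt_one {k M : Type*} [Field k] [IsAlgClosed k]
    [Field M] [Algebra k M] [Algebra (RatFunc k) M] [IsScalarTower k (RatFunc k) M]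
    [Algebra.IsAlgebraic (RatFunc k) M] {V : ValuationSubring M}
    (hV : ∀ c : k, algebraMap k M c ∈ V) {a : k}
    (ha : V.valuation (algebraMap (RatFunc k) M RatFunc.X - algebraMap k M a) < 1) :
    V.IsPlace k := by
  classical
  refine ⟨hV, fun x hx => ?_⟩
  set t := algebraMap (RatFunc k) M RatFunc.X with ht
  let _ : Algebra k[X] M := ((algebraMap (RatFunc k) M).comp (algebraMap k[X] (RatFunc k))).toAlgebra
  have : IsScalarTower k[X] (RatFunc k) M := IsScalarTower.of_algebraMap_eq' rfl
  have hpoly : ∀ f : k[X], algebraMap k[X] M f = aeval t f := by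
    intro f
    change algebraMap (RatFunc k) M (algebraMap k[X] (RatFunc k) f) = _
    rw [ht, ← RatFunc.algebraMap_X, aeval_algebraMap_apply, aeval_algebraMap_apply]
    simp
  have : Module.IsTorsionFree k[X] M := .trans_faithfulSMul k[X] (RatFunc k) M
  have hxalg : IsAlgebraic k[X] x :=
    (IsFractionRing.isAlgebraic_iff k[X] (RatFunc k) M).2 (Algebra.IsAlgebraic.isAlgebraic x)
  obtain ⟨p, hp0, hpx⟩ := hxalg
  have hq := p.isPrimitive_primPart
  have hqx : aeval x p.primPart = 0 := aeval_primPart_eq_zero hp0 hpx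
  set q := p.primPart with hqdef
  set q₀ : k[X] := q.map (evalRingHom a) with hq₀
  have hq₀0 : q₀ ≠ 0 := by
    intro h
    have hdvd : C (X - C a : k[X]) ∣ q := by
      rw [C_dvd_iff_dvd_coeff]
      intro i
      rw [dvd_iff_isRoot]
      have := congrArg (fun f => coeff f i) h
      simpa [hq₀] using this
    exact not_isUnit_X_sub_C a (hq _ hdvd)
  have hmemt : ∀ f : k[X], V.valuation (aeval t f - algebraMap k M (f.eval a)) < 1 := by
    intro f
    by_cases h : V.valuation (aeval t f - algebraMap k M (f.eval a)) = 0
    · rw [h]; exact zero_lt_one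
    obtain ⟨g, hg⟩ := X_sub_C_dvd_sub_C_eval (a := a) (p := f)
    have htA : t ∈ V := by
      have := V.add_mem _ _ ((ValuationSubring.valuation_le_one_iff _ _).1 ha.le) (hV a)
      simpa using this
    have hgA : aeval t g ∈ V := by
      rw [aeval_eq_sum_range]
      refine _root_.sum_mem fun i _ => ?_
      rw [Algebra.smul_def]
      exact V.mul_mem _ _ (hV _) (pow_mem htA i)
    have := congrArg (aeval t) hg
    simp only [map_sub, map_mul, aeval_X, aeval_C] at this
    rw [this, map_mul]
    exact mul_lt_one_of_lt_of_le ha ((ValuationSubring.valuation_le_one_iff _ _).2 hgA)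
  have hlt : V.valuation (aeval x q₀) < 1 := by
    have h1 : aeval x q₀ = - ∑ i ∈ Finset.range (q.natDegree + 1),
        (aeval t (q.coeff i) - algebraMap k M ((q.coeff i).eval a)) * x ^ i := by
      have h2 : aeval x q₀ = ∑ i ∈ Finset.range (q.natDegree + 1),
          algebraMap k M ((q.coeff i).eval a) * x ^ i := by
        rw [aeval_eq_sum_range' (n := q.natDegree + 1)
          (Nat.lt_succ_of_le (natDegree_map_le))]
        refine Finset.sum_congr rfl fun i _ => ?_
        rw [Algebra.smul_def, coeff_map, coe_evalRingHom]
      have h3 : ∑ i ∈ Finset.range (q.natDegree + 1), aeval t (q.coeff i) * x ^ i = 0 := by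
        rw [← hqx, aeval_eq_sum_range]
        refine Finset.sum_congr rfl fun i _ => ?_
        rw [Algebra.smul_def, hpoly]
      rw [h2]
      simp only [sub_mul, Finset.sum_sub_distrib]
      rw [h3, zero_sub, neg_neg]
    rw [h1, Valuation.map_neg]
    refine Valuation.map_sum_lt _ one_ne_zero fun i _ => ?_
    rw [map_mul]
    exact mul_lt_one_of_lt_of_le (hmemt _)
      ((ValuationSubring.valuation_le_one_iff _ _).2 (pow_mem hx i))
  have hsplit := IsAlgClosed.splits q₀
  rw [hsplit.eq_prod_roots, map_mul, aeval_C, map_multiset_prod, Multiset.map_map, map_mul,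
    map_multiset_prod, Multiset.map_map] at hlt
  by_contra hall
  push Not at hall
  have hone : ∀ c : k, V.valuation (x - algebraMap k M c) = 1 := fun c =>
    le_antisymm ((ValuationSubring.valuation_le_one_iff _ _).2 (sub_mem hx (hV c))) (hall c)
  have hlead : V.valuation (algebraMap k M q₀.leadingCoeff) = 1 := by
    refine le_antisymm ((ValuationSubring.valuation_le_one_iff _ _).2 (hV _)) ?_
    have := (ValuationSubring.valuation_le_one_iff V _).2 (hV q₀.leadingCoeff⁻¹)
    rw [map_inv₀, map_inv₀] at this
    exact (inv_le_one₀ (zero_lt_iff.2 ((Valuation.ne_zero_iff _).2 (by simpa using hq₀0)))).1 this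
  rw [hlead, one_mul, Multiset.prod_eq_one] at hlt
  · exact lt_irrefl _ hlt
  · intro y hy
    obtain ⟨c, -, rfl⟩ := Multiset.mem_map.1 hy
    simpa using hone c

/-- Characters of subalgebras extend to valuation rings. -/
theorem Subalgebra.exists_valuationSubring {k M : Type*} [Field k] [Field M] [Algebra k M]
    (R : Subalgebra k M) (ψ : R →ₐ[k] k) : ∃ V : ValuationSubring M,
      (∀ x ∈ R, x ∈ V) ∧ ∀ x : R, V.valuation (x - algebraMap k M (ψ x)) < 1 := by
  obtain ⟨V, hRV, hV⟩ := Ideal.image_subset_nonunits_valuationSubring (A := R.toSubring)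
    (RingHom.ker ψ.toRingHom : Ideal R) (RingHom.ker_ne_top _)
  refine ⟨V, fun x hx => hRV hx, fun x => ?_⟩
  refine (ValuationSubring.mem_nonunits_iff V).1 (hV ⟨x - algebraMap k R (ψ x), ?_, rfl⟩)
  change ψ (x - algebraMap k R (ψ x)) = 0
  simp

/-- Places over a given point of the affine line. -/
theorem ValuationSubring.exists_valuation_X_sub_lt_one {k M : Type*} [Field k]
    [Field M] [Algebra k M] [Algebra (RatFunc k) M] [IsScalarTower k (RatFunc k) M] (a : k) :
    ∃ V : ValuationSubring M, (∀ c : k, algebraMap k M c ∈ V) ∧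
      V.valuation (algebraMap (RatFunc k) M RatFunc.X - algebraMap k M a) < 1 := by
  set t := algebraMap (RatFunc k) M RatFunc.X with ht
  let ι : k[X] →ₐ[k] M := aeval t
  have hinj : Function.Injective ι := by
    have h : ∀ f : k[X], ι f = algebraMap (RatFunc k) M (algebraMap k[X] (RatFunc k) f) := by
      intro f
      change aeval t f = _
      rw [ht, ← RatFunc.algebraMap_X, aeval_algebraMap_apply, aeval_algebraMap_apply]
      simp
    intro f g hfg
    rw [h, h] at hfg
    exact RatFunc.algebraMap_injective k ((algebraMap (RatFunc k) M).injective hfg)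
  let e := AlgEquiv.ofInjective ι hinj
  obtain ⟨V, hRV, hV⟩ := ι.range.exists_valuationSubring ((aeval a).comp e.symm.toAlgHom)
  refine ⟨V, fun c => hRV _ (ι.range.algebraMap_mem c), ?_⟩
  have := hV (e X)
  have h2 : ((e X : ι.range) : M) = t := by
    change aeval t X = t
    simp
  have h3 : ((aeval a).comp e.symm.toAlgHom) (e X) = a := by simp
  rwa [h2, h3] at this

namespace OrdSystem

universe u

variable {k K : Type u} {P : Type*} [Field k] [Field K] [Algebra k K]
  {ord : K → P → ℤ} (H : OrdSystem k ord) [IsAlgClosed k]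

/-- The inclusion of the field of rational functions given by a transcendental element. -/
def _root_.RatFunc.toTranscendental {k K : Type*} [Field k] [Field K] [Algebra k K] {f : K}
    (hf : Transcendental k f) : RatFunc k →ₐ[k] K :=
  RatFunc.liftAlgHom (aeval f) (by
    intro p hp
    rw [Submonoid.mem_comap, mem_nonZeroDivisors_iff_ne_zero]
    intro h
    exact nonZeroDivisors.ne_zero hp ((transcendental_iff.1 hf) p h))

theorem _root_.RatFunc.toTranscendental_X {k K : Type*} [Field k] [Field K] [Algebra k K] {f : K}
    (hf : Transcendental k f) : RatFunc.toTranscendental hf RatFunc.X = f := by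
  have := RatFunc.liftAlgHom_apply_div' (K := k) (S := k) (L := K) (φ := aeval f) (by
    intro p hp
    rw [Submonoid.mem_comap, mem_nonZeroDivisors_iff_ne_zero]
    intro h
    exact nonZeroDivisors.ne_zero hp ((transcendental_iff.1 hf) p h)) X 1
  simp only [map_one, div_one, RatFunc.algebraMap_X, aeval_X] at this
  exact this

include H

/-- A nonconstant function has as many zeros as it has poles. -/
theorem degree_zeros_eq (f : K) (hf : f ≠ 0) :
    ((H.zeros f hf).sum fun _ n => n) = (H.poles f hf).sum fun _ n => n := by
  suffices key : ∀ (f : K) (hf : f ≠ 0),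
      ((H.zeros f hf).sum fun _ n => n) ≤ (H.poles f hf).sum fun _ n => n by
    refine le_antisymm (key f hf) ?_
    have := key f⁻¹ (inv_ne_zero hf)
    simpa only [zeros, inv_inv] using this
  intro f hf
  by_cases halg : IsAlgebraic k f
  · obtain ⟨c, rfl⟩ := IsAlgClosed.exists_algebraMap_eq_of_isIntegral halg.isIntegral
    have : H.zeros _ hf = 0 := by
      ext p
      rw [H.zeros_apply, H.const c p (by rintro rfl; simp at hf)]
      rfl
    rw [this]
    simp
  have htr : Transcendental k f := halg
  let _ : Algebra (RatFunc k) K := (RatFunc.toTranscendental htr).toAlgebra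
  have : IsScalarTower k (RatFunc k) K :=
    IsScalarTower.of_algebraMap_eq fun c => ((RatFunc.toTranscendental htr).commutes c).symm
  have hX : algebraMap (RatFunc k) K RatFunc.X = f := RatFunc.toTranscendental_X htr
  let M := AlgebraicClosure (RatFunc k)
  obtain ⟨hfin, -⟩ := H.finrank_le_degree_zeros (K := K) 0
  obtain ⟨S, hS, hchar⟩ := exists_multiset_embeddings (RatFunc k) K M
  obtain ⟨V, hV, ha⟩ := ValuationSubring.exists_valuation_X_sub_lt_one (M := M) (0 : k)
  choose c hc using fun σ : K →ₐ[RatFunc k] M => H.exists_center V hV (σ.restrictScalars k)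
  have h1 := congrArg Multiset.card (H.map_center_eq_zeros hV ha hS hchar hc)
  rw [Multiset.card_map, hS, Finsupp.card_toMultiset] at h1
  have hXtr : Transcendental k (RatFunc.X : RatFunc k) := by
    rw [← RatFunc.algebraMap_X, transcendental_algebraMap_iff (RatFunc.algebraMap_injective k)]
    exact transcendental_X k
  have h2 := (H.finite_of_transcendental (K := K) hXtr (by rwa [hX])).2
  rw [h1] at h2
  simp only [hX, map_zero, sub_zero] at h2
  exact h2

/-- The degree of a principal divisor is zero. -/
theorem sum_ord_eq_zero (f : K) (hf : f ≠ 0) (D : P →₀ ℤ) (hD : ∀ p, D p = ord f p) :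
    (D.sum fun _ n => n) = 0 := by
  classical
  have h := H.degree_zeros_eq f hf
  have hD' : D = (H.zeros f hf).mapRange (fun n : ℕ => (n : ℤ)) Nat.cast_zero -
      (H.poles f hf).mapRange (fun n : ℕ => (n : ℤ)) Nat.cast_zero := by
    ext p
    rw [Finsupp.sub_apply, Finsupp.mapRange_apply, Finsupp.mapRange_apply, H.zeros_apply,
      H.poles_apply, hD]
    omega
  have hcast : ∀ E : P →₀ ℕ, ((E.mapRange (fun n : ℕ => (n : ℤ)) Nat.cast_zero).sum fun _ n => n) =
      ((E.sum fun _ n => n : ℕ) : ℤ) := by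
    intro E
    rw [Finsupp.sum_mapRange_index (fun _ => rfl), Finsupp.sum, Finsupp.sum]
    push_cast
    rfl
  rw [hD', Finsupp.sum_sub_index (fun _ _ _ => rfl), hcast, hcast, h, sub_self]

/-- There are infinitely many points. -/
theorem infinite_points [Nonempty P] : Infinite P := by
  obtain ⟨p⟩ := ‹Nonempty P›
  obtain ⟨f, hf, hfp⟩ := H.uniformizer p
  have hnc : ∀ c, f ≠ algebraMap k K c := by
    rintro c rfl
    have hc : c ≠ 0 := by rintro rfl; simp at hf
    rw [H.const c p hc] at hfp
    omega
  have hzero : ∀ c : k, ∃ q, 0 < ord (f - algebraMap k K c) q := by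
    intro c
    by_contra hno
    push Not at hno
    have hne : f - algebraMap k K c ≠ 0 := sub_ne_zero.2 (hnc c)
    obtain ⟨b, hb⟩ := H.exists_const_of_forall_ge (f := (f - algebraMap k K c)⁻¹) fun q =>
      Or.inr (by rw [H.inv hne]; have := hno q; omega)
    apply hnc (b⁻¹ + c)
    rw [map_add, map_inv₀, ← hb, inv_inv, sub_add_cancel]
  choose q hq using hzero
  have : Infinite k := inferInstance
  refine Infinite.of_injective q fun b c hbc => ?_
  by_contra hne
  have h1 : H.GE (f - algebraMap k K b) (q b) 1 := Or.inr (hq b)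
  have h2 : H.GE (f - algebraMap k K c) (q b) 1 := Or.inr (by rw [hbc]; exact hq c)
  have h3 := H.ge_sub h1 h2
  have h4 : f - algebraMap k K b - (f - algebraMap k K c) = algebraMap k K (c - b) := by
    rw [map_sub]; ring
  have hcb : c - b ≠ 0 := sub_ne_zero.2 (Ne.symm hne)
  rw [h4, H.ge_iff ((_root_.map_ne_zero _).2 hcb), H.const _ _ hcb] at h3
  omega

end OrdSystem

end

noncomputable section

open IsLocalRing

theorem MvPolynomial.isPrincipalIdealRing_of_bijective {R k : Type*} [CommRing R] [Field k]
    {σ : Type*} [Unique σ] {f : R →+* k} (hf : Function.Bijective f) :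
    IsDomain (MvPolynomial σ R) ∧ IsPrincipalIdealRing (MvPolynomial σ R) := by
  let e : MvPolynomial σ R ≃+* Polynomial k :=
    (MvPolynomial.mapEquiv σ (RingEquiv.ofBijective f hf)).trans
      (MvPolynomial.uniqueAlgEquiv k σ).toRingEquiv
  exact ⟨e.toMulEquiv.isDomain _, IsPrincipalIdealRing.of_surjective e.symm.toRingHom e.symm.surjective⟩

/-- The local rings of a smooth curve at rational points are discrete valuation rings. -/
theorem RingHom.IsStandardSmoothOfRelativeDimension.isDiscreteValuationRing {R A S k : Type*}
    [CommRing R] [CommRing A] [CommRing S] [Field k] [IsDomain A] [IsDomain S] [IsLocalRing S]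
    [IsNoetherianRing S] {φ : R →+* A} (hφ : φ.IsStandardSmoothOfRelativeDimension 1)
    (q : Ideal A) [q.IsPrime] [Algebra A S] [IsLocalization.AtPrime S q] (ψ : S →+* k)
    [IsLocalHom ψ] (hψ : Function.Bijective ((ψ.comp (algebraMap A S)).comp φ)) :
    IsDiscreteValuationRing S := by
  obtain ⟨g, hg, het⟩ := hφ.exists_etale_mvPolynomial
  obtain ⟨hdom, hpid⟩ := MvPolynomial.isPrincipalIdealRing_of_bijective (σ := Fin 1) hψ
  algebraize [g]
  set B := MvPolynomial (Fin 1) R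
  let p : Ideal B := q.under B
  have hmap : p.map (algebraMap B (Localization.AtPrime q)) =
      maximalIdeal (Localization.AtPrime q) := by
    let _ : Algebra (Localization.AtPrime p) (Localization.AtPrime q) :=
      Localization.AtPrime.algebraOfLiesOver p q
    have := (Algebra.isUnramifiedAt_iff_map_eq B p q).1 inferInstance
    exact this.2
  let e : Localization.AtPrime q ≃ₐ[A] S := IsLocalization.algEquiv q.primeCompl _ _
  obtain ⟨π, hπ⟩ := (IsPrincipalIdealRing.principal p).principal
  have hmax : maximalIdeal S = Ideal.span {algebraMap A S (algebraMap B A π)} := by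
    ext x
    have h1 : x ∈ maximalIdeal S ↔ e.symm x ∈ maximalIdeal (Localization.AtPrime q) := by
      rw [mem_maximalIdeal, mem_maximalIdeal, mem_nonunits_iff, mem_nonunits_iff,
        MulEquiv.isUnit_map]
    have hπ' : p = Ideal.span {π} := hπ
    rw [h1, ← hmap, hπ', Ideal.map_span, Set.image_singleton, Ideal.mem_span_singleton,
      Ideal.mem_span_singleton, IsScalarTower.algebraMap_apply B A, ← map_dvd_iff e,
      AlgEquiv.apply_symm_apply, AlgEquiv.commutes]
  have hinjA : Function.Injective (algebraMap B A) := by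
    have : Module.Flat B A := inferInstance
    exact FaithfulSMul.algebraMap_injective B A
  have hinjS : Function.Injective (algebraMap A S) :=
    IsLocalization.injective S q.primeCompl_le_nonZeroDivisors
  have hnf : ¬ IsField S := by
    obtain ⟨c, hc⟩ := hψ.2 (ψ (algebraMap A S (algebraMap B A (MvPolynomial.X 0))))
    set z : B := MvPolynomial.X 0 - MvPolynomial.C c with hz
    have hz0 : z ≠ 0 := by
      intro h
      have : Nontrivial R := ((ψ.comp (algebraMap A S)).comp φ).domain_nontrivial
      simpa [hz] using congrArg (MvPolynomial.eval fun _ => c + 1) h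
    have hzψ : ψ (algebraMap A S (algebraMap B A z)) = 0 := by
      rw [hz, map_sub, map_sub, map_sub, ← hc, sub_eq_zero]
      have : algebraMap B A (MvPolynomial.C c) = φ c := congrArg (fun f => f c) hg
      rw [this]
      rfl
    rw [IsLocalRing.isField_iff_maximalIdeal_eq]
    intro h
    have hmem : algebraMap A S (algebraMap B A z) ∈ maximalIdeal S := by
      rw [mem_maximalIdeal, mem_nonunits_iff]
      intro hu
      exact (hu.map ψ).ne_zero hzψ
    rw [h, Ideal.mem_bot] at hmem
    exact hz0 (hinjA (hinjS (by rw [hmem, map_zero, map_zero])))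
  have hprin : (maximalIdeal S).IsPrincipal := ⟨⟨_, hmax⟩⟩
  exact ((IsDiscreteValuationRing.TFAE S hnf).out 0 4).2 hprin

end

noncomputable section

namespace AbelLLS

universe u

variable {k : Type u} [Field k]

/-- Two maps from an integral affine scheme to a separated scheme agree if they agree
on a dominant affine scheme. -/
theorem specMap_ext_of_isSeparated {X Y : Scheme.{u}} (f : X ⟶ Y) [IsSeparated f]
    {R M : CommRingCat.{u}} [IsDomain R] (i : R ⟶ M) (hi : Function.Injective i.hom)
    {l₁ l₂ : Spec R ⟶ X} (h : Spec.map i ≫ l₁ = Spec.map i ≫ l₂) (h' : l₁ ≫ f = l₂ ≫ f) :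
    l₁ = l₂ := by
  have : IsDominant (Spec.map i) := ⟨(PrimeSpectrum.denseRange_comap_iff_ker_le_nilRadical _).2
    (((RingHom.injective_iff_ker_eq_bot _).1 hi).trans_le bot_le)⟩
  exact ext_of_isDominant_of_isSeparated f h' (Spec.map i) h

theorem KPoint.pt_injective [IsAlgClosed k] {S : Scheme.{u}} {f : S ⟶ Spec (.of k)}
    [LocallyOfFiniteType f] : Function.Injective (KPoint.pt (f := f)) := fun _ _ h =>
  (pointEquivClosedPoint f).injective (Subtype.ext h)

theorem KPoint.isClosed_pt [IsAlgClosed k] {S : Scheme.{u}} {f : S ⟶ Spec (.of k)}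
    [LocallyOfFiniteType f] (p : KPoint f) : IsClosed {p.pt} := (pointEquivClosedPoint f p).2

theorem KPoint.exists_pt_eq [IsAlgClosed k] {S : Scheme.{u}} {f : S ⟶ Spec (.of k)}
    [LocallyOfFiniteType f] {x : S} (hx : IsClosed {x}) : ∃ p : KPoint f, p.pt = x := by
  obtain ⟨p, hp⟩ := (pointEquivClosedPoint f).surjective ⟨x, hx⟩
  exact ⟨p, congrArg Subtype.val hp⟩

namespace SmoothCurve

variable (C : SmoothCurve k)

/-- The `k`-algebra structure of a local ring of the curve. -/
def constGerm (x : C.scheme) : CommRingCat.of k ⟶ C.scheme.presheaf.stalk x :=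
  (Scheme.ΓSpecIso (.of k)).inv ≫ C.str.appTop ≫ C.scheme.presheaf.germ ⊤ x trivial

theorem specMap_constGerm (x : C.scheme) :
    Spec.map (C.constGerm x) = C.scheme.fromSpecStalk x ≫ C.str := by
  rw [constGerm, Spec.map_comp, Spec.map_comp, ← Scheme.fromSpecStalk_toSpecΓ]
  simp only [Category.assoc]
  congr 1
  rw [← Scheme.toSpecΓ_naturality_assoc]
  simp

theorem constGerm_stalkSpecializes {x y : C.scheme} (h : x ⤳ y) :
    C.constGerm y ≫ C.scheme.presheaf.stalkSpecializes h = C.constGerm x := by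
  have h := TopCat.Presheaf.germ_stalkSpecializes C.scheme.presheaf (U := ⊤) trivial h
  exact congrArg (fun t => (Scheme.ΓSpecIso (.of k)).inv ≫ C.str.appTop ≫ t) h

theorem algebraMap_constGerm (x : C.scheme) (c : k) :
    algebraMap (C.scheme.presheaf.stalk x) C.FunctionField ((C.constGerm x).hom c) =
      algebraMap k C.FunctionField c := by
  have := C.constGerm_stalkSpecializes (genericPoint_specializes x)
  exact congrArg (fun f => f.hom c) this

/-- Evaluation of germs of functions at a rational point. -/
def stalkEval (p : C.Point) : C.scheme.presheaf.stalk p.pt ⟶ CommRingCat.of k :=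
  Scheme.stalkClosedPointTo p.1

instance (p : C.Point) : IsLocalHom (C.stalkEval p).hom :=
  Scheme.isLocalHom_stalkClosedPointTo' p.1

theorem specMap_stalkEval (p : C.Point) :
    Spec.map (C.stalkEval p) ≫ C.scheme.fromSpecStalk p.pt = p.1 :=
  Scheme.Spec_stalkClosedPointTo_fromSpecStalk p.1

theorem constGerm_stalkEval (p : C.Point) : C.constGerm p.pt ≫ C.stalkEval p = 𝟙 _ := by
  apply Spec.map_injective
  rw [Spec.map_comp, specMap_constGerm, ← Category.assoc, specMap_stalkEval, p.2, Spec.map_id]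

theorem stalkEval_constGerm (p : C.Point) (c : k) :
    (C.stalkEval p).hom ((C.constGerm p.pt).hom c) = c :=
  congrArg (fun f => f.hom c) (C.constGerm_stalkEval p)

instance isDiscreteValuationRing_stalk (p : C.Point) :
    IsDiscreteValuationRing (C.scheme.presheaf.stalk p.pt) := by
  obtain ⟨U, hU, V, hV, hx, e, hsm⟩ :=
    SmoothOfRelativeDimension.exists_isStandardSmoothOfRelativeDimension (n := 1) (f := C.str) p.pt
  have : Nonempty V := ⟨⟨_, hx⟩⟩
  have := hV.isLocalization_stalk ⟨p.pt, hx⟩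
  have hUtop : U = ⊤ := by
    ext y
    have : Subsingleton (Spec (.of k)) := inferInstanceAs (Subsingleton (PrimeSpectrum k))
    have hy : y = C.str p.pt := Subsingleton.elim _ _
    simp only [TopologicalSpace.Opens.coe_top, Set.mem_univ, iff_true, hy]
    exact e hx
  subst hUtop
  let _ : Algebra Γ(C.scheme, V) (C.scheme.presheaf.stalk p.pt) :=
    (C.scheme.presheaf.germ V p.pt hx).hom.toAlgebra
  have : IsLocalization.AtPrime (C.scheme.presheaf.stalk p.pt)
    (hV.primeIdealOf ⟨p.pt, hx⟩).asIdeal := hV.isLocalization_stalk ⟨p.pt, hx⟩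
  have : IsNoetherianRing (C.scheme.presheaf.stalk p.pt) := inferInstance
  refine hsm.isDiscreteValuationRing (hV.primeIdealOf ⟨p.pt, hx⟩).asIdeal (C.stalkEval p).hom ?_
  have key : C.str.appLE ⊤ V e ≫ C.scheme.presheaf.germ V p.pt hx ≫ C.stalkEval p =
      (Scheme.ΓSpecIso (.of k)).hom := by
    have h := C.constGerm_stalkEval p
    rw [constGerm, Category.assoc, Iso.inv_comp_eq, Category.comp_id, Category.assoc] at h
    rw [← h, Scheme.Hom.appLE, Category.assoc, TopCat.Presheaf.germ_res_assoc]
    rfl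
  have hb : Function.Bijective (Scheme.ΓSpecIso (.of k)).hom.hom :=
    ConcreteCategory.bijective_of_isIso (Scheme.ΓSpecIso (.of k)).hom
  rw [← key] at hb
  exact hb

theorem coheight_pt (p : C.Point) : Order.coheight p.pt = 1 := by
  have h := ringKrullDim_stalk_eq_coheight p.pt
  rw [IsDiscreteValuationRing.ringKrullDim_eq_one] at h
  exact_mod_cast h.symm

instance krullDimLE_stalk (p : C.Point) : Ring.KrullDimLE 1 (C.scheme.presheaf.stalk p.pt) :=
  krullDimLE_of_coheight_le (C.coheight_pt p).le

theorem le_ord_iff {f : C.FunctionField} (hf : f ≠ 0) (p : C.Point) (n : ℤ) :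
    n ≤ C.ord f p ↔
      ((Multiplicative.ofAdd n : Multiplicative ℤ) : WithZero (Multiplicative ℤ)) ≤
        Ring.ordFrac (C.scheme.presheaf.stalk p.pt) f :=
  Scheme.le_ord_iff (C.coheight_pt p) hf

theorem ord_eq_iff {f : C.FunctionField} (hf : f ≠ 0) (p : C.Point) (n : ℤ) :
    C.ord f p = n ↔ Ring.ordFrac (C.scheme.presheaf.stalk p.pt) f =
      ((Multiplicative.ofAdd n : Multiplicative ℤ) : WithZero (Multiplicative ℤ)) :=
  Scheme.ord_eq_iff (C.coheight_pt p) hf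

theorem algebraMap_stalk_ne_zero {x : C.scheme} {a : C.scheme.presheaf.stalk x} (ha : a ≠ 0) :
    algebraMap _ C.FunctionField a ≠ 0 := by
  rw [Ne, ← map_zero (algebraMap (C.scheme.presheaf.stalk x) C.FunctionField)]
  exact fun h => ha (IsFractionRing.injective (C.scheme.presheaf.stalk x) C.FunctionField h)

theorem ord_nonneg_of_mem {p : C.Point} (x : C.scheme.presheaf.stalk p.pt) :
    0 ≤ C.ord (algebraMap _ C.FunctionField x) p := by
  by_cases hx : x = 0
  · rw [hx, map_zero, ord, Scheme.ord_zero]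
    rfl
  · rw [le_ord_iff]
    · exact Ring.ordFrac_ge_one_of_ne_zero hx
    · exact C.algebraMap_stalk_ne_zero hx

theorem ord_eq_zero_iff_isUnit {p : C.Point} {x : C.scheme.presheaf.stalk p.pt} (hx : x ≠ 0) :
    C.ord (algebraMap _ C.FunctionField x) p = 0 ↔ IsUnit x := by
  rw [C.ord_eq_iff (C.algebraMap_stalk_ne_zero hx)]
  exact (Ring.isUnit_iff_ordFrac_one_of_isDiscreteValuationRing (K := C.FunctionField)).symm

theorem exists_of_ord_nonneg {f : C.FunctionField} {p : C.Point} (h : 0 ≤ C.ord f p) :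
    ∃ x : C.scheme.presheaf.stalk p.pt, algebraMap _ C.FunctionField x = f := by
  by_cases hf : f = 0
  · exact ⟨0, by rw [hf, map_zero]⟩
  obtain ⟨x, hx⟩ | ⟨x, hx⟩ := ValuationRing.isInteger_or_isInteger
    (C.scheme.presheaf.stalk p.pt) f
  · exact ⟨x, hx⟩
  · have hx0 : x ≠ 0 := by
      rintro rfl
      rw [map_zero] at hx
      exact inv_ne_zero hf hx.symm
    have h1 := C.ord_nonneg_of_mem x
    rw [hx, ord_inv _ hf] at h1
    obtain ⟨u, rfl⟩ := (C.ord_eq_zero_iff_isUnit hx0).1 (by rw [hx, ord_inv _ hf]; omega)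
    refine ⟨((u⁻¹ : (C.scheme.presheaf.stalk p.pt)ˣ) : C.scheme.presheaf.stalk p.pt), ?_⟩
    rw [← inv_inv f, ← hx]
    apply eq_inv_of_mul_eq_one_left
    rw [← map_mul, Units.inv_mul, map_one]

theorem stalkEval_eq_zero_iff {p : C.Point} {x : C.scheme.presheaf.stalk p.pt} (hx : x ≠ 0) :
    (C.stalkEval p).hom x = 0 ↔ 1 ≤ C.ord (algebraMap _ C.FunctionField x) p := by
  have h1 : IsUnit ((C.stalkEval p).hom x) ↔ IsUnit x := isUnit_map_iff _ _
  have h2 := C.ord_nonneg_of_mem x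
  have h3 := C.ord_eq_zero_iff_isUnit hx
  rw [← h1, isUnit_iff_ne_zero] at h3
  constructor
  · intro h
    have := mt h3.1 (by simpa using h)
    omega
  · intro h
    by_contra h'
    have := h3.2 h'
    omega

theorem ord_algebraMap {c : k} (hc : c ≠ 0) (p : C.Point) :
    C.ord (algebraMap k C.FunctionField c) p = 0 := by
  rw [← C.algebraMap_constGerm p.pt c, ord_eq_zero_iff_isUnit]
  · exact (isUnit_iff_ne_zero.2 hc).map (C.constGerm p.pt).hom
  · exact ((isUnit_iff_ne_zero.2 hc).map (C.constGerm p.pt).hom).ne_zero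

theorem exists_residue {f : C.FunctionField} {p : C.Point} (h : 0 ≤ C.ord f p) :
    ∃ c : k, f = algebraMap k _ c ∨ 1 ≤ C.ord (f - algebraMap k _ c) p := by
  obtain ⟨x, rfl⟩ := C.exists_of_ord_nonneg h
  refine ⟨(C.stalkEval p).hom x, or_iff_not_imp_left.2 fun hne => ?_⟩
  rw [← C.algebraMap_constGerm p.pt, ← map_sub, ← stalkEval_eq_zero_iff]
  · rw [map_sub, stalkEval_constGerm, sub_self]
  · intro h
    rw [sub_eq_zero] at h
    apply hne
    conv_lhs => rw [h]
    exact C.algebraMap_constGerm p.pt _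

theorem exists_ord_eq_one (p : C.Point) : ∃ f : C.FunctionField, f ≠ 0 ∧ C.ord f p = 1 := by
  obtain ⟨x, hx⟩ := IsDiscreteValuationRing.exists_irreducible (C.scheme.presheaf.stalk p.pt)
  have hx0 := C.algebraMap_stalk_ne_zero hx.ne_zero
  refine ⟨algebraMap _ C.FunctionField x, hx0, ?_⟩
  rw [ord_eq_iff _ hx0]
  exact Ring.ordFrac_irreducible hx

theorem ord_add_ge {f g : C.FunctionField} (h : f + g ≠ 0) (p : C.Point) :
    min (C.ord f p) (C.ord g p) ≤ C.ord (f + g) p := Scheme.ord_add h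

theorem eq_pt_of_specializes {p : C.Point} {w : C.scheme} (hw : w ⤳ p.pt)
    (hη : w ≠ genericPoint C.scheme) : w = p.pt := by
  by_contra hne
  have h1 : p.pt < w := ⟨hw, fun h => hne (Specializes.antisymm hw h).eq⟩
  have h2 : w < genericPoint C.scheme := ⟨genericPoint_specializes w, fun h =>
    hη (Specializes.antisymm h (genericPoint_specializes w)).eq⟩
  have h3 := Order.coheight_add_one_le h1
  have h4 := Order.coheight_add_one_le h2
  rw [coheight_pt] at h3
  have h5 : (1 : ℕ∞) ≤ Order.coheight w := le_trans (by simp) h4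
  have h6 : (1 : ℕ∞) + 1 ≤ 1 := le_trans (add_le_add_left h5 1) h3
  norm_num at h6

instance : CompactSpace C.scheme := QuasiCompact.compactSpace_of_compactSpace C.str

instance : IsNoetherian C.scheme where

theorem finite_support_ord [IsAlgClosed k] {f : C.FunctionField} (hf : f ≠ 0) : {p | C.ord f p ≠ 0}.Finite := by
  obtain ⟨U, hU, g, hne, rfl, hg⟩ := exists_isUnit_germ_eq C.scheme f hf
  obtain ⟨S, hS, hcl, hirr, hUS⟩ := TopologicalSpace.NoetherianSpace.exists_finite_set_isClosed_irreducible
    (U.isOpen.isClosed_compl)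
  refine (hS.biUnion (t := fun t => {p : C.Point | p.pt ∈ t}) fun t ht => ?_).subset ?_
  · apply Set.Subsingleton.finite
    obtain ⟨w, hw⟩ := QuasiSober.sober (hirr t ht) (hcl t ht)
    have hwU : w ∈ (U : Set C.scheme)ᶜ := by
      rw [hUS]
      exact ⟨t, ht, hw.mem⟩
    have hη : w ≠ genericPoint C.scheme := by
      rintro rfl
      exact hwU (((genericPoint_spec C.scheme).mem_open_set_iff U.isOpen).2 (by simpa using hne))
    have key (p : C.Point) (hp : p.pt ∈ t) : w = p.pt :=
      C.eq_pt_of_specializes (hw.specializes hp) hη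
    intro p hp q hq
    exact KPoint.pt_injective ((key p hp).symm.trans (key q hq))
  · intro p hp
    have : p.pt ∈ (U : Set C.scheme)ᶜ := fun h => hp (Scheme.ord_of_isUnit hg h)
    rw [hUS] at this
    obtain ⟨t, ht, hpt⟩ := this
    exact Set.mem_biUnion ht hpt

/-- The generic point of the curve, as a morphism from the spectrum of the function field. -/
def genericMap : Spec (.of C.FunctionField) ⟶ C.scheme :=
  C.scheme.fromSpecStalk (genericPoint C.scheme)

theorem genericMap_str :
    C.genericMap ≫ C.str = Spec.map (CommRingCat.ofHom (algebraMap k C.FunctionField)) :=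
  (C.specMap_constGerm _).symm

theorem specMap_algebraMap_fromSpecStalk (x : C.scheme) :
    Spec.map (CommRingCat.ofHom (algebraMap (C.scheme.presheaf.stalk x) C.FunctionField)) ≫
      C.scheme.fromSpecStalk x = C.genericMap :=
  Scheme.SpecMap_stalkSpecializes_fromSpecStalk (genericPoint_specializes x)

theorem exists_center [IsAlgClosed k] (A : ValuationSubring C.FunctionField)
    (hA : ∀ c : k, algebraMap k C.FunctionField c ∈ A) :
    ∃ p, ∀ f, f ≠ 0 → 0 ≤ C.ord f p → f ∈ A := by
  let i : k →+* A := (algebraMap k C.FunctionField).codRestrict A.toSubring hA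
  let S : ValuativeCommSq C.str :=
    { R := A
      K := C.FunctionField
      i₁ := C.genericMap
      i₂ := Spec.map (CommRingCat.ofHom i)
      commSq := ⟨by
        rw [genericMap_str, ← Spec.map_comp]
        rfl⟩ }
  have hC : IsProper C.str := inferInstance
  rw [IsProper.eq_valuativeCriterion] at hC
  obtain ⟨⟨l, hl, hl'⟩⟩ := (ValuativeCriterion.existence hC.1.1.1 S).exists_lift
  obtain ⟨x, hx, hxc⟩ := isClosed_closure.exists_closed_singleton
    (S := closure {l (IsLocalRing.closedPoint A)}) ⟨_, subset_closure rfl⟩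
  obtain ⟨p, rfl⟩ := KPoint.exists_pt_eq (f := C.str) hxc
  have hp : l (IsLocalRing.closedPoint A) ⤳ p.pt := specializes_iff_mem_closure.2 hx
  refine ⟨p, fun f hf h => ?_⟩
  obtain ⟨y, rfl⟩ := C.exists_of_ord_nonneg h
  have key : C.scheme.presheaf.stalkSpecializes hp ≫
      Scheme.stalkClosedPointTo (R := .of A) l ≫ CommRingCat.ofHom (algebraMap A C.FunctionField) =
      CommRingCat.ofHom (algebraMap (C.scheme.presheaf.stalk p.pt) C.FunctionField) := by
    apply Spec.map_injective
    rw [← cancel_mono (C.scheme.fromSpecStalk p.pt), specMap_algebraMap_fromSpecStalk,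
      Spec.map_comp, Spec.map_comp, Category.assoc, Category.assoc,
      Scheme.SpecMap_stalkSpecializes_fromSpecStalk]
    exact (congrArg (Spec.map (CommRingCat.ofHom (algebraMap A C.FunctionField)) ≫ ·)
      (Scheme.Spec_stalkClosedPointTo_fromSpecStalk (R := .of A) l)).trans hl
  have h2 := congrArg (fun g => g.hom y) key
  rw [show algebraMap (C.scheme.presheaf.stalk p.pt) C.FunctionField y = _ from h2.symm]
  exact Subtype.property _

theorem exists_ord_nonneg_ord_neg [IsAlgClosed k] {p q : C.Point} (hpq : p ≠ q) :
    ∃ f : C.FunctionField, f ≠ 0 ∧ 0 ≤ C.ord f p ∧ C.ord f q < 0 := by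
  by_contra! H
  have hmem (x : C.scheme.presheaf.stalk p.pt) : algebraMap _ C.FunctionField x ∈
      (algebraMap (C.scheme.presheaf.stalk q.pt) C.FunctionField).range := by
    by_cases hx : x = 0
    · rw [hx, map_zero]
      exact zero_mem _
    · exact C.exists_of_ord_nonneg (H _ (C.algebraMap_stalk_ne_zero hx) (C.ord_nonneg_of_mem x))
  let e := RingEquiv.ofBijective
    (algebraMap (C.scheme.presheaf.stalk q.pt) C.FunctionField).rangeRestrict
    ⟨fun a b h => IsFractionRing.injective (C.scheme.presheaf.stalk q.pt) C.FunctionField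
      (congrArg Subtype.val h), RingHom.rangeRestrict_surjective _⟩
  obtain ⟨φ, hφ⟩ : ∃ φ : C.scheme.presheaf.stalk p.pt ⟶ C.scheme.presheaf.stalk q.pt, ∀ x,
      algebraMap (C.scheme.presheaf.stalk q.pt) C.FunctionField (φ.hom x) =
        algebraMap _ C.FunctionField x :=
    ⟨CommRingCat.ofHom (e.symm.toRingHom.comp ((algebraMap
        (C.scheme.presheaf.stalk p.pt) C.FunctionField).codRestrict _ hmem)),
      fun x => congrArg Subtype.val (e.apply_symm_apply ⟨_, hmem x⟩)⟩
  have hφk : C.constGerm p.pt ≫ φ = C.constGerm q.pt := by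
    ext c
    apply IsFractionRing.injective (C.scheme.presheaf.stalk q.pt) C.FunctionField
    rw [C.algebraMap_constGerm]
    exact (hφ _).trans (C.algebraMap_constGerm _ _)
  have hl : C.scheme.fromSpecStalk q.pt =
      Spec.map φ ≫ C.scheme.fromSpecStalk p.pt := by
    apply specMap_ext_of_isSeparated C.str
      (CommRingCat.ofHom (algebraMap (C.scheme.presheaf.stalk q.pt) C.FunctionField))
    · exact IsFractionRing.injective _ _
    · rw [specMap_algebraMap_fromSpecStalk, ← C.specMap_algebraMap_fromSpecStalk p.pt,
        ← Category.assoc, ← Spec.map_comp]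
      congr 2
      ext x
      exact (hφ x).symm
    · rw [Category.assoc, ← specMap_constGerm, ← specMap_constGerm, ← Spec.map_comp, hφk]
  have hq : q.pt ∈ Set.range (C.scheme.fromSpecStalk p.pt) := by
    refine ⟨Spec.map φ (IsLocalRing.closedPoint (C.scheme.presheaf.stalk q.pt)), ?_⟩
    exact (congrArg (fun g : Spec (C.scheme.presheaf.stalk q.pt) ⟶ C.scheme =>
      g (IsLocalRing.closedPoint (C.scheme.presheaf.stalk q.pt))) hl.symm).trans
      Scheme.fromSpecStalk_closedPoint
  rw [Scheme.range_fromSpecStalk] at hq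
  have h2 : p.pt ∈ closure {q.pt} := specializes_iff_mem_closure.1 hq
  rw [(KPoint.isClosed_pt q).closure_eq] at h2
  exact hpq (KPoint.pt_injective h2)

theorem ordSystem [IsAlgClosed k] : OrdSystem k C.ord where
  mul p hf hg := C.ord_mul hf hg p
  add p _ _ h := C.ord_add_ge h p
  const _ p hc := C.ord_algebraMap hc p
  residue _ _ h := C.exists_residue h
  uniformizer := C.exists_ord_eq_one
  finite_support _ hf := C.finite_support_ord hf
  center := C.exists_center
  separated _ _ := C.exists_ord_nonneg_ord_neg

end SmoothCurve

end AbelLLS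

end

noncomputable section

universe u

namespace ValuationSubring.IsPlace

variable {k M : Type u} [Field k] [Field M] [Algebra k M] {V : ValuationSubring M}
  (hV : V.IsPlace k)

/-- The inclusion of the constants in the valuation ring of a place. -/
def constHom : CommRingCat.of k ⟶ CommRingCat.of V :=
  CommRingCat.ofHom ((algebraMap k M).codRestrict V.toSubring hV.algebraMap_mem)

include hV in
theorem bijective_constHom_residue :
    Function.Bijective ((IsLocalRing.residue V).comp hV.constHom.hom) := by
  refine ⟨RingHom.injective _, fun y => ?_⟩
  obtain ⟨x, rfl⟩ := IsLocalRing.residue_surjective y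
  obtain ⟨c, hc⟩ := hV.residue x x.2
  refine ⟨c, ?_⟩
  rw [RingHom.comp_apply, eq_comm, ← sub_eq_zero, ← map_sub, IsLocalRing.residue_eq_zero_iff]
  exact (ValuationSubring.valuation_lt_one_iff V _).2 hc

/-- The residue map of a place. -/
def residueHom : CommRingCat.of V ⟶ CommRingCat.of k :=
  CommRingCat.ofHom ((RingEquiv.ofBijective _ hV.bijective_constHom_residue).symm.toRingHom.comp
    (IsLocalRing.residue V))

theorem constHom_residueHom : hV.constHom ≫ hV.residueHom = 𝟙 _ := by
  ext c
  exact (RingEquiv.ofBijective _ hV.bijective_constHom_residue).symm_apply_apply c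

instance : IsLocalHom hV.residueHom.hom :=
  inferInstanceAs (IsLocalHom (RingHom.comp _ _))

/-- The inclusion of the valuation ring of a place in its field of fractions. -/
def subtypeHom (_ : V.IsPlace k) : CommRingCat.of V ⟶ CommRingCat.of M :=
  CommRingCat.ofHom (algebraMap V M)

theorem constHom_subtypeHom :
    hV.constHom ≫ hV.subtypeHom = CommRingCat.ofHom (algebraMap k M) := rfl

theorem subtypeHom_injective : Function.Injective hV.subtypeHom.hom := Subtype.val_injective

end ValuationSubring.IsPlace

namespace AbelLLS

variable {k M : Type u} [Field k] [Field M] [Algebra k M] {V : ValuationSubring M}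
  (hV : V.IsPlace k) {S T : Scheme.{u}} {f : S ⟶ Spec (.of k)} {g : T ⟶ Spec (.of k)}

/-- The rational point `p` is the limit along a place of the point `ξ` with values in the field
of the place. -/
def IsLimit (ξ : Spec (.of M) ⟶ S) (p : KPoint f) : Prop :=
  ∃ l : Spec (.of V) ⟶ S, Spec.map hV.subtypeHom ≫ l = ξ ∧
    l ≫ f = Spec.map hV.constHom ∧ Spec.map hV.residueHom ≫ l = p.1

theorem exists_isLimit [IsProper f] {ξ : Spec (.of M) ⟶ S}
    (hξ : ξ ≫ f = Spec.map (CommRingCat.ofHom (algebraMap k M))) :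
    ∃ p : KPoint f, IsLimit hV ξ p := by
  let S : ValuativeCommSq f :=
    { R := V
      K := M
      i₁ := ξ
      i₂ := Spec.map hV.constHom
      commSq := ⟨by
        rw [hξ, ← hV.constHom_subtypeHom, Spec.map_comp]
        rfl⟩ }
  have hC : IsProper f := inferInstance
  rw [IsProper.eq_valuativeCriterion] at hC
  obtain ⟨⟨l, hl, hl'⟩⟩ := (ValuativeCriterion.existence hC.1.1.1 S).exists_lift
  refine ⟨⟨Spec.map hV.residueHom ≫ l, ?_⟩, l, hl, hl', rfl⟩
  rw [Category.assoc]
  refine (congrArg (Spec.map hV.residueHom ≫ ·) hl').trans ?_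
  change _ ≫ Spec.map hV.constHom = _
  rw [← Spec.map_comp, hV.constHom_residueHom, Spec.map_id]

variable {hV}

theorem IsLimit.unique [IsSeparated f] {ξ : Spec (.of M) ⟶ S} {p q : KPoint f}
    (hp : IsLimit hV ξ p) (hq : IsLimit hV ξ q) : p = q := by
  obtain ⟨l, h1, h2, h3⟩ := hp
  obtain ⟨l', h1', h2', h3'⟩ := hq
  obtain rfl : l = l' := specMap_ext_of_isSeparated f hV.subtypeHom hV.subtypeHom_injective
    (h1.trans h1'.symm) (h2.trans h2'.symm)
  exact Subtype.ext (h3.symm.trans h3')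

theorem IsLimit.comp {ξ : Spec (.of M) ⟶ S} {p : KPoint f} (hp : IsLimit hV ξ p) (i : S ⟶ T)
    (hi : i ≫ g = f) {q : KPoint g} (hq : q.1 = p.1 ≫ i) : IsLimit hV (ξ ≫ i) q := by
  obtain ⟨l, h1, h2, h3⟩ := hp
  refine ⟨l ≫ i, ?_, ?_, ?_⟩
  · rw [← Category.assoc, h1]
  · rw [Category.assoc, hi, h2]
  · rw [← Category.assoc, h3, hq]

/-- A rational point, as a constant point with values in a larger field. -/
def constPoint (M : Type u) [Field M] [Algebra k M] (p : KPoint f) : Spec (.of M) ⟶ S :=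
  Spec.map (CommRingCat.ofHom (algebraMap k M)) ≫ p.1

theorem constPoint_comp (p : KPoint f) :
    constPoint M p ≫ f = Spec.map (CommRingCat.ofHom (algebraMap k M)) := by
  rw [constPoint, Category.assoc, p.2, Category.comp_id]

theorem isLimit_constPoint (p : KPoint f) : IsLimit hV (constPoint M p) p := by
  refine ⟨Spec.map hV.constHom ≫ p.1, ?_, ?_, ?_⟩
  · rw [← Category.assoc, ← Spec.map_comp, hV.constHom_subtypeHom]
    rfl
  · rw [Category.assoc, p.2, Category.comp_id]
  · rw [← Category.assoc, ← Spec.map_comp, hV.constHom_residueHom, Spec.map_id, Category.id_comp]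

theorem specMap_residueHom_closedPoint :
    Spec.map hV.residueHom (IsLocalRing.closedPoint k) = IsLocalRing.closedPoint V :=
  IsLocalRing.comap_closedPoint hV.residueHom.hom

theorem closedPoint_eq_of_residueHom {p : KPoint f} {l : Spec (.of V) ⟶ S}
    (h : Spec.map hV.residueHom ≫ l = p.1) : l (IsLocalRing.closedPoint V) = p.pt := by
  rw [KPoint.pt, ← h]
  exact (congrArg l specMap_residueHom_closedPoint).symm

namespace SmoothCurve

variable (C : SmoothCurve k)

/-- The point with values in `M` given by an embedding of the function field in `M`. -/
def embeddingPoint (σ : C.FunctionField →ₐ[k] M) : Spec (.of M) ⟶ C.scheme :=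
  Spec.map (CommRingCat.ofHom σ.toRingHom) ≫ C.genericMap

theorem embeddingPoint_str (σ : C.FunctionField →ₐ[k] M) :
    C.embeddingPoint σ ≫ C.str = Spec.map (CommRingCat.ofHom (algebraMap k M)) := by
  rw [embeddingPoint, Category.assoc, genericMap_str, ← Spec.map_comp, ← CommRingCat.ofHom_comp]
  congr 2
  exact σ.comp_algebraMap

theorem mem_of_isLimit {σ : C.FunctionField →ₐ[k] M} {p : C.Point}
    (hp : IsLimit hV (C.embeddingPoint σ) p) {h : C.FunctionField} (hh : 0 ≤ C.ord h p) :
    σ h ∈ V := by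
  obtain ⟨l, h1, h2, h3⟩ := hp
  obtain ⟨y, rfl⟩ := C.exists_of_ord_nonneg hh
  have hl : l (IsLocalRing.closedPoint V) = p.pt := closedPoint_eq_of_residueHom h3
  have key : C.scheme.presheaf.stalkSpecializes (specializes_of_eq hl) ≫
      Scheme.stalkClosedPointTo (R := .of V) l ≫ hV.subtypeHom =
      CommRingCat.ofHom (algebraMap (C.scheme.presheaf.stalk p.pt) C.FunctionField) ≫
        CommRingCat.ofHom σ.toRingHom := by
    apply Spec.map_injective
    rw [← cancel_mono (C.scheme.fromSpecStalk p.pt), Spec.map_comp _ (CommRingCat.ofHom σ.toRingHom),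
      Category.assoc, specMap_algebraMap_fromSpecStalk,
      Spec.map_comp, Spec.map_comp, Category.assoc, Category.assoc,
      Scheme.SpecMap_stalkSpecializes_fromSpecStalk]
    exact (congrArg (Spec.map hV.subtypeHom ≫ ·)
      (Scheme.Spec_stalkClosedPointTo_fromSpecStalk (R := .of V) l)).trans h1
  have h4 := congrArg (fun g => g.hom y) key
  rw [show σ (algebraMap (C.scheme.presheaf.stalk p.pt) C.FunctionField y) = _ from h4.symm]
  exact Subtype.property _

end SmoothCurve

end AbelLLS

end

noncomputable section

namespace AbelLLS

universe u

variable {k M : Type u} [Field k] [Field M] [Algebra k M]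

namespace SmoothCurve

variable (C : SmoothCurve k)

open scoped Classical in
/-- The multiset `A` of points is the divisor of zeros of `f`, as a section of `𝒪(D)`. -/
def IsDivisorOf (D : C.Divisor) (f : C.FunctionField) (A : Multiset C.Point) : Prop :=
  f ≠ 0 ∧ ∀ p, (A.count p : ℤ) = C.ord f p + D p

theorem exists_isDivisorOf [IsAlgClosed k] {D : C.Divisor} {f : C.FunctionField} (hf : f ≠ 0)
    (h : ∀ p, 0 ≤ C.ord f p + D p) : ∃ A, C.IsDivisorOf D f A := by
  classical
  let E : C.Point →₀ ℕ := Finsupp.onFinset ((C.finite_support_ord hf).toFinset ∪ D.support)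
    (fun p => (C.ord f p + D p).toNat) (by
      intro p hp
      by_contra hn
      simp only [Finset.mem_union, Set.Finite.mem_toFinset, Set.mem_ofPred_eq,
        Finsupp.mem_support_iff, not_or, not_not] at hn
      simp [hn.1, hn.2] at hp)
  refine ⟨Finsupp.toMultiset E, hf, fun p => ?_⟩
  rw [Finsupp.count_toMultiset]
  exact Int.toNat_of_nonneg (h p)

variable {C}

theorem IsDivisorOf.nonneg {D : C.Divisor} {f : C.FunctionField} {A : Multiset C.Point}
    (h : C.IsDivisorOf D f A) (p : C.Point) : 0 ≤ C.ord f p + D p := by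
  rw [← h.2 p]
  positivity

theorem IsDivisorOf.unique {D : C.Divisor} {f : C.FunctionField} {A B : Multiset C.Point}
    (hA : C.IsDivisorOf D f A) (hB : C.IsDivisorOf D f B) : A = B := by
  classical
  ext p
  exact_mod_cast (hA.2 p).trans (hB.2 p).symm

theorem ord_smul [IsAlgClosed k] {c : k} (hc : c ≠ 0) {f : C.FunctionField} (hf : f ≠ 0)
    (p : C.Point) : C.ord (c • f) p = C.ord f p := by
  rw [Algebra.smul_def, C.ord_mul ((map_ne_zero _).2 hc) hf, C.ord_algebraMap hc, zero_add]

theorem IsDivisorOf.smul [IsAlgClosed k] {D : C.Divisor} {f : C.FunctionField}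
    {A : Multiset C.Point} (h : C.IsDivisorOf D f A) {c : k} (hc : c ≠ 0) :
    C.IsDivisorOf D (c • f) A :=
  ⟨smul_ne_zero hc h.1, fun p => by rw [ord_smul hc h.1, h.2]⟩

variable [IsAlgClosed k] [IsAlgClosed M] [Algebra (RatFunc k) M] [IsScalarTower k (RatFunc k) M]

variable (M) in
/-- The generic member of the pencil of sections `f₁ + t (f₂ - f₁)` vanishes at certain points with
values in an algebraically closed field containing `k(t)`; the limits of these points along a place
over `t = a` are the zeros of `f₁ + a (f₂ - f₁)`. -/
theorem exists_zeros_pencil {D : C.Divisor} {f₁ f₂ : C.FunctionField} {A₁ A₂ : Multiset C.Point}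
    (h₁ : C.IsDivisorOf D f₁ A₁) (h₂ : C.IsDivisorOf D f₂ A₂) :
    ∃ S : Multiset (Spec (.of M) ⟶ C.scheme),
      (∀ ξ ∈ S, ξ ≫ C.str = Spec.map (CommRingCat.ofHom (algebraMap k M))) ∧
      ∃ E : Finset k, 0 ∉ E ∧ 1 ∉ E ∧ ∀ a ∉ E, ∀ (V : ValuationSubring M) (hV : V.IsPlace k),
        V.valuation (algebraMap (RatFunc k) M RatFunc.X - algebraMap k M a) < 1 →
        ∀ c : (Spec (.of M) ⟶ C.scheme) → C.Point, (∀ ξ ∈ S, IsLimit hV ξ (c ξ)) →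
          C.IsDivisorOf D (f₁ + a • (f₂ - f₁)) (S.map c) := by
  classical
  have hconst (A : Multiset C.Point) {V : ValuationSubring M} {hV : V.IsPlace k}
      {c : (Spec (.of M) ⟶ C.scheme) → C.Point}
      (hc : ∀ ξ ∈ A.map (constPoint M), IsLimit hV ξ (c ξ)) :
      (A.map (constPoint M)).map c = A := by
    rw [Multiset.map_map]
    conv_rhs => rw [← Multiset.map_id A]
    refine Multiset.map_congr rfl fun p hp => ?_
    exact (hc _ (Multiset.mem_map_of_mem _ hp)).unique (isLimit_constPoint p)
  have hcase {h : C.FunctionField} {A : Multiset C.Point} (hA : C.IsDivisorOf D h A) (E : Finset k)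
      (hE0 : 0 ∉ E) (hE1 : 1 ∉ E) (hE : ∀ a ∉ E, ∃ b : k, b ≠ 0 ∧ f₁ + a • (f₂ - f₁) = b • h) :
      ∃ S : Multiset (Spec (.of M) ⟶ C.scheme),
      (∀ ξ ∈ S, ξ ≫ C.str = Spec.map (CommRingCat.ofHom (algebraMap k M))) ∧
      ∃ E : Finset k, 0 ∉ E ∧ 1 ∉ E ∧ ∀ a ∉ E, ∀ (V : ValuationSubring M) (hV : V.IsPlace k),
        V.valuation (algebraMap (RatFunc k) M RatFunc.X - algebraMap k M a) < 1 →
        ∀ c : (Spec (.of M) ⟶ C.scheme) → C.Point, (∀ ξ ∈ S, IsLimit hV ξ (c ξ)) →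
          C.IsDivisorOf D (f₁ + a • (f₂ - f₁)) (S.map c) := by
    refine ⟨A.map (constPoint M), ?_, E, hE0, hE1, fun a ha V hV _ c hc => ?_⟩
    · intro ξ hξ
      obtain ⟨p, -, rfl⟩ := Multiset.mem_map.1 hξ
      exact constPoint_comp p
    · obtain ⟨b, hb, hab⟩ := hE a ha
      rw [hconst A hc, hab]
      exact hA.smul hb
  by_cases hf : f₂ - f₁ = 0
  · exact hcase h₁ ∅ (by simp) (by simp) fun a _ => ⟨1, one_ne_zero, by rw [hf]; simp⟩
  set φ : C.FunctionField := -f₁ / (f₂ - f₁) with hφdef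
  have hφ : φ * (f₂ - f₁) = - f₁ := div_mul_cancel₀ _ hf
  have hφ0 : φ ≠ 0 := by
    intro h
    rw [h, zero_mul, eq_comm, neg_eq_zero] at hφ
    exact h₁.1 hφ
  have hpen (a : k) : f₁ + a • (f₂ - f₁) = -((φ - algebraMap k _ a) * (f₂ - f₁)) := by
    rw [sub_mul, hφ, Algebra.smul_def]
    ring
  have hf' (p : C.Point) : C.ordSystem.GE (f₂ - f₁) p (- D p) :=
    C.ordSystem.ge_sub (Or.inr (by linarith [h₂.nonneg p])) (Or.inr (by linarith [h₁.nonneg p]))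
  by_cases halg : ∃ b : k, φ = algebraMap k _ b
  · obtain ⟨b, hb⟩ := halg
    have hb' (a : k) : f₁ + a • (f₂ - f₁) = (a - b) • (f₂ - f₁) := by
      rw [hpen, hb, Algebra.smul_def, map_sub]
      ring
    obtain ⟨A, hA⟩ := C.exists_isDivisorOf (D := D) hf fun p => by
      have := (C.ordSystem.ge_iff hf).1 (hf' p)
      linarith
    refine hcase hA {b} ?_ ?_ fun a ha => ⟨a - b, ?_, hb' a⟩
    · rw [Finset.mem_singleton]
      rintro rfl
      exact h₁.1 (by simpa using hb' 0)
    · rw [Finset.mem_singleton]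
      rintro rfl
      exact h₂.1 (by simpa using hb' 1)
    · rw [Finset.mem_singleton] at ha
      exact sub_ne_zero.2 ha
  · have htr : Transcendental k φ := fun h => halg
      (IsAlgClosed.exists_algebraMap_eq_of_isIntegral h.isIntegral)
    let _ : Algebra (RatFunc k) C.FunctionField := (RatFunc.toTranscendental htr).toRingHom.toAlgebra
    have : IsScalarTower k (RatFunc k) C.FunctionField :=
      IsScalarTower.of_algebraMap_eq' (RatFunc.toTranscendental htr).comp_algebraMap.symm
    have hX : algebraMap (RatFunc k) C.FunctionField RatFunc.X = φ :=
      RatFunc.toTranscendental_X htr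
    have hfin := (C.ordSystem.finrank_le_degree_zeros (0 : k)).1
    obtain ⟨S, hS, hchar⟩ := exists_multiset_embeddings (RatFunc k) C.FunctionField M
    let B : C.Point →₀ ℕ := Finsupp.onFinset ((C.finite_support_ord hf).toFinset ∪ D.support ∪
        (C.ordSystem.poles φ hφ0).support)
      (fun p => (C.ord (f₂ - f₁) p + D p - C.ordSystem.poles φ hφ0 p).toNat) (by
        intro p hp
        by_contra hn
        simp only [Finset.mem_union, Set.Finite.mem_toFinset, Set.mem_ofPred_eq,
          Finsupp.mem_support_iff, not_or, not_not] at hn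
        simp [hn.1.1, hn.1.2, hn.2] at hp)
    have hB (p : C.Point) : (B p : ℤ) = C.ord (f₂ - f₁) p + D p - (- C.ord φ p).toNat := by
      refine Int.toNat_of_nonneg ?_
      rw [C.ordSystem.poles_apply]
      have h3 := (C.ordSystem.ge_iff hf).1 (hf' p)
      have h4 := h₁.nonneg p
      have h5 := C.ord_mul hφ0 hf p
      rw [hφ, C.ordSystem.neg] at h5
      omega
    refine ⟨(S.map fun σ => C.embeddingPoint (σ.restrictScalars k)) +
      (Finsupp.toMultiset B).map (constPoint M), ?_, ∅, by simp, by simp,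
      fun a _ V hV ha c hc => ?_⟩
    · intro ξ hξ
      rw [Multiset.mem_add, Multiset.mem_map, Multiset.mem_map] at hξ
      obtain ⟨σ, -, rfl⟩ | ⟨p, -, rfl⟩ := hξ
      · exact C.embeddingPoint_str _
      · exact constPoint_comp p
    · have hφa := OrdSystem.sub_algebraMap_ne_zero (K := C.FunctionField) a
      rw [hX] at hφa
      choose c' hc' using fun σ : C.FunctionField →ₐ[RatFunc k] M =>
        exists_isLimit hV (C.embeddingPoint_str (σ.restrictScalars k))
      have key := C.ordSystem.map_center_eq_zeros hV.algebraMap_mem ha hS hchar (c := c')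
        fun σ h _ h0 => C.mem_of_isLimit (hc' σ) h0
      have h1 : (S.map fun σ => C.embeddingPoint (σ.restrictScalars k)).map c = S.map c' := by
        rw [Multiset.map_map]
        exact Multiset.map_congr rfl fun σ hσ =>
          (hc _ (Multiset.mem_add.2 (Or.inl (Multiset.mem_map_of_mem _ hσ)))).unique (hc' σ)
      rw [Multiset.map_add, h1, key, hconst _ fun ξ hξ => hc ξ (Multiset.mem_add.2 (Or.inr hξ)),
        hpen]
      refine ⟨neg_ne_zero.2 (mul_ne_zero hφa hf), fun p => ?_⟩
      rw [Multiset.count_add, Finsupp.count_toMultiset, Finsupp.count_toMultiset,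
        C.ordSystem.zeros_apply, C.ordSystem.neg, C.ord_mul hφa hf, Nat.cast_add, hB, hX]
      have hpole : C.ord φ p < 0 → C.ord (φ - algebraMap k _ a) p = C.ord φ p := by
        intro hneg
        rw [sub_eq_add_neg]
        exact (C.ordSystem.add_eq_of_lt hφ0 (C.ordSystem.ge_neg
          (C.ordSystem.ge_mono (C.ordSystem.ge_const a p) (by omega)))).2
      have hpole' : 0 ≤ C.ord φ p → 0 ≤ C.ord (φ - algebraMap k _ a) p := fun h =>
        (C.ordSystem.ge_iff hφa).1 (C.ordSystem.ge_sub (Or.inr h) (C.ordSystem.ge_const a p))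
      omega

end SmoothCurve

end AbelLLS

end

noncomputable section

open Limits

namespace AbelLLS

universe u

theorem locallyOfFiniteType_widePullback_base {S T : Scheme.{u}} (f : S ⟶ T)
    [LocallyOfFiniteType f] (d : ℕ) :
    LocallyOfFiniteType (WidePullback.base (fun _ : Fin d => f)) := by
  induction d with
  | zero =>
    have : IsIso (WidePullback.base (fun _ : Fin 0 => f)) := by
      refine ⟨WidePullback.lift (𝟙 T) (fun i => i.elim0) (fun i => i.elim0), ?_, ?_⟩
      · apply WidePullback.hom_ext
        · exact fun i => i.elim0
        · rw [Category.assoc, WidePullback.lift_base, Category.comp_id, Category.id_comp]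
      · rw [WidePullback.lift_base]
    infer_instance
  | succ d ih =>
    let b := WidePullback.base (fun _ : Fin d => f)
    let e : widePullback T (fun _ : Fin (d + 1) => S) (fun _ => f) ⟶ pullback b f :=
      pullback.lift (WidePullback.lift (WidePullback.base _)
        (fun i => WidePullback.π (fun _ : Fin (d + 1) => f) i.castSucc)
        (fun i => WidePullback.π_arrow (fun _ : Fin (d + 1) => f) i.castSucc))
        (WidePullback.π (fun _ : Fin (d + 1) => f) (Fin.last d)) (by
          rw [WidePullback.lift_base, WidePullback.π_arrow (fun _ : Fin (d + 1) => f)])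
    let e' : pullback b f ⟶ widePullback T (fun _ : Fin (d + 1) => S) (fun _ => f) :=
      WidePullback.lift (pullback.fst b f ≫ b)
        (fun i => Fin.lastCases (motive := fun _ => (pullback b f ⟶ S)) (pullback.snd b f)
          (fun i => pullback.fst b f ≫ WidePullback.π (fun _ : Fin d => f) i) i) (by
        intro i
        cases i using Fin.lastCases with
        | last => rw [Fin.lastCases_last, pullback.condition]
        | cast i =>
          rw [Fin.lastCases_castSucc, Category.assoc, WidePullback.π_arrow (fun _ : Fin d => f)])
    have he : IsIso e := by
      refine ⟨e', ?_, ?_⟩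
      · apply WidePullback.hom_ext
        · intro i
          rw [Category.assoc, WidePullback.lift_π, Category.id_comp]
          cases i using Fin.lastCases with
          | last => rw [Fin.lastCases_last, pullback.lift_snd]
          | cast i => rw [Fin.lastCases_castSucc, pullback.lift_fst_assoc, WidePullback.lift_π]
        · rw [Category.assoc, WidePullback.lift_base, Category.id_comp, pullback.lift_fst_assoc,
            WidePullback.lift_base]
      · apply pullback.hom_ext
        · rw [Category.assoc, pullback.lift_fst, Category.id_comp]
          apply WidePullback.hom_ext
          · intro i
            rw [Category.assoc, WidePullback.lift_π, WidePullback.lift_π, Fin.lastCases_castSucc]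
          · rw [Category.assoc, WidePullback.lift_base, WidePullback.lift_base]
        · rw [Category.assoc, pullback.lift_snd, WidePullback.lift_π, Fin.lastCases_last,
            Category.id_comp]
    have : WidePullback.base (fun _ : Fin (d + 1) => f) = e ≫ pullback.fst b f ≫ b := by
      rw [pullback.lift_fst_assoc, WidePullback.lift_base]
    rw [this]
    infer_instance

theorem _root_.Subalgebra.FG.exists_algHom {k M : Type*} [Field k] [IsAlgClosed k] [Field M] [Algebra k M]
    {A : Subalgebra k M} (hA : A.FG) : Nonempty (A →ₐ[k] k) := by
  have : Algebra.FiniteType k A := (Subalgebra.fg_iff_finiteType _).1 hA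
  obtain ⟨m, hm⟩ := Ideal.exists_maximal A
  let _ := Ideal.Quotient.field m
  have : Module.Finite k (A ⧸ m) := finite_of_finite_type_of_isJacobsonRing k (A ⧸ m)
  have hb : Function.Bijective (Algebra.ofId k (A ⧸ m)) :=
    IsAlgClosed.algebraMap_bijective_of_isIntegral (k := k) (K := A ⧸ m)
  exact ⟨(AlgEquiv.ofBijective _ hb).symm.toAlgHom.comp (Ideal.Quotient.mkₐ k m)⟩

variable {k M : Type u} [Field k] [Field M] [Algebra k M]

/-- A finitely generated algebra of functions in an algebraic extension of `k(t)` is contained in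
the valuation ring of a place over a general point. -/
theorem _root_.AlgHom.exists_isPlace_range_le [IsAlgClosed k] [Algebra (RatFunc k) M]
    [IsScalarTower k (RatFunc k) M] [Algebra.IsAlgebraic (RatFunc k) M] {R : Type*} [CommRing R]
    [Algebra k R] [Algebra.FiniteType k R] (φ : R →ₐ[k] M) (E : Finset k) :
    ∃ a ∉ E, ∃ V : ValuationSubring M, V.IsPlace k ∧
      V.valuation (algebraMap (RatFunc k) M RatFunc.X - algebraMap k M a) < 1 ∧ ∀ x, φ x ∈ V := by
  classical
  set t := algebraMap (RatFunc k) M RatFunc.X with ht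
  have ht0 (b : k) : t - algebraMap k M b ≠ 0 := OrdSystem.sub_algebraMap_ne_zero b
  let s : Finset M := insert t (E.image fun b => (t - algebraMap k M b)⁻¹)
  let A : Subalgebra k M := φ.range ⊔ Algebra.adjoin k s
  have hA : A.FG := by
    refine Subalgebra.FG.sup ?_ ⟨s, rfl⟩
    rw [← Algebra.map_top]
    exact (Algebra.FiniteType.out).map φ
  have hsA : ∀ x ∈ s, x ∈ A := fun x hx =>
    (le_sup_right : _ ≤ A) (Algebra.subset_adjoin hx)
  have htA : t ∈ A := hsA t (Finset.mem_insert_self _ _)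
  obtain ⟨ψ⟩ := hA.exists_algHom
  obtain ⟨V, hAV, hV⟩ := A.exists_valuationSubring ψ
  have hVt := hV ⟨t, htA⟩
  have hVk (c : k) : algebraMap k M c ∈ V := hAV _ (A.algebraMap_mem c)
  refine ⟨ψ ⟨t, htA⟩, fun hE => ?_, V, V.isPlace_of_valuation_lt_one hVk hVt, hVt,
    fun x => hAV _ ((le_sup_left : _ ≤ A) ⟨x, rfl⟩)⟩
  have hmem := hsA _ (Finset.mem_insert_of_mem (Finset.mem_image_of_mem
    (fun b => (t - algebraMap k M b)⁻¹) hE))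
  have h1 := congrArg ψ (show (⟨t, htA⟩ - algebraMap k A (ψ ⟨t, htA⟩)) * (⟨_, hmem⟩ : A) = 1 from
    Subtype.ext (mul_inv_cancel₀ (ht0 _)))
  rw [map_mul, map_sub, AlgHom.commutes, map_one] at h1
  simp at h1

namespace NodalCurve

variable (X : NodalCurve k) {d : ℕ}

/-- The structure morphism of the `d`-fold product. -/
def powerStr (d : ℕ) : X.power d ⟶ Spec (.of k) := WidePullback.base (fun _ : Fin d => X.str)

instance : LocallyOfFiniteType (X.powerStr d) := locallyOfFiniteType_widePullback_base X.str d

/-- The projections from the `d`-fold product. -/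
def powerProj (i : Fin d) : X.power d ⟶ X.scheme := WidePullback.π (fun _ : Fin d => X.str) i

theorem powerProj_str (i : Fin d) : X.powerProj i ≫ X.str = X.powerStr d :=
  WidePullback.π_arrow (fun _ : Fin d => X.str) i

variable {X} in
theorem power_hom_ext {T : Scheme.{u}} {f g : T ⟶ X.power d}
    (h : ∀ i, f ≫ X.powerProj i = g ≫ X.powerProj i) (h' : f ≫ X.powerStr d = g ≫ X.powerStr d) :
    f = g := WidePullback.hom_ext _ _ _ h h'

/-- A morphism to the `d`-fold product, in terms of its coordinates. -/
def powerLift {T : Scheme.{u}} (s : T ⟶ Spec (.of k)) (ξ : Fin d → (T ⟶ X.scheme))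
    (hξ : ∀ i, ξ i ≫ X.str = s) : T ⟶ X.power d := WidePullback.lift s ξ hξ

theorem powerLift_proj {T : Scheme.{u}} (s : T ⟶ Spec (.of k)) (ξ : Fin d → (T ⟶ X.scheme))
    (hξ : ∀ i, ξ i ≫ X.str = s) (i : Fin d) : X.powerLift s ξ hξ ≫ X.powerProj i = ξ i :=
  WidePullback.lift_π _ _ _ _ _

theorem powerLift_str {T : Scheme.{u}} (s : T ⟶ Spec (.of k)) (ξ : Fin d → (T ⟶ X.scheme))
    (hξ : ∀ i, ξ i ≫ X.str = s) : X.powerLift s ξ hξ ≫ X.powerStr d = s :=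
  WidePullback.lift_base _ _ _ _

theorem tuplePt_eq (x : Fin d → X.Point) : X.tuplePt d x =
    X.powerLift (𝟙 _) (fun i => (x i).1) (fun i => (x i).2) (IsLocalRing.closedPoint k) := rfl

/-- If a tuple of rational points is the limit of a tuple of points with values in `M`, then
every neighbourhood of the former contains the latter. -/
theorem powerLift_mem_of_isLimit {V : ValuationSubring M} {hV : V.IsPlace k}
    {ξ : Fin d → (Spec (.of M) ⟶ X.scheme)}
    (hξ : ∀ i, ξ i ≫ X.str = Spec.map (CommRingCat.ofHom (algebraMap k M))) {x : Fin d → X.Point}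
    (hx : ∀ i, IsLimit hV (ξ i) (x i)) {U : Set (X.power d)} (hU : IsOpen U)
    (hxU : X.tuplePt d x ∈ U) : X.powerLift _ ξ hξ (IsLocalRing.closedPoint M) ∈ U := by
  choose l h1 h2 h3 using hx
  let L := X.powerLift _ l h2
  have hL : Spec.map hV.subtypeHom ≫ L = X.powerLift _ ξ hξ := by
    apply power_hom_ext
    · intro i
      rw [Category.assoc, powerLift_proj, powerLift_proj, h1]
    · rw [Category.assoc, powerLift_str, powerLift_str, ← Spec.map_comp]
      rfl
  have hL' : Spec.map hV.residueHom ≫ L =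
      X.powerLift (𝟙 _) (fun i => (x i).1) (fun i => (x i).2) := by
    apply power_hom_ext
    · intro i
      rw [Category.assoc, powerLift_proj, powerLift_proj, h3]
    · rw [Category.assoc, powerLift_str, powerLift_str, ← Spec.map_comp,
        hV.constHom_residueHom, Spec.map_id]
  rw [tuplePt_eq, ← hL'] at hxU
  rw [← hL]
  have h4 : L (IsLocalRing.closedPoint V) ∈ U := by
    rw [← specMap_residueHom_closedPoint (hV := hV)]
    exact hxU
  exact ((IsLocalRing.specializes_closedPoint _).map L.continuous).mem_open hU h4

/-- Every neighbourhood of a tuple of points with values in an algebraic extension of `k(t)`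
contains the limit of the tuple along some place over a general point. -/
theorem exists_isLimit_mem [IsAlgClosed k] [Algebra (RatFunc k) M]
    [IsScalarTower k (RatFunc k) M] [Algebra.IsAlgebraic (RatFunc k) M]
    {ξ : Fin d → (Spec (.of M) ⟶ X.scheme)}
    (hξ : ∀ i, ξ i ≫ X.str = Spec.map (CommRingCat.ofHom (algebraMap k M)))
    {U : Set (X.power d)} (hU : IsOpen U)
    (hξU : X.powerLift _ ξ hξ (IsLocalRing.closedPoint M) ∈ U) (E : Finset k) :
    ∃ a ∉ E, ∃ (V : ValuationSubring M) (hV : V.IsPlace k),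
      V.valuation (algebraMap (RatFunc k) M RatFunc.X - algebraMap k M a) < 1 ∧
      ∃ x : Fin d → X.Point, (∀ i, IsLimit hV (ξ i) (x i)) ∧ X.tuplePt d x ∈ U := by
  obtain ⟨_, ⟨W, hW, rfl⟩, hξW, hWU⟩ :=
    (X.power d).isBasis_affineOpens.exists_subset_of_mem_open hξU hU
  set g := X.powerLift _ ξ hξ with hg
  have hrange : Set.range g ⊆ Set.range hW.fromSpec := by
    rw [hW.range_fromSpec]
    rintro _ ⟨y, rfl⟩
    have : Subsingleton (Spec (.of M)) := inferInstanceAs (Subsingleton (PrimeSpectrum M))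
    rw [Subsingleton.elim y (IsLocalRing.closedPoint M)]
    exact hξW
  have := hW.isOpenImmersion_fromSpec
  let g' := IsOpenImmersion.lift hW.fromSpec g hrange
  have hg' : g' ≫ hW.fromSpec = g := IsOpenImmersion.lift_fac _ _ _
  let φ := Spec.preimage g'
  let s := Spec.preimage (hW.fromSpec ≫ X.powerStr d)
  have hφ : Spec.map φ = g' := Spec.map_preimage _
  have hs : Spec.map s = hW.fromSpec ≫ X.powerStr d := Spec.map_preimage _
  have hsφ : s ≫ φ = CommRingCat.ofHom (algebraMap k M) := by
    apply Spec.map_injective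
    rw [Spec.map_comp, hφ, hs, ← Category.assoc, hg', powerLift_str]
  let _ : Algebra k Γ(X.power d, W) := s.hom.toAlgebra
  have hft : Algebra.FiniteType k Γ(X.power d, W) := by
    have : LocallyOfFiniteType (Spec.map s) := by
      rw [hs]
      infer_instance
    rw [HasRingHomProperty.Spec_iff (P := @LocallyOfFiniteType)] at this
    exact this
  let φ' : Γ(X.power d, W) →ₐ[k] M :=
    { φ.hom with commutes' := fun c => congrArg (fun f => f.hom c) hsφ }
  obtain ⟨a, ha, V, hV, hVa, hφV⟩ := φ'.exists_isPlace_range_le E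
  refine ⟨a, ha, V, hV, hVa, ?_⟩
  let l : Γ(X.power d, W) ⟶ CommRingCat.of V :=
    CommRingCat.ofHom (φ.hom.codRestrict V.toSubring hφV)
  have hl : l ≫ hV.subtypeHom = φ := rfl
  have hsl : s ≫ l = hV.constHom := by
    ext c
    exact congrArg (fun f => f.hom c) hsφ
  let L := Spec.map l ≫ hW.fromSpec
  have hL : L ≫ X.powerStr d = Spec.map hV.constHom := by
    rw [Category.assoc, ← hs, ← Spec.map_comp, hsl]
  have hLφ : Spec.map hV.subtypeHom ≫ L = g := by
    rw [← Category.assoc, ← Spec.map_comp, hl, hφ, hg']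
  have hx (i : Fin d) : (Spec.map hV.residueHom ≫ L ≫ X.powerProj i) ≫ X.str = 𝟙 _ := by
    rw [Category.assoc, Category.assoc, powerProj_str, hL, ← Spec.map_comp,
      hV.constHom_residueHom, Spec.map_id]
  refine ⟨fun i => ⟨Spec.map hV.residueHom ≫ L ≫ X.powerProj i, hx i⟩,
    fun i => ⟨L ≫ X.powerProj i, ?_, ?_, rfl⟩, hWU ?_⟩
  · rw [← Category.assoc, hLφ, powerLift_proj]
  · rw [Category.assoc, powerProj_str, hL]
  · rw [tuplePt_eq]
    have : X.powerLift (𝟙 _) (fun i => Spec.map hV.residueHom ≫ L ≫ X.powerProj i) hx =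
        (Spec.map hV.residueHom ≫ Spec.map l) ≫ hW.fromSpec := by
      apply power_hom_ext
      · intro i
        rw [powerLift_proj, Category.assoc, Category.assoc, Category.assoc]
      · rw [powerLift_str, Category.assoc, Category.assoc, ← hs, ← Spec.map_comp, hsl,
          ← Spec.map_comp, hV.constHom_residueHom, Spec.map_id]
    have hmem : ((Spec.map hV.residueHom ≫ Spec.map l) ≫ hW.fromSpec)
        (IsLocalRing.closedPoint k) ∈ (W : Set (X.power d)) := by
      rw [← hW.range_fromSpec]
      exact ⟨_, rfl⟩
    rw [← this] at hmem
    exact hmem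

end NodalCurve

end AbelLLS

end

noncomputable section

open Limits

namespace AbelLLS

universe u

theorem _root_.Multiset.exists_map_univ_eq {α : Type*} (m : Multiset α) {d : ℕ}
    (hm : m.card = d) : ∃ x : Fin d → α, Finset.univ.val.map x = m := by
  subst hm
  induction m using Quotient.inductionOn with
  | h l => exact ⟨l.get, congrArg _ (List.map_get_finRange l)⟩

theorem exists_limit_function {k M : Type u} [Field k] [Field M] [Algebra k M] {S : Scheme.{u}}
    {f : S ⟶ Spec (.of k)} [IsProper f] (p₀ : KPoint f) {A : Set (Spec (.of M) ⟶ S)}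
    (hA : ∀ ξ ∈ A, ξ ≫ f = Spec.map (CommRingCat.ofHom (algebraMap k M)))
    {V : ValuationSubring M} (hV : V.IsPlace k) :
    ∃ c : (Spec (.of M) ⟶ S) → KPoint f, ∀ ξ ∈ A, IsLimit hV ξ (c ξ) := by
  have (ξ : Spec (.of M) ⟶ S) : ∃ p : KPoint f, ξ ∈ A → IsLimit hV ξ p := by
    by_cases hξ : ξ ∈ A
    · obtain ⟨p, hp⟩ := exists_isLimit hV (hA ξ hξ)
      exact ⟨p, fun _ => hp⟩
    · exact ⟨p₀, fun h => absurd h hξ⟩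
  choose c hc using this
  exact ⟨c, hc⟩

namespace NodalCurve

variable {k : Type u} [Field k] (X : NodalCurve k) {d : ℕ}

variable {X} in
theorem isOpen_symProd_iff {U : Set (X.SymProd d)} :
    IsOpen U ↔ ∃ U' : Set (X.power d), IsOpen U' ∧ X.tuplePt d ⁻¹' U' = X.cycle d ⁻¹' U :=
  (@isOpen_coinduced _ _ (X.powerTopology d) U (X.cycle d)).trans isOpen_induced_iff

/-- The cycles on `X` that are sums of the divisor of zeros of a nonzero section of `𝒪(D)` on `Y`
contained in `V` and of that of a nonzero section of `𝒪(E)` on `Z` contained in `W`. -/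
def zeroCycles (d : ℕ) (D : X.Y.Divisor) (E : X.Z.Divisor) (V : Submodule k X.Y.FunctionField)
    (W : Submodule k X.Z.FunctionField) : Set (X.SymProd d) :=
  {s | ∃ f ∈ V, ∃ A, X.Y.IsDivisorOf D f A ∧ ∃ g ∈ W, ∃ B, X.Z.IsDivisorOf E g B ∧
    (s : Sym X.Point d).1 = A.map X.pointY + B.map X.pointZ}

theorem isPreirreducible_zeroCycles [IsAlgClosed k] (D : X.Y.Divisor) (E : X.Z.Divisor)
    (V : Submodule k X.Y.FunctionField) (W : Submodule k X.Z.FunctionField) :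
    IsPreirreducible (X.zeroCycles d D E V W) := by
  classical
  rintro U₁ U₂ hU₁ hU₂ ⟨s₁, ⟨f₁, hf₁, A₁, hA₁, g₁, hg₁, B₁, hB₁, hs₁⟩, hsU₁⟩
    ⟨s₂, ⟨f₂, hf₂, A₂, hA₂, g₂, hg₂, B₂, hB₂, hs₂⟩, hsU₂⟩
  let M := AlgebraicClosure (RatFunc k)
  obtain ⟨SY, hSY, EY, hEY0, hEY1, hY⟩ := SmoothCurve.exists_zeros_pencil M hA₁ hA₂
  obtain ⟨SZ, hSZ, EZ, hEZ0, hEZ1, hZ⟩ := SmoothCurve.exists_zeros_pencil M hB₁ hB₂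
  let S : Multiset (Spec (.of M) ⟶ X.scheme) := SY.map (· ≫ X.inclY) + SZ.map (· ≫ X.inclZ)
  have hS : ∀ ξ ∈ S, ξ ≫ X.str = Spec.map (CommRingCat.ofHom (algebraMap k M)) := by
    intro ξ hξ
    rw [Multiset.mem_add, Multiset.mem_map, Multiset.mem_map] at hξ
    obtain ⟨ξ, h, rfl⟩ | ⟨ξ, h, rfl⟩ := hξ
    · rw [Category.assoc, X.inclY_str, hSY ξ h]
    · rw [Category.assoc, X.inclZ_str, hSZ ξ h]
  -- the zeros of the members of the pencil are the limits of the generic zeros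
  have key {a : k} (haY : a ∉ EY) (haZ : a ∉ EZ) {V' : ValuationSubring M} (hV' : V'.IsPlace k)
      (hVa : V'.valuation (algebraMap (RatFunc k) M RatFunc.X - algebraMap k M a) < 1)
      {c : (Spec (.of M) ⟶ X.scheme) → X.Point} (hc : ∀ ξ ∈ S, IsLimit hV' ξ (c ξ)) :
      ∃ A, X.Y.IsDivisorOf D (f₁ + a • (f₂ - f₁)) A ∧ ∃ B,
        X.Z.IsDivisorOf E (g₁ + a • (g₂ - g₁)) B ∧
        S.map c = A.map X.pointY + B.map X.pointZ := by
    obtain ⟨cY, hcY⟩ := exists_limit_function X.nodeY (A := {ξ | ξ ∈ SY}) hSY hV'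
    obtain ⟨cZ, hcZ⟩ := exists_limit_function X.nodeZ (A := {ξ | ξ ∈ SZ}) hSZ hV'
    refine ⟨_, hY a haY V' hV' hVa cY hcY, _, hZ a haZ V' hV' hVa cZ hcZ, ?_⟩
    rw [Multiset.map_add, Multiset.map_map, Multiset.map_map, Multiset.map_map, Multiset.map_map]
    congr 1
    · refine Multiset.map_congr rfl fun ξ hξ => ?_
      exact (hc _ (Multiset.mem_add.2 (Or.inl (Multiset.mem_map_of_mem _ hξ)))).unique
        ((hcY ξ hξ).comp X.inclY X.inclY_str rfl)
    · refine Multiset.map_congr rfl fun ξ hξ => ?_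
      exact (hc _ (Multiset.mem_add.2 (Or.inr (Multiset.mem_map_of_mem _ hξ)))).unique
        ((hcZ ξ hξ).comp X.inclZ X.inclZ_str rfl)
  have hlim {V : ValuationSubring M} (hV : V.IsPlace k) :
      ∃ c : (Spec (.of M) ⟶ X.scheme) → X.Point, ∀ ξ ∈ S, IsLimit hV ξ (c ξ) :=
    exists_limit_function (X.pointY X.nodeY) (A := {ξ | ξ ∈ S}) hS hV
  -- the two given members
  obtain ⟨V₁, hV₁k, hV₁⟩ := ValuationSubring.exists_valuation_X_sub_lt_one (M := M) (0 : k)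
  obtain ⟨V₂, hV₂k, hV₂⟩ := ValuationSubring.exists_valuation_X_sub_lt_one (M := M) (1 : k)
  have hP₁ : V₁.IsPlace k := ValuationSubring.isPlace_of_valuation_lt_one hV₁k hV₁
  have hP₂ : V₂.IsPlace k := ValuationSubring.isPlace_of_valuation_lt_one hV₂k hV₂
  obtain ⟨c₁, hc₁⟩ := hlim hP₁
  obtain ⟨c₂, hc₂⟩ := hlim hP₂
  have hSs₁ : S.map c₁ = (s₁ : Sym X.Point d).1 := by
    obtain ⟨A, hA, B, hB, h⟩ := key hEY0 hEZ0 hP₁ hV₁ hc₁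
    rw [zero_smul, add_zero] at hA hB
    rw [h, hs₁, hA.unique hA₁, hB.unique hB₁]
  have hSs₂ : S.map c₂ = (s₂ : Sym X.Point d).1 := by
    obtain ⟨A, hA, B, hB, h⟩ := key hEY1 hEZ1 hP₂ hV₂ hc₂
    rw [one_smul, add_sub_cancel] at hA hB
    rw [h, hs₂, hA.unique hA₂, hB.unique hB₂]
  have hcard : S.card = d := by
    rw [← Multiset.card_map c₁ S, hSs₁]
    exact (s₁ : Sym X.Point d).2
  obtain ⟨ξ, hξS⟩ : ∃ ξ : Fin d → (Spec (.of M) ⟶ X.scheme), Finset.univ.val.map ξ = S :=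
    S.exists_map_univ_eq hcard
  have hmem (i) : ξ i ∈ S := by
    rw [← hξS]
    exact Multiset.mem_map_of_mem _ (Finset.mem_univ i)
  have hcyc {c : (Spec (.of M) ⟶ X.scheme) → X.Point} {s : X.SymProd d}
      (h : S.map c = (s : Sym X.Point d).1) : X.cycle d (fun i => c (ξ i)) = s := by
    apply Subtype.ext
    rw [← h, ← hξS, Multiset.map_map]
    rfl
  have hξ (i) := hS _ (hmem i)
  -- the generic member is in both open sets
  obtain ⟨U₁', hU₁', hpre₁⟩ := isOpen_symProd_iff.1 hU₁
  obtain ⟨U₂', hU₂', hpre₂⟩ := isOpen_symProd_iff.1 hU₂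
  have hin₁ : X.powerLift _ ξ hξ (IsLocalRing.closedPoint M) ∈ U₁' := by
    refine X.powerLift_mem_of_isLimit hξ (fun i => hc₁ _ (hmem i)) hU₁' ?_
    change (fun i => c₁ (ξ i)) ∈ X.tuplePt d ⁻¹' U₁'
    rw [hpre₁, Set.mem_preimage, hcyc hSs₁]
    exact hsU₁
  have hin₂ : X.powerLift _ ξ hξ (IsLocalRing.closedPoint M) ∈ U₂' := by
    refine X.powerLift_mem_of_isLimit hξ (fun i => hc₂ _ (hmem i)) hU₂' ?_
    change (fun i => c₂ (ξ i)) ∈ X.tuplePt d ⁻¹' U₂'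
    rw [hpre₂, Set.mem_preimage, hcyc hSs₂]
    exact hsU₂
  obtain ⟨a, ha, V', hV', hV'a, x, hx, hxU⟩ := X.exists_isLimit_mem hξ (hU₁'.inter hU₂')
    ⟨hin₁, hin₂⟩ (EY ∪ EZ)
  rw [Finset.notMem_union] at ha
  obtain ⟨c, hc⟩ := hlim hV'
  have hcx : (fun i => c (ξ i)) = x := funext fun i => (hc _ (hmem i)).unique (hx i)
  obtain ⟨A, hA, B, hB, h⟩ := key ha.1 ha.2 hV' hV'a hc
  refine ⟨X.cycle d x, ⟨_, V.add_mem hf₁ (V.smul_mem a (V.sub_mem hf₂ hf₁)), A, hA, _,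
    W.add_mem hg₁ (W.smul_mem a (W.sub_mem hg₂ hg₁)), B, hB, ?_⟩, ?_, ?_⟩
  · rw [← h, ← hξS, Multiset.map_map, ← hcx]
    rfl
  · change x ∈ X.cycle d ⁻¹' U₁
    rw [← hpre₁]
    exact hxU.1
  · change x ∈ X.cycle d ⁻¹' U₂
    rw [← hpre₂]
    exact hxU.2

end NodalCurve

end AbelLLS

end

noncomputable section

open Limits

theorem OrdSystem.GE.ord_eq {k K P : Type*} [Field k] [Field K] [Algebra k K] {ord : K → P → ℤ}
    {H : OrdSystem k ord} {f : K} {p : P} {n : ℤ} (h : H.GE f p n) (h' : ¬ H.GE f p (n + 1)) :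
    f ≠ 0 ∧ ord f p = n := by
  have hf : f ≠ 0 := by
    rintro rfl
    exact h' (H.ge_zero p _)
  rw [H.ge_iff hf] at h h'
  exact ⟨hf, by omega⟩

/-- The space of functions of order at least `n` at `p`. -/
def OrdSystem.geSpace {k K P : Type*} [Field k] [Field K] [Algebra k K] {ord : K → P → ℤ}
    (H : OrdSystem k ord) (p : P) (n : ℤ) : Submodule k K where
  carrier := {f | H.GE f p n}
  add_mem' hf hg := H.ge_add hf hg
  zero_mem' := H.ge_zero p _
  smul_mem' c _ hf := H.ge_smul c hf

theorem OrdSystem.mem_geSpace {k K P : Type*} [Field k] [Field K] [Algebra k K] {ord : K → P → ℤ}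
    (H : OrdSystem k ord) {p : P} {n : ℤ} {f : K} : f ∈ H.geSpace p n ↔ H.GE f p n := Iff.rfl

theorem OrdSystem.finrank_le_succ_inf_geSpace {k K P : Type*} [Field k] [Field K] [Algebra k K]
    {ord : K → P → ℤ} (H : OrdSystem k ord) {p : P} {n : ℤ} {V : Submodule k K}
    [FiniteDimensional k V] (hV : V ≤ H.geSpace p n) :
    Module.finrank k V ≤ Module.finrank k (V ⊓ H.geSpace p (n + 1) : Submodule k K) + 1 := by
  have : FiniteDimensional k (V ⊓ H.geSpace p (n + 1) : Submodule k K) :=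
    Submodule.finiteDimensional_of_le inf_le_left
  refine (Submodule.finrank_le_succ_of_forall_exists inf_le_left fun x hx hxN y hy => ?_).2
  obtain ⟨hx0, hxn⟩ := (H.mem_geSpace.1 (hV hx)).ord_eq fun h => hxN ⟨hx, h⟩
  obtain ⟨c, hc⟩ := H.exists_ge_succ hx0 hxn (hV hy)
  exact ⟨c, V.sub_mem hy (V.smul_mem c hx), hc⟩

namespace AbelLLS

universe u

variable {k : Type u} [Field k]

namespace SmoothCurve

variable {C : SmoothCurve k}

theorem deg_add (D E : C.Divisor) : C.deg (D + E) = C.deg D + C.deg E :=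
  Finsupp.sum_add_index' (fun _ => rfl) fun _ _ _ => rfl

theorem deg_sub (D E : C.Divisor) : C.deg (D - E) = C.deg D - C.deg E := by
  have := C.deg_add (D - E) E
  rw [sub_add_cancel] at this
  omega

theorem deg_single (p : C.Point) (n : ℤ) : C.deg (Finsupp.single p n) = n :=
  Finsupp.sum_single_index rfl

open scoped Classical in
/-- The divisor corresponding to a multiset of points. -/
def divisorOf (A : Multiset C.Point) : C.Divisor :=
  (Multiset.toFinsupp A).mapRange (fun n : ℕ => (n : ℤ)) Nat.cast_zero

open scoped Classical in
theorem divisorOf_apply (A : Multiset C.Point) (p : C.Point) : divisorOf A p = A.count p := rfl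

theorem deg_divisorOf (A : Multiset C.Point) : C.deg (divisorOf A) = A.card := by
  classical
  rw [deg, divisorOf, Finsupp.sum_mapRange_index (fun _ => rfl), ← Multiset.toFinsupp_sum_eq A,
    Finsupp.sum, Finsupp.sum]
  push_cast
  rfl

theorem IsDivisorOf.card [IsAlgClosed k] {D : C.Divisor} {f : C.FunctionField}
    {A : Multiset C.Point} (h : C.IsDivisorOf D f A) : (A.card : ℤ) = C.deg D := by
  have := C.ordSystem.sum_ord_eq_zero f h.1 (divisorOf A - D) fun p => by
    rw [Finsupp.sub_apply, divisorOf_apply, h.2]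
    ring
  change C.deg _ = 0 at this
  rw [deg_sub, deg_divisorOf] at this
  omega

/-- The space of global sections of `𝒪(D)`. -/
abbrev sectionSpace [IsAlgClosed k] (D : C.Divisor) : Submodule k C.FunctionField :=
  C.ordSystem.sectionSpace D

theorem exists_isDivisorOf_of_mem [IsAlgClosed k] {D : C.Divisor} {f : C.FunctionField}
    (hf : f ≠ 0) (h : f ∈ sectionSpace D) : ∃ A, C.IsDivisorOf D f A :=
  C.exists_isDivisorOf hf fun p => by
    have := (C.ordSystem.ge_iff hf).1 (h p)
    omega

theorem IsDivisorOf.mem [IsAlgClosed k] {D : C.Divisor} {f : C.FunctionField}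
    {A : Multiset C.Point} (h : C.IsDivisorOf D f A) : f ∈ sectionSpace D :=
  fun p => Or.inr (by linarith [h.nonneg p])

instance finiteDimensional_sectionSpace [IsAlgClosed k] (D : C.Divisor) :
    FiniteDimensional k (sectionSpace D) := by
  have := (C.ordSystem.finrank_sectionSpace_le (D.mapRange Int.toNat rfl)).1
  refine Submodule.finiteDimensional_of_le (S₂ := C.ordSystem.sectionSpace
    fun p => (D.mapRange Int.toNat rfl p : ℤ)) fun f hf p => C.ordSystem.ge_mono (hf p) ?_
  change -((D p).toNat : ℤ) ≤ - D p
  omega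

/-- Imposing a zero at a general point lowers the dimension of a space of sections by one. -/
theorem exists_vanishing_subspace [IsAlgClosed k] {D : C.Divisor}
    {V : Submodule k C.FunctionField} (hV : V ≤ sectionSpace D) (h2 : 2 ≤ Module.finrank k V)
    (p₀ : C.Point) : ∃ q ≠ p₀, ∃ V' ≤ V, Module.finrank k V ≤ Module.finrank k V' + 1 ∧
      (∀ f ∈ V', f ≠ 0 → 1 ≤ C.ord f q + D q) ∧ ∃ f ∈ V, f ≠ 0 ∧ C.ord f q + D q = 0 := by
  have : FiniteDimensional k V := Submodule.finiteDimensional_of_le hV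
  obtain ⟨f, hf, hf0⟩ := (Submodule.ne_bot_iff V).1 (by
    rintro rfl
    rw [finrank_bot] at h2
    omega)
  have : Nonempty C.Point := ⟨p₀⟩
  have : Infinite C.Point := C.ordSystem.infinite_points
  classical
  obtain ⟨q, hq⟩ := Infinite.exists_notMem_finset
    (insert p₀ ((C.finite_support_ord hf0).toFinset ∪ D.support))
  simp only [Finset.mem_insert, Finset.mem_union, Set.Finite.mem_toFinset, Set.mem_ofPred_eq,
    Finsupp.mem_support_iff, not_or, not_not] at hq
  refine ⟨q, hq.1, V ⊓ C.ordSystem.geSpace q (- D q + 1), inf_le_left,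
    C.ordSystem.finrank_le_succ_inf_geSpace fun g hg => hV hg q, fun g hg hg0 => ?_,
    f, hf, hf0, by rw [hq.2.1, hq.2.2, add_zero]⟩
  have := (C.ordSystem.ge_iff hg0).1 hg.2
  omega

end SmoothCurve

namespace NodalCurve

variable (X : NodalCurve k) {d : ℕ}

theorem pointY_nodeY : X.pointY X.nodeY = X.pointZ X.nodeZ := Subtype.ext X.isPullback.w

variable {X} in
theorem pointY_eq_pointZ_iff {p : X.Y.Point} {q : X.Z.Point} :
    X.pointY p = X.pointZ q ↔ p = X.nodeY ∧ q = X.nodeZ := by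
  constructor
  · intro h
    obtain ⟨l, hl, hl'⟩ := X.isPullback.exists_lift p.1 q.1 (congrArg Subtype.val h)
    have hid : l = 𝟙 _ := by
      have := congrArg (· ≫ X.Y.str) hl
      simp only [Category.assoc] at this
      rwa [X.nodeY.2, p.2, Category.comp_id] at this
    rw [hid, Category.id_comp] at hl hl'
    exact ⟨Subtype.ext hl.symm, Subtype.ext hl'.symm⟩
  · rintro ⟨rfl, rfl⟩
    exact X.pointY_nodeY

theorem exists_pointY_or_pointZ [IsAlgClosed k] (x : X.Point) :
    (∃ p, X.pointY p = x) ∨ ∃ q, X.pointZ q = x := by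
  have hx : x.pt ∈ Set.range X.inclY ∪ Set.range X.inclZ := by
    rw [X.cover]
    trivial
  refine hx.imp ?_ ?_
  · rintro ⟨y, hy⟩
    have hyc : IsClosed {y} := by
      rw [← Set.preimage_image_eq {y} X.inclY.injective, Set.image_singleton, hy]
      exact x.isClosed_pt.preimage X.inclY.continuous
    obtain ⟨p, rfl⟩ := KPoint.exists_pt_eq (f := X.Y.str) hyc
    exact ⟨p, KPoint.pt_injective hy⟩
  · rintro ⟨y, hy⟩
    have hyc : IsClosed {y} := by
      rw [← Set.preimage_image_eq {y} X.inclZ.injective, Set.image_singleton, hy]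
      exact x.isClosed_pt.preimage X.inclZ.continuous
    obtain ⟨p, rfl⟩ := KPoint.exists_pt_eq (f := X.Z.str) hyc
    exact ⟨p, KPoint.pt_injective hy⟩

theorem powerProj_tuplePt (x : Fin d → X.Point) (i : Fin d) :
    X.powerProj i (X.tuplePt d x) = (x i).pt := by
  rw [tuplePt_eq, KPoint.pt, ← X.powerLift_proj (𝟙 _) (fun i => (x i).1) (fun i => (x i).2) i]
  rfl

theorem isClosed_setOf_mem [IsAlgClosed k] (q : X.Point) :
    IsClosed {s : X.SymProd d | q ∈ (s : Sym X.Point d).1} := by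
  rw [← isOpen_compl_iff, isOpen_symProd_iff]
  refine ⟨(⋃ i : Fin d, X.powerProj i ⁻¹' {q.pt})ᶜ, ?_, ?_⟩
  · rw [isOpen_compl_iff]
    exact isClosed_iUnion_of_finite fun i => q.isClosed_pt.preimage (X.powerProj i).continuous
  · ext x
    rw [Set.mem_preimage, Set.mem_preimage, Set.mem_compl_iff, Set.mem_compl_iff, not_iff_not,
      Set.mem_iUnion]
    change _ ↔ q ∈ Finset.univ.val.map x
    rw [Multiset.mem_map]
    refine exists_congr fun i => ?_
    rw [Set.mem_preimage, powerProj_tuplePt]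
    constructor
    · exact fun h => ⟨Finset.mem_univ i, KPoint.pt_injective h⟩
    · rintro ⟨-, rfl⟩
      rfl

end NodalCurve

end AbelLLS

end

noncomputable section

open Limits

/-- `T` is the first of `n + 1` decreasing irreducible sets, each of which is separated from the
previous one by a closed set. -/
def HasIrreducibleChain {S : Type*} [TopologicalSpace S] : ℕ → Set S → Prop
  | 0, T => IsIrreducible T
  | n + 1, T => IsIrreducible T ∧ ∃ K, IsClosed K ∧ ¬ T ⊆ K ∧ ∃ T' ⊆ T ∩ K, HasIrreducibleChain n T'

theorem HasIrreducibleChain.isIrreducible {S : Type*} [TopologicalSpace S] {n : ℕ} {T : Set S}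
    (h : HasIrreducibleChain n T) : IsIrreducible T := by
  cases n with
  | zero => exact h
  | succ n => exact h.1

theorem Topology.IsInducing.isIrreducible_preimage {A S : Type*} [TopologicalSpace A]
    [TopologicalSpace S] {e : A → S} (he : Topology.IsInducing e) {T : Set S} (hT : IsIrreducible T)
    (hTe : T ⊆ Set.range e) : IsIrreducible (e ⁻¹' T) := by
  constructor
  · obtain ⟨_, hx⟩ := hT.1
    obtain ⟨a, rfl⟩ := hTe hx
    exact ⟨a, hx⟩
  · rintro _ _ hu hv ⟨a, ha, hau⟩ ⟨b, hb, hbv⟩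
    obtain ⟨u, hu', rfl⟩ := he.isOpen_iff.1 hu
    obtain ⟨v, hv', rfl⟩ := he.isOpen_iff.1 hv
    obtain ⟨x, hx, hxuv⟩ := hT.2 u v hu' hv' ⟨_, ha, hau⟩ ⟨_, hb, hbv⟩
    obtain ⟨c, rfl⟩ := hTe hx
    exact ⟨c, hx, hxuv⟩

theorem HasIrreducibleChain.le_topologicalKrullDim {A S : Type*} [TopologicalSpace A]
    [TopologicalSpace S] {e : A → S} (he : Topology.IsInducing e) {n : ℕ} {T : Set S}
    (hT : HasIrreducibleChain n T) (hTe : T ⊆ Set.range e) : n ≤ topologicalKrullDim A := by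
  let Z (T : Set S) (hT : IsIrreducible T) (hTe : T ⊆ Set.range e) :
      TopologicalSpace.IrreducibleCloseds A :=
    ⟨closure (e ⁻¹' T), (he.isIrreducible_preimage hT hTe).closure, isClosed_closure⟩
  suffices h : (n : ℕ∞) ≤ Order.height (Z T hT.isIrreducible hTe) by
    refine le_trans ?_ (Order.height_le_krullDim (Z T hT.isIrreducible hTe))
    exact_mod_cast h
  induction n generalizing T with
  | zero => simp
  | succ n ih =>
    obtain ⟨-, K, hK, hTK, T', hT', hchain⟩ := id hT
    have h1 := ih hchain (fun x hx => hTe (hT' hx).1)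
    have hlt : Z T' hchain.isIrreducible (fun x hx => hTe (hT' hx).1) <
        Z T hT.isIrreducible hTe := by
      refine lt_of_le_not_ge (closure_mono fun x hx => (hT' hx).1) fun hle => hTK ?_
      intro x hx
      obtain ⟨a, rfl⟩ := hTe hx
      have h2 : a ∈ closure (e ⁻¹' T') := hle (subset_closure hx)
      exact closure_minimal (s := e ⁻¹' T') (t := e ⁻¹' K) (fun y hy => (hT' hy).2) (hK.preimage he.continuous) h2
    refine le_trans ?_ (Order.height_add_one_le hlt)
    push_cast
    exact add_le_add_left h1 1

namespace AbelLLS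

universe u

namespace NodalCurve

variable {k : Type u} [Field k] (X : NodalCurve k) {d : ℕ}

theorem exists_mem_zeroCycles [IsAlgClosed k] {D : X.Y.Divisor} {E : X.Z.Divisor}
    (hdeg : X.Y.deg D + X.Z.deg E = d) {f : X.Y.FunctionField} {g : X.Z.FunctionField}
    {A : Multiset X.Y.Point} {B : Multiset X.Z.Point} (hA : X.Y.IsDivisorOf D f A)
    (hB : X.Z.IsDivisorOf E g B) :
    ∃ s : X.SymProd d, (s : Sym X.Point d).1 = A.map X.pointY + B.map X.pointZ :=
  ⟨(⟨A.map X.pointY + B.map X.pointZ, by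
    have h1 := hA.card
    have h2 := hB.card
    rw [Multiset.card_add, Multiset.card_map, Multiset.card_map]
    omega⟩ : Sym X.Point d), rfl⟩

theorem isIrreducible_zeroCycles [IsAlgClosed k] {D : X.Y.Divisor} {E : X.Z.Divisor}
    (hdeg : X.Y.deg D + X.Z.deg E = d) {V : Submodule k X.Y.FunctionField}
    {W : Submodule k X.Z.FunctionField} (hV : V ≤ SmoothCurve.sectionSpace D)
    (hW : W ≤ SmoothCurve.sectionSpace E) (hV1 : V ≠ ⊥) (hW1 : W ≠ ⊥) :
    IsIrreducible (X.zeroCycles d D E V W) := by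
  refine ⟨?_, X.isPreirreducible_zeroCycles D E V W⟩
  obtain ⟨f, hf, hf0⟩ := (Submodule.ne_bot_iff V).1 hV1
  obtain ⟨g, hg, hg0⟩ := (Submodule.ne_bot_iff W).1 hW1
  obtain ⟨A, hA⟩ := SmoothCurve.exists_isDivisorOf_of_mem hf0 (hV hf)
  obtain ⟨B, hB⟩ := SmoothCurve.exists_isDivisorOf_of_mem hg0 (hW hg)
  obtain ⟨s, hs⟩ := X.exists_mem_zeroCycles hdeg hA hB
  exact ⟨s, f, hf, A, hA, g, hg, B, hB, hs⟩

theorem zeroCycles_mono {D : X.Y.Divisor} {E : X.Z.Divisor} {V V' : Submodule k X.Y.FunctionField}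
    {W W' : Submodule k X.Z.FunctionField} (hV : V' ≤ V) (hW : W' ≤ W) :
    X.zeroCycles d D E V' W' ⊆ X.zeroCycles d D E V W := by
  rintro s ⟨f, hf, A, hA, g, hg, B, hB, hs⟩
  exact ⟨f, hV hf, A, hA, g, hW hg, B, hB, hs⟩

theorem hasIrreducibleChain_zeroCycles [IsAlgClosed k] {D : X.Y.Divisor} {E : X.Z.Divisor}
    (hdeg : X.Y.deg D + X.Z.deg E = d) (n : ℕ) {V : Submodule k X.Y.FunctionField}
    {W : Submodule k X.Z.FunctionField} (hV : V ≤ SmoothCurve.sectionSpace D)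
    (hW : W ≤ SmoothCurve.sectionSpace E) (hV1 : 1 ≤ Module.finrank k V)
    (hW1 : 1 ≤ Module.finrank k W) (hn : n + 2 ≤ Module.finrank k V + Module.finrank k W) :
    HasIrreducibleChain n (X.zeroCycles d D E V W) := by
  classical
  have hirr : IsIrreducible (X.zeroCycles d D E V W) := by
    refine X.isIrreducible_zeroCycles hdeg hV hW ?_ ?_
    · rintro rfl
      rw [finrank_bot] at hV1
      omega
    · rintro rfl
      rw [finrank_bot] at hW1
      omega
  induction n generalizing V W with
  | zero => exact hirr
  | succ n ih =>
    refine ⟨hirr, ?_⟩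
    by_cases hV2 : 2 ≤ Module.finrank k V
    · obtain ⟨q, hq, V', hV', hr, hvan, f, hf, hf0, hfq⟩ :=
        SmoothCurve.exists_vanishing_subspace hV hV2 X.nodeY
      refine ⟨_, X.isClosed_setOf_mem (X.pointY q), ?_, X.zeroCycles d D E V' W, ?_,
        ih (hV'.trans hV) hW (by omega) hW1 (by omega) (X.isIrreducible_zeroCycles hdeg
          (hV'.trans hV) hW (by rintro rfl; rw [finrank_bot] at hr; omega)
          (by rintro rfl; rw [finrank_bot] at hW1; omega))⟩
      · obtain ⟨g, hg, hg0⟩ := (Submodule.ne_bot_iff W).1 (by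
          rintro rfl; rw [finrank_bot] at hW1; omega)
        obtain ⟨A, hA⟩ := SmoothCurve.exists_isDivisorOf_of_mem hf0 (hV hf)
        obtain ⟨B, hB⟩ := SmoothCurve.exists_isDivisorOf_of_mem hg0 (hW hg)
        obtain ⟨s, hs⟩ := X.exists_mem_zeroCycles hdeg hA hB
        intro hsub
        have hmem : X.pointY q ∈ (s : Sym X.Point d).1 := hsub ⟨f, hf, A, hA, g, hg, B, hB, hs⟩
        rw [hs, Multiset.mem_add, Multiset.mem_map, Multiset.mem_map] at hmem
        obtain ⟨p, hp, hpq⟩ | ⟨p, hp, hpq⟩ := hmem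
        · rw [X.pointY_injective hpq, ← Multiset.count_pos] at hp
          have := hA.2 q
          omega
        · exact hq (pointY_eq_pointZ_iff.1 hpq.symm).1
      · intro s hs
        refine ⟨X.zeroCycles_mono hV' le_rfl hs, ?_⟩
        obtain ⟨f, hf, A, hA, g, hg, B, hB, hs⟩ := hs
        change _ ∈ (s : Sym X.Point d).1
        rw [hs, Multiset.mem_add]
        refine Or.inl (Multiset.mem_map_of_mem _ ?_)
        rw [← Multiset.count_pos]
        have h1 := hA.2 q
        have h2 := hvan f hf hA.1
        omega
    · have hW2 : 2 ≤ Module.finrank k W := by omega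
      obtain ⟨q, hq, W', hW', hr, hvan, g, hg, hg0, hgq⟩ :=
        SmoothCurve.exists_vanishing_subspace hW hW2 X.nodeZ
      refine ⟨_, X.isClosed_setOf_mem (X.pointZ q), ?_, X.zeroCycles d D E V W', ?_,
        ih hV (hW'.trans hW) hV1 (by omega) (by omega) (X.isIrreducible_zeroCycles hdeg
          hV (hW'.trans hW) (by rintro rfl; rw [finrank_bot] at hV1; omega)
          (by rintro rfl; rw [finrank_bot] at hr; omega))⟩
      · obtain ⟨f, hf, hf0⟩ := (Submodule.ne_bot_iff V).1 (by
          rintro rfl; rw [finrank_bot] at hV1; omega)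
        obtain ⟨A, hA⟩ := SmoothCurve.exists_isDivisorOf_of_mem hf0 (hV hf)
        obtain ⟨B, hB⟩ := SmoothCurve.exists_isDivisorOf_of_mem hg0 (hW hg)
        obtain ⟨s, hs⟩ := X.exists_mem_zeroCycles hdeg hA hB
        intro hsub
        have hmem : X.pointZ q ∈ (s : Sym X.Point d).1 := hsub ⟨f, hf, A, hA, g, hg, B, hB, hs⟩
        rw [hs, Multiset.mem_add, Multiset.mem_map, Multiset.mem_map] at hmem
        obtain ⟨p, hp, hpq⟩ | ⟨p, hp, hpq⟩ := hmem
        · exact hq (pointY_eq_pointZ_iff.1 hpq).2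
        · rw [X.pointZ_injective hpq, ← Multiset.count_pos] at hp
          have := hB.2 q
          omega
      · intro s hs
        refine ⟨X.zeroCycles_mono le_rfl hW' hs, ?_⟩
        obtain ⟨f, hf, A, hA, g, hg, B, hB, hs⟩ := hs
        change _ ∈ (s : Sym X.Point d).1
        rw [hs, Multiset.mem_add]
        refine Or.inr (Multiset.mem_map_of_mem _ ?_)
        rw [← Multiset.count_pos]
        have h1 := hB.2 q
        have h2 := hvan g hg hB.1
        omega

end NodalCurve

end AbelLLS

end

noncomputable section

open Limits

namespace AbelLLS

universe u

namespace NodalCurve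

variable {k : Type u} [Field k] (X : NodalCurve k) {d : ℕ}

open scoped Classical in
theorem partY_apply (s : X.SymProd d) (p : X.Y.Point) :
    X.partY s p = (s : Sym X.Point d).1.count (X.pointY p) := rfl

open scoped Classical in
theorem partZ_apply (s : X.SymProd d) (q : X.Z.Point) : X.partZ s q =
    if q = X.nodeZ then 0 else ((s : Sym X.Point d).1.count (X.pointZ q) : ℤ) := by
  rw [partZ, Finsupp.mapRange_apply, Finsupp.erase_apply]
  split_ifs with h
  · rfl
  · rfl

theorem exists_eq_divisorOf {C : SmoothCurve k} {D : C.Divisor} (hD : ∀ p, 0 ≤ D p) :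
    ∃ A, SmoothCurve.divisorOf A = D := by
  classical
  refine ⟨Finsupp.toMultiset (D.mapRange Int.toNat rfl), Finsupp.ext fun p => ?_⟩
  rw [SmoothCurve.divisorOf_apply]
  refine (congrArg _ (Finsupp.count_toMultiset _ _)).trans ?_
  exact Int.toNat_of_nonneg (hD p)

open scoped Classical in
theorem count_map_pointZ_pointY (B : Multiset X.Z.Point) (p : X.Y.Point) :
    (B.map X.pointZ).count (X.pointY p) = if p = X.nodeY then B.count X.nodeZ else 0 := by
  split_ifs with h
  · rw [h, pointY_nodeY, Multiset.count_map_eq_count' _ _ X.pointZ_injective]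
  · rw [Multiset.count_eq_zero, Multiset.mem_map]
    rintro ⟨q, -, hq⟩
    exact h (pointY_eq_pointZ_iff.1 hq.symm).1

open scoped Classical in
theorem count_map_pointY_pointZ (A : Multiset X.Y.Point) (q : X.Z.Point) :
    (A.map X.pointY).count (X.pointZ q) = if q = X.nodeZ then A.count X.nodeY else 0 := by
  split_ifs with h
  · rw [h, ← pointY_nodeY, Multiset.count_map_eq_count' _ _ X.pointY_injective]
  · rw [Multiset.count_eq_zero, Multiset.mem_map]
    rintro ⟨p, -, hp⟩
    exact h (pointY_eq_pointZ_iff.1 hp).2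

theorem exists_partY_partZ_eq [IsAlgClosed k] (s : X.SymProd d) :
    ∃ A B, X.partY s = SmoothCurve.divisorOf A ∧ X.partZ s = SmoothCurve.divisorOf B ∧
      (s : Sym X.Point d).1 = A.map X.pointY + B.map X.pointZ := by
  classical
  obtain ⟨A, hA⟩ := exists_eq_divisorOf (D := X.partY s) fun p => by
    rw [partY_apply]
    positivity
  obtain ⟨B, hB⟩ := exists_eq_divisorOf (D := X.partZ s) fun p => by
    rw [partZ_apply]
    split_ifs <;> positivity
  refine ⟨A, B, hA.symm, hB.symm, ?_⟩
  have hA' (p) : A.count p = (s : Sym X.Point d).1.count (X.pointY p) := by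
    have := DFunLike.congr_fun hA p
    rw [partY_apply, SmoothCurve.divisorOf_apply] at this
    convert Nat.cast_injective this
  have hB' (q) : B.count q = if q = X.nodeZ then 0 else
      (s : Sym X.Point d).1.count (X.pointZ q) := by
    have := DFunLike.congr_fun hB q
    rw [partZ_apply, SmoothCurve.divisorOf_apply] at this
    split_ifs at this ⊢ with h
    · convert Nat.cast_injective this
    · convert Nat.cast_injective this
  ext x
  rw [Multiset.count_add]
  obtain ⟨p, rfl⟩ | ⟨q, rfl⟩ := X.exists_pointY_or_pointZ x
  · rw [Multiset.count_map_eq_count' _ _ X.pointY_injective, hA', eq_comm, add_eq_left]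
    convert X.count_map_pointZ_pointY B p
    split_ifs with h
    · have := hB' X.nodeZ
      rw [if_pos rfl] at this
      rw [eq_comm]
      convert this
    · rfl
  · rw [Multiset.count_map_eq_count' _ _ X.pointZ_injective, hB']
    have := X.count_map_pointY_pointZ A q
    split_ifs at this ⊢ with h
    · rw [h, ← pointY_nodeY, ← hA', add_zero, pointY_nodeY, ← h]
      convert this.symm
    · rw [eq_comm, add_eq_right]
      convert this

/-- The part of the fibre of the Abel map over `L` that comes from the sections of `L|_Y(-jP)` and
`L|_Z(jP)`. -/
abbrev fiberPart (d : ℕ) (L : X.LineBundle) (j : ℤ) : Set (X.SymProd d) :=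
  X.zeroCycles d (L.divY - Finsupp.single X.nodeY j) (L.divZ + Finsupp.single X.nodeZ j) ⊤ ⊤

theorem mem_abelFiber_iff [IsAlgClosed k] {L : X.LineBundle} {s : X.SymProd d} :
    s ∈ X.abelFiber d L ↔ ∃ j, s ∈ X.fiberPart d L j := by
  classical
  have h1 : s ∈ X.abelFiber d L ↔ X.Equivalent (X.partY s, X.partZ s) (L.divY, L.divZ) :=
    Quotient.eq (r := (⟨X.Equivalent, Equivalent.equivalence X⟩ : Setoid _))
  rw [h1]
  constructor
  · rintro ⟨j, ⟨f, hf, hfj⟩, g, hg, hgj⟩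
    obtain ⟨A, B, hA, hB, hs⟩ := X.exists_partY_partZ_eq s
    refine ⟨j, f, trivial, A, ⟨hf, fun p => ?_⟩, g, trivial, B, ⟨hg, fun q => ?_⟩, hs⟩
    · have := hfj p
      dsimp only at this
      rw [hA] at this
      have h2 := SmoothCurve.divisorOf_apply A p
      omega
    · have := hgj q
      dsimp only at this
      rw [hB] at this
      have h2 := SmoothCurve.divisorOf_apply B q
      omega
  · rintro ⟨j, f, -, A, hA, g, -, B, hB, hs⟩
    refine ⟨j - B.count X.nodeZ, ⟨f, hA.1, fun p => ?_⟩, ⟨g, hB.1, fun q => ?_⟩⟩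
    · have h2 := hA.2 p
      have h3 := X.count_map_pointZ_pointY B p
      rw [partY_apply, hs, Multiset.count_add, Multiset.count_map_eq_count' _ _ X.pointY_injective,
        h3]
      rw [Finsupp.sub_apply, Finsupp.single_apply] at h2 ⊢
      have h4 : X.nodeY = p ↔ p = X.nodeY := eq_comm
      simp only [h4] at h2 ⊢
      split_ifs at h2 ⊢ with h5
      · push_cast
        omega
      · push_cast
        omega
    · have h2 := hB.2 q
      have h3 := X.count_map_pointY_pointZ A q
      rw [partZ_apply, hs, Multiset.count_add, Multiset.count_map_eq_count' _ _ X.pointZ_injective,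
        h3]
      rw [Finsupp.add_apply, Finsupp.single_apply] at h2 ⊢
      have h4 : X.nodeZ = q ↔ q = X.nodeZ := eq_comm
      simp only [h4] at h2 ⊢
      split_ifs at h2 ⊢ with h5
      · subst h5
        omega
      · push_cast
        omega

theorem fiberPart_subset [IsAlgClosed k] (L : X.LineBundle) (j : ℤ) :
    X.fiberPart d L j ⊆ X.abelFiber d L := fun _ hs => X.mem_abelFiber_iff.2 ⟨j, hs⟩

theorem le_of_nonempty_fiberPart [IsAlgClosed k] {L : X.LineBundle} (hY : X.Y.deg L.divY = d)
    (hZ : X.Z.deg L.divZ = 0) {j : ℤ} (h : (X.fiberPart d L j).Nonempty) : 0 ≤ j ∧ j ≤ d := by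
  obtain ⟨s, f, -, A, hA, g, -, B, hB, hs⟩ := h
  have h1 := hA.card
  have h2 := hB.card
  rw [SmoothCurve.deg_sub, SmoothCurve.deg_single] at h1
  rw [SmoothCurve.deg_add, SmoothCurve.deg_single] at h2
  omega

/-- If the node is a base point of `L|_Y(-jP)`, it can be moved to the other component. -/
theorem fiberPart_subset_succ [IsAlgClosed k] {L : X.LineBundle} {j : ℤ}
    (h : ∀ f ∈ SmoothCurve.sectionSpace (L.divY - Finsupp.single X.nodeY j), f ≠ 0 →
      X.Y.ord f X.nodeY + L.divY X.nodeY ≠ j) :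
    X.fiberPart d L j ⊆ X.fiberPart d L (j + 1) := by
  classical
  rintro s ⟨f, -, A, hA, g, -, B, hB, hs⟩
  have hmem : X.nodeY ∈ A := by
    rw [← Multiset.count_ne_zero]
    intro h0
    have h1 := hA.2 X.nodeY
    rw [Finsupp.sub_apply, Finsupp.single_eq_same] at h1
    refine h f hA.mem hA.1 ?_
    have : ((Multiset.count X.nodeY A : ℕ) : ℤ) = 0 := by exact_mod_cast h0
    have h2 : ((Multiset.count X.nodeY A : ℕ) : ℤ) =
      X.Y.ord f X.nodeY + (L.divY X.nodeY - j) := by convert h1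
    omega
  obtain ⟨A', rfl⟩ := Multiset.exists_cons_of_mem hmem
  refine ⟨f, trivial, A', ⟨hA.1, fun p => ?_⟩, g, trivial, X.nodeZ ::ₘ B, ⟨hB.1, fun q => ?_⟩, ?_⟩
  · have h1 := hA.2 p
    rw [Multiset.count_cons] at h1
    rw [Finsupp.sub_apply, Finsupp.single_apply] at h1 ⊢
    have h4 : X.nodeY = p ↔ p = X.nodeY := eq_comm
    simp only [h4] at h1 ⊢
    split_ifs at h1 ⊢ with h5
    · push_cast at h1
      omega
    · push_cast at h1
      omega
  · have h1 := hB.2 q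
    rw [Multiset.count_cons]
    rw [Finsupp.add_apply, Finsupp.single_apply] at h1 ⊢
    have h4 : X.nodeZ = q ↔ q = X.nodeZ := eq_comm
    simp only [h4] at h1 ⊢
    split_ifs at h1 ⊢ with h5
    · push_cast
      omega
    · push_cast
      omega
  · rw [hs, Multiset.map_cons, Multiset.map_cons, pointY_nodeY, Multiset.cons_add,
      Multiset.add_cons]

/-- An irreducible component of the fibre contains the part of the fibre coming from some
`L|_Y(-mP)` without base point at the node. -/
theorem exists_fiberPart_subset [IsAlgClosed k] {L : X.LineBundle} (hY : X.Y.deg L.divY = d)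
    (hZ : X.Z.deg L.divZ = 0) {C : Set (X.abelFiber d L)}
    (hC : C ∈ irreducibleComponents (X.abelFiber d L)) :
    ∃ m : ℕ, m ≤ d ∧ (X.fiberPart d L m).Nonempty ∧
      X.fiberPart d L m ⊆ Set.range (fun x : C => (x : X.SymProd d)) ∧
      ∃ f ∈ SmoothCurve.sectionSpace (L.divY - Finsupp.single X.nodeY (m : ℤ)), f ≠ 0 ∧
        X.Y.ord f X.nodeY + L.divY X.nodeY = m := by
  classical
  let T (j : ℤ) : Set (X.abelFiber d L) := Subtype.val ⁻¹' X.fiberPart d L j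
  have hT (j : ℤ) : IsPreirreducible (T j) := by
    obtain h | h := (X.fiberPart d L j).eq_empty_or_nonempty
    · have : T j = ∅ := by
        change Subtype.val ⁻¹' _ = _
        rw [h, Set.preimage_empty]
      rw [this]
      exact isPreirreducible_empty
    · refine (Topology.IsInducing.isIrreducible_preimage Topology.IsInducing.subtypeVal
        ⟨h, X.isPreirreducible_zeroCycles _ _ _ _⟩ ?_).2
      rw [Subtype.range_val]
      exact X.fiberPart_subset L j
  have hCirr : IsIrreducible C := hC.1
  have hCcov : C ⊆ ⋃₀ (((Finset.range (d + 1)).image fun m : ℕ => closure (T m) :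
      Finset (Set (X.abelFiber d L))) : Set (Set (X.abelFiber d L))) := by
    intro x _
    obtain ⟨j, hj⟩ := X.mem_abelFiber_iff.1 x.2
    obtain ⟨h0, hd⟩ := X.le_of_nonempty_fiberPart hY hZ ⟨_, hj⟩
    lift j to ℕ using h0
    refine ⟨closure (T j), ?_, subset_closure hj⟩
    rw [Finset.mem_coe, Finset.mem_image]
    exact ⟨j, Finset.mem_range.2 (by omega), rfl⟩
  have hex : ∃ m : ℕ, m ≤ d ∧ C ⊆ closure (T m) := by
    obtain ⟨t, ht, hCt⟩ := isIrreducible_iff_sUnion_isClosed.1 hCirr _ (by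
      intro t ht
      obtain ⟨m, -, rfl⟩ := Finset.mem_image.1 ht
      exact isClosed_closure) hCcov
    obtain ⟨m, hm, rfl⟩ := Finset.mem_image.1 ht
    exact ⟨m, by have := Finset.mem_range.1 hm; omega, hCt⟩
  obtain ⟨m₀, hm₀d, hm₀⟩ := hex
  set m := Nat.findGreatest (fun m => C ⊆ closure (T m)) d with hm
  have hCm : C ⊆ closure (T m) := Nat.findGreatest_spec (P := fun m => C ⊆ closure (T m)) hm₀d hm₀
  have hmd : m ≤ d := Nat.findGreatest_le d
  have hTne : (T m).Nonempty := by
    rw [← closure_nonempty_iff]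
    exact hCirr.1.mono hCm
  have hne : (X.fiberPart d L m).Nonempty := by
    obtain ⟨x, hx⟩ := hTne
    exact ⟨_, hx⟩
  have hCeq : closure (T m) ⊆ C := hC.2 (IsIrreducible.closure ⟨hTne, hT m⟩) hCm
  refine ⟨m, hmd, hne, fun s hs => ?_, ?_⟩
  · exact ⟨⟨⟨s, X.fiberPart_subset L m hs⟩, hCeq (subset_closure hs)⟩, rfl⟩
  · by_contra! hbase
    have hsub := X.fiberPart_subset_succ (d := d) hbase
    obtain ⟨-, hle⟩ := X.le_of_nonempty_fiberPart hY hZ (hne.mono hsub)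
    have hC' : C ⊆ closure (T (m + 1 : ℕ)) := by
      refine hCm.trans (closure_mono fun x hx => ?_)
      change _ ∈ X.fiberPart d L ((m + 1 : ℕ) : ℤ)
      rw [Nat.cast_succ]
      exact hsub hx
    have := Nat.le_findGreatest (P := fun m => C ⊆ closure (T m)) (by omega : m + 1 ≤ d) hC'
    omega

/-- A bound for the dimension of an irreducible component of the fibre of the Abel map. -/
theorem le_topologicalKrullDim [IsAlgClosed k] {L : X.LineBundle} (hY : X.Y.deg L.divY = d)
    (hZ : X.Z.deg L.divZ = 0) {C : Set (X.abelFiber d L)} {m : ℕ}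
    (hne : (X.fiberPart d L m).Nonempty)
    (hC : X.fiberPart d L m ⊆ Set.range (fun x : C => (x : X.SymProd d))) {n : ℕ}
    (hn : n + 2 ≤
      Module.finrank k (SmoothCurve.sectionSpace (L.divY - Finsupp.single X.nodeY (m : ℤ))) +
      Module.finrank k (SmoothCurve.sectionSpace (L.divZ + Finsupp.single X.nodeZ (m : ℤ)))) :
    n ≤ topologicalKrullDim C := by
  obtain ⟨s, f, -, A, hA, g, -, B, hB, hs⟩ := hne
  have h1 := Submodule.one_le_finrank_iff.2 ((Submodule.ne_bot_iff _).2 ⟨f, hA.mem, hA.1⟩)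
  have h2 := Submodule.one_le_finrank_iff.2 ((Submodule.ne_bot_iff _).2 ⟨g, hB.mem, hB.1⟩)
  have := X.hasIrreducibleChain_zeroCycles (d := d) (by
    rw [SmoothCurve.deg_sub, SmoothCurve.deg_add, SmoothCurve.deg_single, SmoothCurve.deg_single,
      hY, hZ]
    ring) n le_rfl le_rfl h1 h2 hn
  refine this.le_topologicalKrullDim (e := fun x : C => (x : X.SymProd d))
    (Topology.IsInducing.subtypeVal.comp Topology.IsInducing.subtypeVal) ?_
  exact (X.zeroCycles_mono le_top le_top).trans hC

end NodalCurve

end AbelLLS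

end

noncomputable section

open Limits

theorem OrdSystem.card_le_finrank {k K P : Type*} [Field k] [Field K] [Algebra k K]
    {ord : K → P → ℤ} (H : OrdSystem k ord) (p : P) (O : Finset ℤ) (V : Submodule k K)
    [FiniteDimensional k V] (h : ∀ n ∈ O, ∃ f ∈ V, f ≠ 0 ∧ ord f p = n) :
    O.card ≤ Module.finrank k V := by
  induction O using Finset.induction_on_min generalizing V with
  | empty => simp
  | insert a s has ih =>
    obtain ⟨f, hf, hf0, hfa⟩ := h a (Finset.mem_insert_self a s)
    have : FiniteDimensional k (V ⊓ H.geSpace p (a + 1) : Submodule k K) :=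
      Submodule.finiteDimensional_of_le inf_le_left
    have h1 := ih (V ⊓ H.geSpace p (a + 1)) fun n hn => by
      obtain ⟨g, hg, hg0, hgn⟩ := h n (Finset.mem_insert_of_mem hn)
      exact ⟨g, ⟨hg, (H.ge_iff hg0).2 (by have := has n hn; omega)⟩, hg0, hgn⟩
    have h2 : Module.finrank k (V ⊓ H.geSpace p (a + 1) : Submodule k K) < Module.finrank k V := by
      refine Submodule.finrank_lt_finrank_of_lt (lt_of_le_of_ne inf_le_left fun heq => ?_)
      rw [← heq] at hf
      have := (H.ge_iff hf0).1 hf.2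
      omega
    rw [Finset.card_insert_of_notMem fun ha => lt_irrefl _ (has a ha)]
    omega

namespace AbelLLS

universe u

namespace NodalCurve

variable {k : Type u} [Field k] [IsAlgClosed k] {X : NodalCurve k} {d r : ℕ} {L : X.LineBundle}

theorem LimitLinearSeries.le_finrank_add_finrank (S : X.LimitLinearSeries d r L) {m : ℕ}
    (hm : m ≤ d)
    (hf : ∃ f ∈ SmoothCurve.sectionSpace (L.divY - Finsupp.single X.nodeY (m : ℤ)), f ≠ 0 ∧
      X.Y.ord f X.nodeY + L.divY X.nodeY = m) :
    r + 2 ≤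
      Module.finrank k (SmoothCurve.sectionSpace (L.divY - Finsupp.single X.nodeY (m : ℤ))) +
      Module.finrank k (SmoothCurve.sectionSpace (L.divZ + Finsupp.single X.nodeZ (m : ℤ))) := by
  obtain ⟨f, hfs, hf0, hfm⟩ := hf
  let i : Fin (d + 1) := ⟨m, by omega⟩
  set B := S.bundle i with hB
  have hBY : B.divY = L.divY - Finsupp.single X.nodeY (m : ℤ) := S.divY_bundle i
  have hBZ : B.divZ = L.divZ + Finsupp.single X.nodeZ (m : ℤ) := S.divZ_bundle i
  rw [← hBY] at hfs
  have hfm' : X.Y.ord f X.nodeY = - B.divY X.nodeY := by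
    rw [hBY, Finsupp.sub_apply, Finsupp.single_eq_same]
    omega
  rw [← hBY, ← hBZ]
  set V := S.V i with hVdef
  have hVfin : Module.finrank k V = r + 1 := S.finrank_V i
  have hVs : ∀ s ∈ V, s ∈ B.sections := fun s hs => S.V_sections i hs
  have : FiniteDimensional k V := Module.finite_of_finrank_pos (by omega)
  let ρ : V →ₗ[k] X.Y.FunctionField := (LinearMap.fst k _ _).domRestrict V
  let W : Submodule k X.Z.FunctionField := V.comap (LinearMap.inr k _ _)
  have hρ : LinearMap.range ρ ≤ SmoothCurve.sectionSpace B.divY := by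
    rintro _ ⟨s, rfl⟩
    exact (hVs s s.2).1
  have hW : W ≤ SmoothCurve.sectionSpace B.divZ := fun g hg => (hVs _ hg).2.1
  have hWP : W ≤ X.Z.ordSystem.geSpace X.nodeZ (1 - B.divZ X.nodeZ) := by
    intro g hg
    obtain ⟨-, -, c, hc1, hc2⟩ := hVs _ hg
    have hc : c = 0 := by
      by_contra hc
      obtain h | h := hc1
      · simp only [LinearMap.inr_apply, zero_sub, neg_eq_zero, smul_eq_zero] at h
        exact h.elim hc B.genY_ne_zero
      · simp only [LinearMap.inr_apply, zero_sub] at h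
        rw [X.Y.ordSystem.neg, SmoothCurve.ord_smul hc B.genY_ne_zero, B.ord_genY] at h
        omega
    simp only [LinearMap.inr_apply, hc, zero_smul, sub_zero] at hc2
    exact hc2
  have hWfin : FiniteDimensional k W := Submodule.finiteDimensional_of_le hW
  have hker : Module.finrank k (LinearMap.ker ρ) ≤ Module.finrank k W := by
    let e : LinearMap.ker ρ →ₗ[k] W := LinearMap.codRestrict W
      ((LinearMap.snd k X.Y.FunctionField X.Z.FunctionField).comp
        (V.subtype.comp (LinearMap.ker ρ).subtype)) fun x => by
        have hx : (x : V).1.1 = 0 := x.2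
        have : ((0, (x : V).1.2) : X.Y.FunctionField × X.Z.FunctionField) = (x : V).1 :=
          Prod.ext hx.symm rfl
        change ((0, (x : V).1.2) : X.Y.FunctionField × X.Z.FunctionField) ∈ V
        rw [this]
        exact (x : V).2
    refine LinearMap.finrank_le_finrank_of_injective (f := e) fun x y hxy => ?_
    have hx : (x : V).1.1 = 0 := x.2
    have hy : (y : V).1.1 = 0 := y.2
    exact Subtype.ext (Subtype.ext (Prod.ext (hx.trans hy.symm) (congrArg Subtype.val hxy)))
  have hrank := LinearMap.finrank_range_add_finrank_ker ρ
  have hleY := Submodule.finrank_mono hρ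
  have hleZ := Submodule.finrank_mono hW
  by_cases hcase : LinearMap.range ρ ≤ X.Y.ordSystem.geSpace X.nodeY (1 - B.divY X.nodeY)
  · have : Module.finrank k (LinearMap.range ρ) <
        Module.finrank k (SmoothCurve.sectionSpace B.divY) := by
      refine Submodule.finrank_lt_finrank_of_lt (lt_of_le_of_ne hρ fun heq => ?_)
      rw [← heq] at hfs
      have := (X.Y.ordSystem.ge_iff hf0).1 (hcase hfs)
      omega
    omega
  · have : Module.finrank k W < Module.finrank k (SmoothCurve.sectionSpace B.divZ) := by
      rw [SetLike.not_le_iff_exists] at hcase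
      obtain ⟨_, ⟨s, rfl⟩, hs⟩ := hcase
      obtain ⟨-, h2, c, hc1, hc2⟩ := hVs s s.2
      refine Submodule.finrank_lt_finrank_of_lt (lt_of_le_of_ne hW fun heq => ?_)
      have hs2 := hWP (heq.ge h2)
      have hc : c ≠ 0 := by
        rintro rfl
        rw [zero_smul, sub_zero] at hc1
        exact hs hc1
      have h3 := (X.Z.ordSystem.geSpace X.nodeZ (1 - B.divZ X.nodeZ)).sub_mem hs2 hc2
      rw [sub_sub_cancel] at h3
      have h4 := (X.Z.ordSystem.ge_iff (smul_ne_zero hc B.genZ_ne_zero)).1 h3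
      rw [SmoothCurve.ord_smul hc B.genZ_ne_zero, B.ord_genZ] at h4
      omega
    omega

theorem EHLimitLinearSeries.le_finrank_add_finrank (S : X.EHLimitLinearSeries d r L) {m : ℕ}
    (hf : ∃ f ∈ SmoothCurve.sectionSpace (L.divY - Finsupp.single X.nodeY (m : ℤ)), f ≠ 0 ∧
      X.Y.ord f X.nodeY + L.divY X.nodeY = m) :
    r + 2 ≤
      Module.finrank k (SmoothCurve.sectionSpace (L.divY - Finsupp.single X.nodeY (m : ℤ))) +
      Module.finrank k (SmoothCurve.sectionSpace (L.divZ + Finsupp.single X.nodeZ (m : ℤ))) := by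
  classical
  obtain ⟨f, hfs, hf0, hfm⟩ := hf
  let JY : Finset (Fin (r + 1)) := Finset.univ.filter fun j => (m : ℤ) ≤ S.aY j
  let JZ : Finset (Fin (r + 1)) := Finset.univ.filter fun j => (d - m : ℤ) ≤ S.aZ j.rev
  have haY : Function.Injective S.aY := S.isVanishingSequenceY.1.injective
  have haZ : Function.Injective fun j : Fin (r + 1) => S.aZ j.rev :=
    S.isVanishingSequenceZ.1.injective.comp Fin.rev_injective
  have hY (j) : ∃ f ∈ S.VY, f ≠ 0 ∧ S.aY j = X.Y.ord f X.nodeY + L.divY X.nodeY := by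
    have : S.aY j ∈ Set.range S.aY := ⟨j, rfl⟩
    rw [S.isVanishingSequenceY.2] at this
    exact this
  have hZ (j) : ∃ g ∈ S.VZ, g ≠ 0 ∧ S.aZ j = X.Z.ord g X.nodeZ + (L.divZ X.nodeZ + d) := by
    have : S.aZ j ∈ Set.range S.aZ := ⟨j, rfl⟩
    rw [S.isVanishingSequenceZ.2] at this
    obtain ⟨g, hg, hg0, h⟩ := this
    rw [Finsupp.add_apply, Finsupp.single_eq_same] at h
    exact ⟨g, hg, hg0, h⟩
  have hcardY := X.Y.ordSystem.card_le_finrank X.nodeY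
    ((insert (m : ℤ) (JY.image S.aY)).image fun n => n - L.divY X.nodeY)
    (SmoothCurve.sectionSpace (L.divY - Finsupp.single X.nodeY (m : ℤ))) (by
      intro n hn
      obtain ⟨n, hn', rfl⟩ := Finset.mem_image.1 hn
      obtain rfl | hn' := Finset.mem_insert.1 hn'
      · exact ⟨f, hfs, hf0, by omega⟩
      · obtain ⟨j, hj, rfl⟩ := Finset.mem_image.1 hn'
        obtain ⟨h, hh, hh0, hhj⟩ := hY j
        have hjm := (Finset.mem_filter.1 hj).2
        refine ⟨h, fun p => ?_, hh0, by omega⟩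
        have hp : X.Y.OrdGE h p (- L.divY p) := S.isLinearSeriesY.1 hh p
        have hp' := (X.Y.ordSystem.ge_iff hh0).1 hp
        rw [X.Y.ordSystem.ge_iff hh0, Finsupp.sub_apply, Finsupp.single_apply]
        split_ifs with h5
        · subst h5
          omega
        · omega)
  have hcardZ := X.Z.ordSystem.card_le_finrank X.nodeZ
    ((JZ.image fun j => S.aZ j.rev).image fun n => n - (L.divZ X.nodeZ + d))
    (SmoothCurve.sectionSpace (L.divZ + Finsupp.single X.nodeZ (m : ℤ))) (by
      intro n hn
      obtain ⟨n, hn', rfl⟩ := Finset.mem_image.1 hn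
      obtain ⟨j, hj, rfl⟩ := Finset.mem_image.1 hn'
      obtain ⟨h, hh, hh0, hhj⟩ := hZ j.rev
      have hjm := (Finset.mem_filter.1 hj).2
      refine ⟨h, fun p => ?_, hh0, by omega⟩
      have hp : X.Z.OrdGE h p (- (L.divZ + Finsupp.single X.nodeZ (d : ℤ)) p) :=
        S.isLinearSeriesZ.1 hh p
      have hp' := (X.Z.ordSystem.ge_iff hh0).1 hp
      rw [Finsupp.add_apply, Finsupp.single_apply] at hp'
      rw [X.Z.ordSystem.ge_iff hh0, Finsupp.add_apply, Finsupp.single_apply]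
      split_ifs at hp' ⊢ with h5
      · subst h5
        omega
      · omega)
  rw [Finset.card_image_of_injective _ (sub_left_injective)] at hcardY hcardZ
  rw [Finset.card_image_of_injective _ haZ] at hcardZ
  have hunion : (JY ∪ JZ).card = r + 1 := by
    have : JY ∪ JZ = Finset.univ := by
      ext j
      simp only [JY, JZ, Finset.mem_union, Finset.mem_filter, Finset.mem_univ, true_and, iff_true]
      have := S.le_add j
      omega
    rw [this, Finset.card_univ, Fintype.card_fin]
  have hinter := Finset.card_union_add_card_inter JY JZ
  by_cases hmem : (m : ℤ) ∈ JY.image S.aY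
  · obtain ⟨j, hj, hjm⟩ := Finset.mem_image.1 hmem
    have hpos : 0 < (JY ∩ JZ).card := Finset.card_pos.2 ⟨j, Finset.mem_inter.2 ⟨hj, by
      have := S.le_add j
      simp only [JZ, Finset.mem_filter, Finset.mem_univ, true_and]
      omega⟩⟩
    rw [Finset.insert_eq_of_mem hmem, Finset.card_image_of_injective _ haY] at hcardY
    omega
  · rw [Finset.card_insert_of_notMem hmem, Finset.card_image_of_injective _ haY] at hcardY
    omega

end NodalCurve

end AbelLLS

end

theorem proposition6p1 {k : Type*} [Field k] [IsAlgClosed k] (X : AbelLLS.NodalCurve k)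
    (d r : ℕ) (L : X.LineBundle) (hY : X.Y.deg L.divY = d) (hZ : X.Z.deg L.divZ = 0)
    (h : ∃ C ∈ irreducibleComponents (X.abelFiber d L), topologicalKrullDim C < r) :
    IsEmpty (X.LimitLinearSeries d r L) ∧ IsEmpty (X.EHLimitLinearSeries d r L) := by
  obtain ⟨C, hC, hdim⟩ := h
  obtain ⟨m, hmd, hne, hsub, hf⟩ := X.exists_fiberPart_subset hY hZ hC
  exact ⟨⟨fun S => absurd (X.le_topologicalKrullDim hY hZ hne hsub
      (S.le_finrank_add_finrank hmd hf)) (not_le.2 hdim)⟩,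
    ⟨fun S => absurd (X.le_topologicalKrullDim hY hZ hne hsub
      (S.le_finrank_add_finrank hf)) (not_le.2 hdim)⟩⟩
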